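/- Let $n\ge 1$, $T>0$, $s\ge 1$. Consider the Cauchy problem on $[0,T]\times\mathbb R^n$ $$\partial_t^2u-\sum_{i=1}^n a_i(t)\partial_{x_i}^2u+\sum_{i=1}^n c_i(t)\partial_{x_i}u+d(t)\partial_tu+e(t)u=f(t,x),\qquad u(0,\cdot)=g_0,\quad \partial_tu(0,\cdot)=g_1,$$ where $a_i$ are real-valued distributions on $\mathbb R$ with $a_i\ge 0$, $c_i,d,e$ are complex-valued distributions on $\mathbb R$, all with support contained in $[0,T]$, $f\in C([0,T];\gamma^s_c(\mathbb R^n))$ and $g_0,g_1\in\gamma^s_c(\mathbb R^n)$ (compactly supported Gevrey functions of order $s$). **Definitions.** Nets are indexed by $\varepsilon\in(0,1]$. A *positive net* is $\omega(\varepsilon)\to0$ ($\varepsilon\to 0$) with $k_2\varepsilon^p\le\omega(\varepsilon)\le k_1$ on $(0,1]$ for some $k_1,k_2,p>0$; it is a *scale of logarithmic type* with exponent $r$ if moreover $\omega(\varepsilon)^{-1}=\kappa(\ln\varepsilon^{-1})^r$ for all small $\varepsilon$, for some $\kappa>0$. For $\psi\in C_c^\infty(\mathbb R)$, $\psi\ge0$,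 $\int\psi=1$, put $\psi_\omega(t)=\omega^{-1}\psi(t/\omega)$; for $\varphi\in\mathcal S(\mathbb R^n)$ with $\int\varphi=1$ and $\int x^\alpha\varphi\,dx=0$ for all $\alpha\ne0$, put $\varphi_\rho(x)=\rho^{-n}\varphi(x/\rho)$. A net $(v_\varepsilon)$ in $C^\infty(\mathbb R)$ is *moderate* if for all compact $K$ and all $k\in\mathbb N$ there are $N\in\mathbb N$, $C>0$ with $|\partial^kv_\varepsilon|\le C\varepsilon^{-N}$ on $K$ for all $\varepsilon\in(0,1]$. A net $(v_\varepsilon)$ in $C^\infty(\mathbb R^n)$ is *$\gamma^s$-moderate* if for all compact $K$ there are $N\in\mathbb N$, $C>0$ with $|\partial^\alpha v_\varepsilon(x)|\le C^{|\alpha|+1}(\alpha!)^s\varepsilon^{-N-|\alpha|}$ for all $\alpha$, $x\in K$, $\varepsilon\in(0,1]$. A net of smooth functions on $[0,T]\times\mathbb R^n$ is *$C^\infty([0,T];\gamma^s(\mathbb R^n))$-moderate* if for all compact $K$ there are $N\in\mathbb N$, $C>0$ and, for all $k\in\mathbb N$, there are $N_k\in\mathbb N$, $C_k>0$ with $|\partial_t^k\partial_x^\alpha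 v_\varepsilon(t,x)|\le C_k\varepsilon^{-N_k}C^{|\alpha|+1}(\alpha!)^s\varepsilon^{-N-|\alpha|}$ for all $\alpha$, $t\in[0,T]$, $x\in K$, $\varepsilon\in(0,1]$. A net $(u_\varepsilon)$ is a *very weak solution of order $s$*, realised by given regularisations of the coefficients, of $f$ and of $g_0,g_1$, if the regularised coefficients are moderate, the regularisations of $f$ are $C^\infty([0,T];\gamma^s)$-moderate, those of $g_0,g_1$ are $\gamma^s$-moderate, $u_\varepsilon$ solves the regularised Cauchy problem on $[0,T]\times\mathbb R^n$ for every $\varepsilon\in(0,1]$, and $(u_\varepsilon)$ is $C^\infty([0,T];\gamma^s)$-moderate. **Hypothesis.** Let $\psi,\varphi$ be as above, let $\rho$ be a positive net, and let the coefficients be regularised at scales of logarithmic type: $a_{i,\varepsilon}=a_i*\psi_{\omega(\varepsilon)}$, $c_{i,\varepsilon}=c_i*\psi_{\nu_c(\varepsilon)}$, $d_\varepsilon=d*\psi_{\nu_d(\varepsilon)}$, $e_\varepsilon=e*\psi_{\nu_e(\varepsilon)}$, where $\omega,\nu_c,\nu_d,\nu_e$ are (possibly equal) scales of logarithmic type with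 exponents $r,r_c,r_d,r_e>0$. Assume that there are $c_1,c_2,R>0$ such that for all sufficiently small $\varepsilon$, all $t\in[0,T]$ and all $|\xi|\ge R$ $$\Big|\,\mathrm i\sum_{i=1}^n c_{i,\varepsilon}(t)\xi_i+e_\varepsilon(t)\Big|^2\le c_1(\ln\varepsilon^{-1})^2\Big(2\sum_{i=1}^n a_{i,\varepsilon}(t)\xi_i^2\Big),\qquad |d_\varepsilon(t)|^2\le c_2(\ln\varepsilon^{-1})^2 .$$ **Conclusion.** The Cauchy problem has a very weak solution of order $s$. More precisely, there are $\theta\in(0,1]$, with $\theta=1$ if $r<1$, and $h:(0,1]\to(0,1]$ with $h(\varepsilon)=\exp(-(\ln\varepsilon^{-1})^\theta)$ for all small $\varepsilon$ (so $h(\varepsilon)=\varepsilon$ for small $\varepsilon$ if $\theta=1$), such that $\omega\circ h,\nu_c\circ h,\nu_d\circ h,\nu_e\circ h$ are scales of logarithmic type with exponents $\theta r,\theta r_c,\theta r_d,\theta r_e$, and there is a very weak solution $(u_\varepsilon)$ of order $s$ realised by the regularised coefficients $a_{i,h(\varepsilon)},c_{i,h(\varepsilon)},d_{h(\varepsilon)},e_{h(\varepsilon)}$,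 the right-hand sides $f*(\psi_{\rho(\varepsilon)}\otimes\varphi_{\rho(\varepsilon)})$ (with $f$ extended by $f(0,\cdot)$ for $t<0$ and by $f(T,\cdot)$ for $t>T$) and the initial data $g_0*\varphi_{\rho(\varepsilon)}$, $g_1*\varphi_{\rho(\varepsilon)}$. -/

import Mathlib

open Set Filter MeasureTheory
open scoped Distributions ContDiff SchwartzMap Topology

noncomputable section

namespace VeryWeakWave

/-! ### Partial derivatives and Gevrey functions -/

/-- The space `ℝⁿ` with its Euclidean norm. -/
abbrev Space (n : ℕ) : Type := EuclideanSpace ℝ (Fin n)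

/-- The partial derivative `∂_{x_i} v`. -/
def pderiv {n : ℕ} (i : Fin n) (v : Space n → ℂ) : Space n → ℂ :=
  fun x => lineDeriv ℝ v x (EuclideanSpace.single i 1)

/-- The derivative `∂^α v = ∂_{x_1}^{α_1} ⋯ ∂_{x_n}^{α_n} v` for a multi-index `α`. -/
def mderiv {n : ℕ} (α : Fin n → ℕ) (v : Space n → ℂ) : Space n → ℂ :=
  (List.finRange n).foldr (fun i w => (pderiv i)^[α i] w) v

/-- The length `|α|` of a multi-index. -/
def order {n : ℕ} (α : Fin n → ℕ) : ℕ := ∑ i, α i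

/-- The Gevrey weight `(α!)^s`. -/
def weight {n : ℕ} (s : ℝ) (α : Fin n → ℕ) : ℝ := (∏ i, (Nat.factorial (α i) : ℝ)) ^ s

/-- `g ∈ γ^s(ℝⁿ)`. -/
def IsGevrey {n : ℕ} (s : ℝ) (g : Space n → ℂ) : Prop :=
  ContDiff ℝ ∞ g ∧ ∀ K : Set (Space n), IsCompact K → ∃ C > (0 : ℝ), ∀ α : Fin n → ℕ, ∀ x ∈ K,
    ‖mderiv α g x‖ ≤ C ^ (order α + 1) * weight s α

/-- `g ∈ γ_c^s(ℝⁿ)`. -/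
def IsGevreyCompact {n : ℕ} (s : ℝ) (g : Space n → ℂ) : Prop :=
  IsGevrey s g ∧ HasCompactSupport g

/-- `f ∈ C([0,T]; γ_c^s(ℝⁿ))`. The space `γ_c^s(ℝⁿ)` is the inductive limit, over compact sets `K`
and constants `A > 0`, of the Banach spaces of smooth functions supported in `K` with norm
`sup_{α, x} |∂^α g(x)| / (A^{|α|} (α!)^s)`. The limit is compactly regular, so that a map from the
compact interval `[0,T]` is continuous iff it is continuous into one of these Banach spaces. -/
def IsContinuousGevreyCompact {n : ℕ} (s T : ℝ) (f : ℝ → Space n → ℂ) : Prop :=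
  ∃ K : Set (Space n), IsCompact K ∧ ∃ A > (0 : ℝ),
    (∀ t ∈ Icc 0 T, ContDiff ℝ ∞ (f t) ∧ tsupport (f t) ⊆ K ∧
      ∃ C : ℝ, ∀ α x, ‖mderiv α (f t) x‖ ≤ C * A ^ order α * weight s α) ∧
    ∀ t ∈ Icc 0 T, ∀ δ > (0 : ℝ), ∀ᶠ t' in 𝓝[Icc 0 T] t, ∀ α x,
      ‖mderiv α (f t') x - mderiv α (f t) x‖ ≤ δ * A ^ order α * weight s α

/-! ### Moderate nets

Nets are indexed by `ε ∈ (0,1]`; they are written as functions of `ε : ℝ`, and only the values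
at `ε ∈ (0,1]` are ever used. -/

/-- `C^∞`-moderate nets of functions of `t ∈ ℝ`. -/
def IsModerate {F : Type*} [NormedAddCommGroup F] [NormedSpace ℝ F] (v : ℝ → ℝ → F) : Prop :=
  (∀ ε ∈ Ioc (0 : ℝ) 1, ContDiff ℝ ∞ (v ε)) ∧
    ∀ K : Set ℝ, IsCompact K → ∀ k : ℕ, ∃ N : ℕ, ∃ C > (0 : ℝ), ∀ ε ∈ Ioc (0 : ℝ) 1, ∀ t ∈ K,
      ‖iteratedDeriv k (v ε) t‖ ≤ C * ε⁻¹ ^ N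

/-- `γ^s`-moderate nets of functions of `x ∈ ℝⁿ`. -/
def IsGevreyModerate {n : ℕ} (s : ℝ) (g : ℝ → Space n → ℂ) : Prop :=
  (∀ ε ∈ Ioc (0 : ℝ) 1, ContDiff ℝ ∞ (g ε)) ∧
    ∀ K : Set (Space n), IsCompact K → ∃ C > (0 : ℝ), ∃ N : ℕ,
      ∀ α : Fin n → ℕ, ∀ x ∈ K, ∀ ε ∈ Ioc (0 : ℝ) 1,
        ‖mderiv α (g ε) x‖ ≤ C ^ (order α + 1) * weight s α * ε⁻¹ ^ (N + order α)

/-- The derivative `∂_t^k ∂_x^α u(t,x)` on `[0,T] × ℝⁿ` (one-sided in `t` at the end points). -/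
def mixedDeriv {n : ℕ} (T : ℝ) (k : ℕ) (α : Fin n → ℕ) (u : ℝ → Space n → ℂ)
    (t : ℝ) (x : Space n) : ℂ :=
  mderiv α (fun y => iteratedDerivWithin k (fun τ => u τ y) (Icc 0 T) t) x

/-- `C^∞([0,T]; γ^s(ℝⁿ))`-moderate nets. The smoothness and the bounds together contain the
fact that each member of the net lies in `C^∞([0,T]; γ^s(ℝⁿ))`. -/
def IsSmoothGevreyModerate {n : ℕ} (s T : ℝ) (u : ℝ → ℝ → Space n → ℂ) : Prop :=
  (∀ ε ∈ Ioc (0 : ℝ) 1,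
    ContDiffOn ℝ ∞ (fun p : ℝ × Space n => u ε p.1 p.2) (Icc 0 T ×ˢ univ)) ∧
    ∀ K : Set (Space n), IsCompact K → ∃ N : ℕ, ∃ C > (0 : ℝ), ∀ k : ℕ, ∃ Nk : ℕ, ∃ Ck > (0 : ℝ),
      ∀ α : Fin n → ℕ, ∀ t ∈ Icc 0 T, ∀ x ∈ K, ∀ ε ∈ Ioc (0 : ℝ) 1,
        ‖mixedDeriv T k α (u ε) t x‖ ≤
          Ck * ε⁻¹ ^ Nk * (C ^ (order α + 1) * weight s α * ε⁻¹ ^ (N + order α))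

/-! ### Mollifiers, scales and regularisations -/

/-- A nonnegative Friedrichs mollifier on `ℝ`. -/
def IsFriedrichsMollifier (ψ : 𝓓((⊤ : TopologicalSpace.Opens ℝ), ℝ)) : Prop :=
  (∀ t, 0 ≤ ψ t) ∧ ∫ t, ψ t = 1

/-- A Schwartz mollifier on `ℝⁿ` all of whose moments of positive order vanish. -/
def IsMomentMollifier {n : ℕ} (φ : 𝓢(Space n, ℂ)) : Prop :=
  ∫ x, φ x = 1 ∧ ∀ α : Fin n → ℕ, α ≠ 0 → ∫ x : Space n, (∏ i, (x i : ℂ) ^ α i) * φ x = 0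

/-- Positive nets: `c₂ ε^p ≤ μ(ε) ≤ c₁` for `ε ∈ (0,1]`, and `μ(ε) → 0` as `ε → 0`. -/
def IsPositiveNet (μ : ℝ → ℝ) : Prop :=
  (∃ p > (0 : ℝ), ∃ c₁ > (0 : ℝ), ∃ c₂ > (0 : ℝ), ∀ ε ∈ Ioc (0 : ℝ) 1, c₂ * ε ^ (p : ℝ) ≤ μ ε ∧ μ ε ≤ c₁) ∧
    Tendsto μ (𝓝[>] 0) (𝓝 0)

/-- Scales of logarithmic type with exponent `r`: positive nets such that
`μ(ε)⁻¹ = κ (ln ε⁻¹)^r` for all small `ε`. -/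
def IsLogScale (r : ℝ) (μ : ℝ → ℝ) : Prop :=
  IsPositiveNet μ ∧ ∃ κ > (0 : ℝ), ∀ᶠ ε in 𝓝[>] (0 : ℝ), μ ε = (κ * Real.log ε⁻¹ ^ r)⁻¹

/-- The test function `τ ↦ ψ_μ(t - τ)`, where `ψ_μ(t) = μ⁻¹ ψ(t / μ)`, for `μ > 0`
(and `0` otherwise). -/
def mollifierAt (ψ : 𝓓((⊤ : TopologicalSpace.Opens ℝ), ℝ)) (μ t : ℝ) :
    𝓓((⊤ : TopologicalSpace.Opens ℝ), ℝ) :=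
  if h : 0 < μ then
    { toFun := fun τ => μ⁻¹ * ψ ((t - τ) / μ)
      contDiff' := by
        refine contDiff_const.mul (ψ.contDiff.comp ?_)
        exact (contDiff_const.sub contDiff_id).div_const μ
      hasCompactSupport' := by
        refine HasCompactSupport.mul_left ?_
        have e : (fun τ : ℝ => ψ ((t - τ) / μ)) =
            ψ ∘ ((Homeomorph.subLeft t).trans (Homeomorph.mulRight₀ μ⁻¹ (by positivity))) := by
          funext τ
          simp [div_eq_mul_inv]
        rw [e]
        exact ψ.hasCompactSupport.comp_homeomorph _
      tsupport_subset' := fun _ _ => trivial }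
  else 0

/-- The regularisation `(v ∗ ψ_μ)(t) = v(ψ_μ(t - ·))` of a distribution `v` on `ℝ`. -/
def mollify {F : Type*} [NormedAddCommGroup F] [NormedSpace ℝ F]
    (ψ : 𝓓((⊤ : TopologicalSpace.Opens ℝ), ℝ)) (μ : ℝ)
    (v : 𝓓'((⊤ : TopologicalSpace.Opens ℝ), F)) (t : ℝ) : F :=
  v (mollifierAt ψ μ t)

/-- `φ_ρ(x) = ρ^{-n} φ(x / ρ)`. -/
def scaled {n : ℕ} (φ : 𝓢(Space n, ℂ)) (ρ : ℝ) (x : Space n) : ℂ :=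
  ((ρ ^ n)⁻¹ : ℝ) * φ (ρ⁻¹ • x)

/-- The regularisation `g ∗ φ_ρ` of a function on `ℝⁿ`. -/
def mollifyData {n : ℕ} (φ : 𝓢(Space n, ℂ)) (ρ : ℝ) (g : Space n → ℂ) (x : Space n) : ℂ :=
  ∫ y, g y * scaled φ ρ (x - y)

/-- The regularisation `f ∗ (ψ_ρ ⊗ φ_ρ)` in `(t,x)` of a function on `[0,T] × ℝⁿ`, extended to
`ℝ × ℝⁿ` by `f(t,x) = f(0,x)` for `t < 0` and `f(t,x) = f(T,x)` for `t > T`. -/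
def mollifySource {n : ℕ} (T : ℝ) (ψ : 𝓓((⊤ : TopologicalSpace.Opens ℝ), ℝ))
    (φ : 𝓢(Space n, ℂ)) (ρ : ℝ) (f : ℝ → Space n → ℂ) (t : ℝ) (x : Space n) : ℂ :=
  ∫ τ, ((ρ⁻¹ * ψ ((t - τ) / ρ) : ℝ) : ℂ) * mollifyData φ ρ (f (max 0 (min T τ))) x

/-! ### The Cauchy problem -/

/-- `u` solves on `[0,T] × ℝⁿ` the Cauchy problem
`∂_t² u - ∑ a_i(t) ∂_{x_i}² u + ∑ c_i(t) ∂_{x_i} u + d(t) ∂_t u + e(t) u = f`,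
`u(0,·) = g₀`, `∂_t u(0,·) = g₁`. -/
def SolvesCauchyProblem {n : ℕ} (T : ℝ) (a : Fin n → ℝ → ℝ) (c : Fin n → ℝ → ℂ) (d e : ℝ → ℂ)
    (f : ℝ → Space n → ℂ) (g₀ g₁ : Space n → ℂ) (u : ℝ → Space n → ℂ) : Prop :=
  (∀ t ∈ Icc 0 T, ∀ x,
    iteratedDerivWithin 2 (fun τ => u τ x) (Icc 0 T) t
      - ∑ i, (a i t : ℂ) * pderiv i (pderiv i (u t)) x
      + (∑ i, c i t * pderiv i (u t) x
        + d t * derivWithin (fun τ => u τ x) (Icc 0 T) t + e t * u t x) = f t x) ∧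
    (∀ x, u 0 x = g₀ x) ∧
    ∀ x, derivWithin (fun τ => u τ x) (Icc 0 T) 0 = g₁ x

/-- The net `u` is a very weak solution of order `s`, realised by the given nets of regularised
coefficients, right-hand sides and initial data: these are moderate, `u` is
`C^∞([0,T]; γ^s(ℝⁿ))`-moderate, and `u_ε` solves the `ε`-regularised problem for every
`ε ∈ (0,1]`. -/
structure IsVeryWeakSolution {n : ℕ} (s T : ℝ) (a : ℝ → Fin n → ℝ → ℝ) (c : ℝ → Fin n → ℝ → ℂ)
    (d e : ℝ → ℝ → ℂ) (f : ℝ → ℝ → Space n → ℂ) (g₀ g₁ : ℝ → Space n → ℂ)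
    (u : ℝ → ℝ → Space n → ℂ) : Prop where
  moderate_a : ∀ i, IsModerate (fun ε => a ε i)
  moderate_c : ∀ i, IsModerate (fun ε => c ε i)
  moderate_d : IsModerate d
  moderate_e : IsModerate e
  moderate_f : IsSmoothGevreyModerate s T f
  moderate_g₀ : IsGevreyModerate s g₀
  moderate_g₁ : IsGevreyModerate s g₁
  solves : ∀ ε ∈ Ioc (0 : ℝ) 1,
    SolvesCauchyProblem T (a ε) (c ε) (d ε) (e ε) (f ε) (g₀ ε) (g₁ ε) (u ε)
  moderate : IsSmoothGevreyModerate s T u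

/-- The Levi conditions for nets of regularised coefficients: for all small `ε`, all
`t ∈ [0,T]` and all `|ξ| ≥ R`, with `c₁, c₂, R` independent of `ε`, `t` and `ξ`. -/
def LeviConditions {n : ℕ} (T : ℝ) (a : ℝ → Fin n → ℝ → ℝ) (c : ℝ → Fin n → ℝ → ℂ)
    (d e : ℝ → ℝ → ℂ) : Prop :=
  ∃ c₁ > (0 : ℝ), ∃ c₂ > (0 : ℝ), ∃ R > (0 : ℝ), ∀ᶠ ε in 𝓝[>] (0 : ℝ), ∀ t ∈ Icc 0 T,
    (∀ ξ : Space n, R ≤ ‖ξ‖ →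
      ‖Complex.I * ∑ i, c ε i t * (ξ i : ℂ) + e ε t‖ ^ 2 ≤
        c₁ * Real.log ε⁻¹ ^ 2 * (2 * ∑ i, a ε i t * ξ i ^ 2)) ∧
    ‖d ε t‖ ^ 2 ≤ c₂ * Real.log ε⁻¹ ^ 2

end VeryWeakWave

end

noncomputable section

namespace VeryWeakWave

/-! The Fourier transform in `x` turns the regularised problem into the ordinary differential
equations v'' + A v + (b + e) v + d v' = F, one for each ξ, with A = ∑ a_i(t) (2πξ_i)² ≥ 0 and b = ∑
c_i(t) 2πi ξ_i. Put Y = 1 + |ξ| and let Λ be of size log ε⁻¹. Compactly supported Gevrey data and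
sources have transforms of size exp(-γ Y^{1/s}) (`exists_fourier_decay`), and any such decay with a
rate independent of ε gives Gevrey bounds back (`exists_norm_mderiv_synth_le`). It therefore
suffices to bound |v|² + |v'|² by exp(MΛ + γ Y^{1/s}) times squared data, up to polynomial factors:
the squared data decay at rate 2γ, so the rate γ/2 survives for v, and exp(MΛ) is a power of ε⁻¹.

The energy is E = |v'|² + (A + m²)|v|² with m ≥ Λ (`energy_estimate`). In E' the terms with A⟨v,v'⟩
cancel. The Levi conditions give |b| ≤ CΛ√A, |e| ≤ CΛ² ≤ CΛm and |d| ≤ CΛ, so the lower order terms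
cost O(Λ)E. The remaining term A'|v|² costs the factor exp ∫|A'|/(A + m²), the total variation of
log(A + m²).

The heart of the proof is that this variation is at most KΛ + τY^{1/s} with τ as small as desired
(`exists_integral_logDeriv_le`). On a short interval A is within m²/4 of a polynomial of degree k,
and the logarithm of a positive polynomial has at most k interior critical points, so the variation
there is O(k log) (`integral_logDeriv_le_of_short`). The number of intervals needed is about the
(k+1)-st root of the derivative of order k+1 of A. Each time derivative of a coefficient regularised
at a scale of logarithmic type with exponent r costs Λ^r, so this root is Λ^r up to small powers of
Λ and Y that vanish as k grows. If r < 1, Young's inequality concludes. If r ≥ 1, the substitution ε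
↦ exp(-(log ε⁻¹)^θ) replaces r by θr < 1; it only weakens the Levi bounds, because Λ^θ ≤ Λ.

The Levi condition couples c and e. Evaluated at ξ and -ξ, the parallelogram law separates them,
homogeneity extends the bound on b to all ξ, and the bound on e reduces to one on a_i, which is
O(μ⁻¹) because nonnegative distributions have order zero. Higher time derivatives of v come from
differentiating the equation, and the solution is recovered by Fourier synthesis
(`solvesCauchyProblem_synth`). -/

/-! ### Total variation of the logarithm of a nonnegative smooth function -/

/-- The integral of `|g'|` over an interval is controlled by the oscillation of `g` and the number
of zeros of `g'`. -/
theorem integral_abs_deriv_le_of_zeros {g g' : ℝ → ℝ} {M : ℝ} (Z : Finset ℝ) {a b : ℝ}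
    (hab : a ≤ b) (hg : ∀ x ∈ Icc a b, HasDerivAt g (g' x) x) (hc : ContinuousOn g' (Icc a b))
    (hM : ∀ x ∈ Icc a b, |g x| ≤ M) (hZ : ∀ x ∈ Ioo a b, g' x = 0 → x ∈ Z) :
    ∫ x in a..b, |g' x| ≤ 2 * M * (Z.card + 1) := by
  induction hn : Z.card using Nat.strong_induction_on generalizing Z a b with
  | _ N ih =>
  have hM0 : 0 ≤ M := (abs_nonneg _).trans (hM a ⟨le_rfl, hab⟩)
  have hint : ∀ {u v}, a ≤ u → u ≤ v → v ≤ b → IntervalIntegrable g' volume u v :=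
    fun {u v} h1 h2 h3 => ContinuousOn.intervalIntegrable_of_Icc h2
      (hc.mono (Icc_subset_Icc h1 h3))
  by_cases hz : ∃ z ∈ Ioo a b, g' z = 0
  · obtain ⟨z, hz, hz0⟩ := hz
    have hzZ := hZ z hz hz0
    -- Splitting at a zero z removes z from both halves of Z. This pays for the second `+ 1` when
    -- the two bounds are added.
    have hsum : (Z.filter (· < z)).card + (Z.filter (z < ·)).card + 1 ≤ Z.card := by
      have h1 : Disjoint (Z.filter (· < z)) (Z.filter (z < ·)) := by
        rw [Finset.disjoint_filter]
        intro x _ h1 h2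
        exact lt_asymm h1 h2
      rw [← Finset.card_union_of_disjoint h1]
      refine Finset.card_lt_card ((Finset.ssubset_iff_of_subset ?_).2 ⟨z, hzZ, ?_⟩)
      · intro x hx
        simp only [Finset.mem_union, Finset.mem_filter] at hx
        tauto
      · simp
    have h1 := ih _ (by omega) (Z.filter (· < z)) hz.1.le
      (fun x hx => hg x ⟨hx.1, hx.2.trans hz.2.le⟩)
      (hc.mono (Icc_subset_Icc le_rfl hz.2.le))
      (fun x hx => hM x ⟨hx.1, hx.2.trans hz.2.le⟩)
      (fun x hx h0 => Finset.mem_filter.2 ⟨hZ x ⟨hx.1, hx.2.trans hz.2⟩ h0, hx.2⟩) rfl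
    have h2 := ih _ (by omega) (Z.filter (z < ·)) hz.2.le
      (fun x hx => hg x ⟨hz.1.le.trans hx.1, hx.2⟩)
      (hc.mono (Icc_subset_Icc hz.1.le le_rfl))
      (fun x hx => hM x ⟨hz.1.le.trans hx.1, hx.2⟩)
      (fun x hx h0 => Finset.mem_filter.2 ⟨hZ x ⟨hz.1.trans hx.1, hx.2⟩ h0, hx.1⟩) rfl
    rw [← intervalIntegral.integral_add_adjacent_intervals (b := z)
      (hint le_rfl hz.1.le hz.2.le).abs (hint hz.1.le hz.2.le le_rfl).abs]
    have h3 : ((Z.filter (· < z)).card : ℝ) + (Z.filter (z < ·)).card + 1 ≤ N := by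
      rw [← hn]; exact_mod_cast hsum
    nlinarith
  · push Not at hz
    -- Without interior zeros g' has constant sign by the intermediate value theorem, so the
    -- integral is |g(b) - g(a)| ≤ 2M.
    have key : |∫ x in a..b, g' x| = ∫ x in a..b, |g' x| := by
      rcases hab.eq_or_lt with rfl | hab'
      · simp
      have hpre : IsPreconnected (Ioo a b) := isPreconnected_Ioo
      have hcl : ∀ x ∈ Icc a b, x ∈ closure (Ioo a b) := by
        intro x hx; rwa [closure_Ioo hab'.ne]
      by_cases hpos : ∃ x ∈ Ioo a b, 0 < g' x
      · obtain ⟨x, hx, hx0⟩ := hpos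
        have : ∀ y ∈ Ioo a b, 0 ≤ g' y := by
          intro y hy
          by_contra! hy0
          obtain ⟨w, hw, hw0⟩ := hpre.intermediate_value hy hx
            (hc.mono Ioo_subset_Icc_self) ⟨hy0.le, hx0.le⟩
          exact hz w hw hw0
        have h1 : ∀ x ∈ uIoc a b, x ≠ b → g' x = |g' x| := by
          intro x hx hxb
          rw [uIoc_of_le hab] at hx
          exact (abs_of_nonneg (this x ⟨hx.1, hx.2.lt_of_ne hxb⟩)).symm
        have h2 : ∫ x in a..b, g' x = ∫ x in a..b, |g' x| := by
          refine intervalIntegral.integral_congr_ae ?_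
          filter_upwards [compl_mem_ae_iff.2 (measure_singleton b)] with x hx hx'
          exact h1 x hx' hx
        rw [h2, abs_of_nonneg (intervalIntegral.integral_nonneg hab fun _ _ => abs_nonneg _)]
      · push Not at hpos
        have h2 : ∫ x in a..b, |g' x| = ∫ x in a..b, -g' x := by
          refine intervalIntegral.integral_congr_ae ?_
          filter_upwards [compl_mem_ae_iff.2 (measure_singleton b)] with x hx hx'
          rw [uIoc_of_le hab] at hx'
          exact abs_of_nonpos (hpos x ⟨hx'.1, hx'.2.lt_of_ne hx⟩)
        have h3 : 0 ≤ ∫ x in a..b, |g' x| :=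
          intervalIntegral.integral_nonneg hab fun _ _ => abs_nonneg _
        rw [h2, intervalIntegral.integral_neg] at *
        rw [abs_of_nonpos (by linarith)]
    rw [← key, intervalIntegral.integral_eq_sub_of_hasDerivAt
      (fun x hx => hg x (by rwa [uIcc_of_le hab] at hx)) (hint le_rfl hab le_rfl)]
    have h1 := abs_sub (g b) (g a)
    have h2 := hM a ⟨le_rfl, hab⟩
    have h3 := hM b ⟨hab, le_rfl⟩
    have : (0:ℝ) ≤ N := Nat.cast_nonneg _
    nlinarith

theorem exists_derivative_eq (Q : Polynomial ℝ) :
    ∃ P : Polynomial ℝ, P.derivative = Q ∧ P.natDegree ≤ Q.natDegree + 1 := by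
  refine ⟨∑ i ∈ Finset.range (Q.natDegree + 1), Polynomial.monomial (i + 1) (Q.coeff i / (i + 1)),
    ?_, ?_⟩
  · rw [Polynomial.derivative_sum]
    conv_rhs => rw [Q.as_sum_range]
    refine Finset.sum_congr rfl fun i _ => ?_
    rw [Polynomial.derivative_monomial]
    congr 1
    push_cast
    have : (i : ℝ) + 1 ≠ 0 := by positivity
    field_simp
  · refine Polynomial.natDegree_sum_le_of_forall_le _ _ fun i hi => ?_
    have := Finset.mem_range.1 hi
    exact (Polynomial.natDegree_monomial_le _).trans (by omega)

/-- Polynomial approximation of a smooth function together with its derivative. -/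
theorem exists_polynomial_approx (k : ℕ) {D a b : ℝ} (hab : a ≤ b) {f : ℝ → ℝ}
    (hf : ContDiff ℝ ∞ f) (hD : ∀ x ∈ Icc a b, |iteratedDeriv (k + 1) f x| ≤ D) :
    ∃ P : Polynomial ℝ, P.natDegree ≤ k ∧ ∀ x ∈ Icc a b,
      |f x - P.eval x| ≤ D * (b - a) ^ (k + 1) ∧
      |deriv f x - P.derivative.eval x| ≤ D * (b - a) ^ k := by
  induction k generalizing f with
  | zero =>
    refine ⟨Polynomial.C (f a), by simp, fun x hx => ?_⟩
    simp only [zero_add, iteratedDeriv_one] at hD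
    have hd : Differentiable ℝ f := hf.differentiable (by simp)
    constructor
    · have := Convex.norm_image_sub_le_of_norm_deriv_le (f := f) (C := D) (x := a) (y := x)
        (fun y _ => hd y) hD (convex_Icc a b) ⟨le_rfl, hab⟩ hx
      rw [Real.norm_eq_abs, Real.norm_eq_abs, abs_of_nonneg (sub_nonneg.2 hx.1)] at this
      have hD0 : 0 ≤ D := (abs_nonneg _).trans (hD x hx)
      simp only [Polynomial.eval_C, zero_add, pow_one]
      nlinarith [hx.2]
    · simpa using hD x hx
  | succ k ih =>
    have hd : Differentiable ℝ f := hf.differentiable (by simp)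
    have hf' : ContDiff ℝ ∞ (deriv f) := (contDiff_infty_iff_deriv.1 hf).2
    obtain ⟨Q, hQ, hQa⟩ := ih hf' (by
      intro x hx
      have := hD x hx
      rwa [iteratedDeriv_succ'] at this)
    obtain ⟨P, hP, hPd⟩ := exists_derivative_eq Q
    -- Integrate the approximation of f' and normalise the error to vanish at a. The mean value
    -- inequality then gains one factor b - a.
    refine ⟨P + Polynomial.C (f a - P.eval a), ?_, fun x hx => ?_⟩
    · refine (Polynomial.natDegree_add_C).le.trans (by omega)
    · have h2 : ∀ y, HasDerivAt (fun y => f y - P.eval y) (deriv f y - Q.eval y) y := by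
        intro y
        have := (hd y).hasDerivAt.sub (P.hasDerivAt y)
        rwa [hP] at this
      have := Convex.norm_image_sub_le_of_norm_hasDerivWithin_le
        (f := fun y => f y - P.eval y) (C := D * (b - a) ^ (k + 1)) (x := a) (y := x)
        (fun y _ => (h2 y).hasDerivWithinAt) (fun y hy => (hQa y hy).1) (convex_Icc a b)
        ⟨le_rfl, hab⟩ hx
      rw [Real.norm_eq_abs, Real.norm_eq_abs, abs_of_nonneg (sub_nonneg.2 hx.1)] at this
      have hD0 : 0 ≤ D := (abs_nonneg _).trans (hD x hx)
      constructor
      · have e : f x - (P + Polynomial.C (f a - P.eval a)).eval x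
            = f x - P.eval x - (f a - P.eval a) := by simp; ring
        rw [e]
        refine this.trans ?_
        rw [pow_succ _ (k + 1), ← mul_assoc]
        have : 0 ≤ D * (b - a) ^ (k + 1) := mul_nonneg hD0 (pow_nonneg (sub_nonneg.2 hab) _)
        gcongr
        exact hx.2
      · simpa [hP] using (hQa x hx).1

/-- The smallness condition puts f within δ/4 of a polynomial P of degree at most k, so P + δ stays
above 3δ/4 and below 5/4 (f + δ). The variation of log((P + δ)/δ) is controlled by counting the
roots of P', and the error in the derivative contributes at most 1/4 to the integral. -/
theorem integral_logDeriv_le_of_short {k : ℕ} {D M δ a b : ℝ} (hab : a ≤ b) {f : ℝ → ℝ}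
    (hf : ContDiff ℝ ∞ f) (hδ : 0 < δ) (h0 : ∀ x ∈ Icc a b, 0 ≤ f x)
    (hM : ∀ x ∈ Icc a b, f x ≤ M) (hD : ∀ x ∈ Icc a b, |iteratedDeriv (k + 1) f x| ≤ D)
    (hl : 4 * (D * (b - a) ^ (k + 1)) ≤ δ) :
    ∫ x in a..b, |deriv f x| / (f x + δ) ≤ 5 * (k + 2) * Real.log (2 + M / δ) := by
  obtain ⟨P, hP, hPa⟩ := exists_polynomial_approx k hab hf hD
  have hd : Differentiable ℝ f := hf.differentiable (by simp)
  have hfc : Continuous f := hf.continuous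
  have hfc' : Continuous (deriv f) := (contDiff_infty_iff_deriv.1 hf).2.continuous
  have hD0 : 0 ≤ D := (abs_nonneg _).trans (hD a ⟨le_rfl, hab⟩)
  have hM0 : 0 ≤ M := (h0 a ⟨le_rfl, hab⟩).trans (hM a ⟨le_rfl, hab⟩)
  have hQlow : ∀ x ∈ Icc a b, 3 / 4 * δ ≤ P.eval x + δ := by
    intro x hx
    have := abs_le.1 (hPa x hx).1
    have := h0 x hx
    linarith
  have hQup : ∀ x ∈ Icc a b, P.eval x + δ ≤ 5 / 4 * (f x + δ) := by
    intro x hx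
    have := abs_le.1 (hPa x hx).1
    have := h0 x hx
    linarith
  have hQpos : ∀ x ∈ Icc a b, 0 < P.eval x + δ := fun x hx => by
    have := hQlow x hx; linarith
  have hratio : ∀ x ∈ Icc a b, 0 < (P.eval x + δ) / δ := fun x hx => div_pos (hQpos x hx) hδ
  have hMδ : 0 ≤ M / δ := by positivity
  -- This lower bound lets the additive 1/4 be absorbed at the end.
  have hlog2 : 1 / 2 ≤ Real.log (2 + M / δ) := by
    have := Real.log_two_gt_d9
    have h2 := Real.log_le_log (by norm_num : (0:ℝ) < 2) (by linarith : (2:ℝ) ≤ 2 + M / δ)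
    linarith
  have hlogs : ∀ x ∈ Icc a b, |Real.log ((P.eval x + δ) / δ)| ≤ Real.log (2 + M / δ) := by
    intro x hx
    rw [abs_le]
    constructor
    · rw [← Real.log_inv]
      refine Real.log_le_log (by positivity) ?_
      rw [le_div_iff₀ hδ]
      have : (2 + M / δ)⁻¹ ≤ 1 / 2 := by
        rw [inv_le_comm₀ (by positivity) (by norm_num)]
        norm_num
        exact hMδ
      have := hQlow x hx
      nlinarith
    · refine Real.log_le_log (hratio x hx) ?_
      rw [div_le_iff₀ hδ, add_mul, div_mul_cancel₀ _ hδ.ne']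
      have := abs_le.1 (hPa x hx).1
      have := hM x hx
      linarith
  have hQint : ∫ x in a..b, |P.derivative.eval x / (P.eval x + δ)|
      ≤ 2 * Real.log (2 + M / δ) * (k + 1) := by
    -- The zero polynomial has an empty multiset of roots by convention, so the root count does not
    -- see this case.
    by_cases hP0 : P.derivative = 0
    · simp only [hP0, Polynomial.eval_zero, zero_div, abs_zero, intervalIntegral.integral_zero]
      positivity
    have hcard : (P.derivative.roots.toFinset.card : ℝ) ≤ k := by
      have h1 := Multiset.toFinset_card_le P.derivative.roots
      have h2 := P.derivative.card_roots'
      have h3 := P.natDegree_derivative_le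
      exact_mod_cast (by omega)
    have := integral_abs_deriv_le_of_zeros (g := fun x => Real.log ((P.eval x + δ) / δ))
      (g' := fun x => P.derivative.eval x / (P.eval x + δ)) (M := Real.log (2 + M / δ))
      P.derivative.roots.toFinset hab ?_ ?_ hlogs ?_
    · refine this.trans ?_
      gcongr
    · intro x hx
      have h1 := (((P.hasDerivAt x).add_const δ).div_const δ).log (hratio x hx).ne'
      convert h1 using 1
      field_simp
    · exact P.derivative.continuous.continuousOn.div (by fun_prop) fun x hx => (hQpos x hx).ne'
    · intro x hx h0
      have hx' := hQpos x (Ioo_subset_Icc_self hx)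
      rw [div_eq_zero_iff, or_iff_left hx'.ne'] at h0
      rw [Multiset.mem_toFinset, Polynomial.mem_roots hP0]
      exact h0
  have hcont : ContinuousOn (fun x => |P.derivative.eval x / (P.eval x + δ)|) (Icc a b) :=
    (P.derivative.continuous.continuousOn.div (by fun_prop) fun x hx => (hQpos x hx).ne').abs
  have hfpos : ∀ x ∈ Icc a b, 0 < f x + δ := fun x hx => by have := h0 x hx; linarith
  have hmono : ∫ x in a..b, |deriv f x| / (f x + δ) ≤
      ∫ x in a..b, (5 / 4 * |P.derivative.eval x / (P.eval x + δ)| + D * (b - a) ^ k / δ) := by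
    refine intervalIntegral.integral_mono_on hab ?_ ?_ fun x hx => ?_
    · exact ContinuousOn.intervalIntegrable_of_Icc hab
        (hfc'.abs.continuousOn.div (by fun_prop) fun x hx => (hfpos x hx).ne')
    · exact ContinuousOn.intervalIntegrable_of_Icc hab
        ((continuousOn_const.mul hcont).add continuousOn_const)
    · have h1 : |deriv f x| ≤ |P.derivative.eval x| + D * (b - a) ^ k := by
        have := (hPa x hx).2
        have h3 := abs_sub_abs_le_abs_sub (deriv f x) (P.derivative.eval x)
        linarith
      have h2 := hfpos x hx
      have h3 := hQpos x hx
      have h4 := h0 x hx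
      have hR : 0 ≤ D * (b - a) ^ k := mul_nonneg hD0 (pow_nonneg (sub_nonneg.2 hab) _)
      calc |deriv f x| / (f x + δ) ≤ (|P.derivative.eval x| + D * (b - a) ^ k) / (f x + δ) := by
            gcongr
        _ = |P.derivative.eval x| / (f x + δ) + D * (b - a) ^ k / (f x + δ) := add_div _ _ _
        _ ≤ 5 / 4 * |P.derivative.eval x / (P.eval x + δ)| + D * (b - a) ^ k / δ := by
            gcongr ?_ + ?_
            · rw [abs_div, abs_of_pos h3, ← mul_div_assoc, div_le_div_iff₀ h2 h3]
              have := hQup x hx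
              nlinarith [abs_nonneg (P.derivative.eval x)]
            · gcongr
              linarith
  refine hmono.trans ?_
  rw [intervalIntegral.integral_add ((ContinuousOn.intervalIntegrable_of_Icc hab hcont).const_mul _)
    (by simp), intervalIntegral.integral_const_mul, intervalIntegral.integral_const, smul_eq_mul]
  have h5 : (b - a) * (D * (b - a) ^ k / δ) ≤ 1 / 4 := by
    rw [← mul_div_assoc, div_le_iff₀ hδ]
    rw [pow_succ] at hl
    linarith
  have hk : (0:ℝ) ≤ k := Nat.cast_nonneg k
  nlinarith [mul_nonneg hk (by linarith : 0 ≤ Real.log (2 + M / δ))]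

/-- For a nonnegative smooth function `f` on `[0,T]`, the total variation of `log (f + δ)` grows
like a small power of the derivatives of `f`. -/
theorem integral_logDeriv_le {k N : ℕ} {D M δ T : ℝ} (hT : 0 ≤ T) {f : ℝ → ℝ}
    (hf : ContDiff ℝ ∞ f) (hδ : 0 < δ) (h0 : ∀ x ∈ Icc 0 T, 0 ≤ f x)
    (hM : ∀ x ∈ Icc 0 T, f x ≤ M) (hD : ∀ x ∈ Icc 0 T, |iteratedDeriv (k + 1) f x| ≤ D)
    (hN : N ≠ 0) (hl : 4 * (D * (T / N) ^ (k + 1)) ≤ δ) :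
    ∫ x in 0..T, |deriv f x| / (f x + δ) ≤ N * (5 * (k + 2) * Real.log (2 + M / δ)) := by
  have hN' : (0:ℝ) < N := by positivity
  have hsub : ∀ i < N, Icc (T / N * i) (T / N * (i + 1 : ℕ)) ⊆ Icc 0 T := by
    intro i hi
    refine Icc_subset_Icc (by positivity) ?_
    have : ((i + 1 : ℕ) : ℝ) ≤ N := by exact_mod_cast hi
    calc T / N * (i + 1 : ℕ) ≤ T / N * N := by gcongr
      _ = T := div_mul_cancel₀ _ hN'.ne'
  have hle : ∀ i : ℕ, T / N * i ≤ T / N * (i + 1 : ℕ) := by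
    intro i; push_cast; gcongr; linarith
  have hfc' : Continuous (deriv f) := (contDiff_infty_iff_deriv.1 hf).2.continuous
  have hfc := hf.continuous
  have := intervalIntegral.sum_integral_adjacent_intervals (μ := volume)
    (f := fun x => |deriv f x| / (f x + δ)) (a := fun i : ℕ => T / N * i) (n := N) (by
      intro i hi
      refine ContinuousOn.intervalIntegrable_of_Icc (hle i)
        (hfc'.abs.continuousOn.div (by fun_prop) fun x hx => ?_)
      have := h0 x (hsub i hi hx)
      positivity)
  simp only [Nat.cast_zero, mul_zero, div_mul_cancel₀ _ hN'.ne'] at this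
  rw [← this]
  refine (Finset.sum_le_card_nsmul _ _ (5 * (k + 2) * Real.log (2 + M / δ)) fun i hi => ?_).trans
    (by simp)
  have hi := Finset.mem_range.1 hi
  refine integral_logDeriv_le_of_short (hle i) hf hδ (fun x hx => h0 x (hsub i hi hx))
    (fun x hx => hM x (hsub i hi hx)) (fun x hx => hD x (hsub i hi hx)) ?_
  have e : T / N * (i + 1 : ℕ) - T / N * i = T / N := by push_cast; ring
  rwa [e]

/-- Young's inequality with weights q and 1 - q. The coefficient K' is the one for which (K'X)^q
(τZ)^{1-q} equals the left-hand side. -/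
theorem mul_rpow_mul_rpow_le {q K τ : ℝ} (hq : 0 < q) (hq1 : q < 1) (hK : 0 < K) (hτ : 0 < τ) :
    ∃ K' > 0, ∀ X Z : ℝ, 0 ≤ X → 0 ≤ Z → K * (X ^ q * Z ^ (1 - q)) ≤ K' * X + τ * Z := by
  refine ⟨K ^ (1 / q) * τ ^ (-((1 - q) / q)), by positivity, fun X Z hX hZ => ?_⟩
  have h := Real.geom_mean_le_arith_mean2_weighted hq.le (sub_nonneg.2 hq1.le)
    (by positivity : 0 ≤ K ^ (1 / q) * τ ^ (-((1 - q) / q)) * X) (by positivity : 0 ≤ τ * Z)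
    (by ring)
  rw [Real.mul_rpow (by positivity) hX, Real.mul_rpow (by positivity) (by positivity),
    Real.mul_rpow hτ.le hZ, ← Real.rpow_mul hK.le, ← Real.rpow_mul hτ.le, one_div,
    inv_mul_cancel₀ hq.ne', Real.rpow_one, neg_mul, div_mul_cancel₀ _ hq.ne',
    Real.rpow_neg hτ.le] at h
  have hne : τ ^ (1 - q) ≠ 0 := by positivity
  have h1 : K * (X ^ q * Z ^ (1 - q)) = K * (τ ^ (1 - q))⁻¹ * X ^ q * (τ ^ (1 - q) * Z ^ (1 - q)) := by
    field_simp
  rw [h1]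
  refine h.trans ?_
  have h2 : 0 ≤ K ^ (1 / q) * τ ^ (-((1 - q) / q)) * X := by positivity
  have h3 : 0 ≤ τ * Z := by positivity
  rw [one_div] at h2 ⊢
  nlinarith

/-- The total variation of `log (f + δ)` for coefficients of logarithmic type. -/
theorem exists_integral_logDeriv_le {r s T : ℝ} (N₀ : ℕ) (hr : 0 < r) (hr1 : r < 1) (hs : 1 ≤ s)
    (hT : 0 < T) : ∃ k : ℕ, ∀ C ≥ (1 : ℝ), ∀ τ > (0 : ℝ), ∃ K > 0, ∀ Λ ≥ (1 : ℝ), ∀ Y ≥ (1 : ℝ),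
      ∀ f : ℝ → ℝ, ContDiff ℝ ∞ f → (∀ t ∈ Icc 0 T, 0 ≤ f t) →
      (∀ t ∈ Icc 0 T, f t ≤ C * Λ ^ (r * N₀) * Y ^ 2) →
      (∀ t ∈ Icc 0 T, |iteratedDeriv (k + 1) f t| ≤ C * Λ ^ (r * (N₀ + (k + 1))) * Y ^ 2) →
      ∀ δ ≥ (1 : ℝ),
        ∫ t in 0..T, |deriv f t| / (f t + δ) ≤ K * Λ + τ * Y ^ (1 / s) := by
  -- With η = 1/(k+1) the final bound is a multiple of Λ^q Y^{4η}, where q = r + 2rN₀η. This choice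
  -- of k makes q < 1 and 4η ≤ (1 - q)/s. It precedes C, which in the application bounds a
  -- derivative of order k + 1.
  obtain ⟨k, hk⟩ := exists_nat_gt ((4 * s + 2 * r * N₀) / (1 - r))
  refine ⟨k, fun C hC τ hτ => ?_⟩
  have hs0 : 0 < s := by linarith
  set η : ℝ := 1 / (k + 1) with hη
  have hη0 : 0 < η := by positivity
  have hη1 : η ≤ 1 := by
    rw [hη, div_le_one (by positivity)]
    linarith [(Nat.cast_nonneg k : (0:ℝ) ≤ k)]
  have hηk : η * (k + 1) = 1 := by rw [hη]; field_simp
  have hηs : η * (4 * s + 2 * r * N₀) ≤ 1 - r := by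
    rw [div_lt_iff₀ (by linarith)] at hk
    rw [hη, one_div, inv_mul_le_iff₀ (by positivity)]
    nlinarith
  set q : ℝ := r + 2 * r * N₀ * η with hq
  have hN0 : (0:ℝ) ≤ N₀ := Nat.cast_nonneg _
  have hq0 : 0 < q := by positivity
  have hq1 : q < 1 := by nlinarith
  set K₁ : ℝ := (4 * C * T + 2) * (5 * (k + 2) * (3 * C / η)) with hK₁
  obtain ⟨K, hK, hKle⟩ := mul_rpow_mul_rpow_le hq0 hq1 (by positivity : 0 < K₁) hτ
  refine ⟨K, hK, fun Λ hΛ Y hY f hf hf0 hfM hfD δ hδ => ?_⟩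
  have hΛ0 : 0 < Λ := by linarith
  have hY0 : 0 < Y := by linarith
  set M := C * Λ ^ (r * N₀) * Y ^ 2 with hM
  set D := C * Λ ^ (r * (N₀ + (k + 1))) * Y ^ 2 with hD
  have hM1 : 1 ≤ M := by
    have h1 : 1 ≤ Λ ^ (r * N₀) := Real.one_le_rpow hΛ (by positivity)
    have h2 : 1 ≤ Y ^ 2 := one_le_pow₀ hY
    rw [hM]
    exact one_le_mul_of_one_le_of_one_le (one_le_mul_of_one_le_of_one_le hC h1) h2
  have hD0 : 0 < D := by positivity
  have hCη : ∀ c ≥ (1:ℝ), c ^ η ≤ c := fun c hc => by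
    simpa using Real.rpow_le_rpow_of_exponent_le hc hη1
  have hY2 : (Y ^ 2) ^ η = Y ^ (2 * η) := by
    rw [← Real.rpow_natCast, ← Real.rpow_mul hY0.le]; norm_num
  have hDη : (4 * D) ^ η ≤ 4 * C * Λ ^ (r + r * N₀ * η) * Y ^ (2 * η) := by
    have e : 4 * D = (4 * C) * Λ ^ (r * (N₀ + (k + 1))) * Y ^ 2 := by rw [hD]; ring
    rw [e, Real.mul_rpow (by positivity) (by positivity), Real.mul_rpow (by positivity)
      (by positivity), hY2, ← Real.rpow_mul hΛ0.le]
    have e2 : r * (N₀ + (k + 1)) * η = r + r * N₀ * η := by linear_combination r * hηk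
    rw [e2]
    gcongr
    exact hCη _ (by linarith)
  -- The logarithm is traded for the small power η, at the cost of the constant 1/η.
  have hlog : Real.log (2 + M / δ) ≤ 3 * C / η * Λ ^ (r * N₀ * η) * Y ^ (2 * η) := by
    have h1 : 2 + M / δ ≤ 3 * M := by
      have : M / δ ≤ M := div_le_self (by linarith) hδ
      linarith
    have h2 : 0 ≤ M / δ := by positivity
    refine (Real.log_le_rpow_div (by linarith) hη0).trans ?_
    have h3 : (3 * M) ^ η ≤ 3 * C * Λ ^ (r * N₀ * η) * Y ^ (2 * η) := by
      have e : 3 * M = (3 * C) * Λ ^ (r * N₀) * Y ^ 2 := by rw [hM]; ring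
      rw [e, Real.mul_rpow (by positivity) (by positivity), Real.mul_rpow (by positivity)
        (by positivity), hY2, ← Real.rpow_mul hΛ0.le]
      gcongr
      exact hCη _ (by linarith)
    have h4 : (2 + M / δ) ^ η ≤ (3 * M) ^ η := Real.rpow_le_rpow (by linarith) h1 hη0.le
    calc (2 + M / δ) ^ η / η ≤ (3 * C * Λ ^ (r * N₀ * η) * Y ^ (2 * η)) / η := by
          gcongr; exact h4.trans h3
      _ = _ := by ring
  -- Enough intervals to have 4D(T/N)^{k+1} ≤ 1 ≤ δ. The `+ 1` keeps N nonzero.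
  set N : ℕ := ⌈T * (4 * D) ^ η⌉₊ + 1 with hNdef
  have hNge : T * (4 * D) ^ η ≤ N := by
    rw [hNdef]; push_cast
    linarith [Nat.le_ceil (T * (4 * D) ^ η)]
  have hNle : (N : ℝ) ≤ (4 * C * T + 2) * (Λ ^ (r + r * N₀ * η) * Y ^ (2 * η)) := by
    have h1 := Nat.ceil_lt_add_one (by positivity : 0 ≤ T * (4 * D) ^ η)
    have h2 : 1 ≤ Λ ^ (r + r * N₀ * η) := Real.one_le_rpow hΛ (by positivity)
    have h3 : 1 ≤ Y ^ (2 * η) := Real.one_le_rpow hY (by positivity)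
    have h4 := one_le_mul_of_one_le_of_one_le h2 h3
    have h5 : T * (4 * D) ^ η ≤ T * (4 * C * Λ ^ (r + r * N₀ * η) * Y ^ (2 * η)) := by gcongr
    rw [hNdef]; push_cast
    nlinarith
  have hNpos : (0:ℝ) < N := by rw [hNdef]; positivity
  have hsmall : 4 * (D * (T / N) ^ (k + 1)) ≤ δ := by
    refine le_trans ?_ hδ
    rw [div_pow, ← mul_assoc, ← mul_div_assoc, div_le_one (by positivity)]
    have h1 : (T * (4 * D) ^ η) ^ (k + 1) ≤ (N:ℝ) ^ (k + 1) := by gcongr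
    rw [mul_pow, ← Real.rpow_natCast ((4 * D) ^ η), ← Real.rpow_mul (by positivity)] at h1
    push_cast at h1
    rw [hηk, Real.rpow_one] at h1
    linarith
  refine (integral_logDeriv_le hT.le hf (by linarith : 0 < δ) hf0 hfM hfD (by omega) hsmall).trans ?_
  refine le_trans ?_ (hKle Λ (Y ^ (1 / s)) hΛ0.le (by positivity))
  have hYq : Y ^ (4 * η) ≤ (Y ^ (1 / s)) ^ (1 - q) := by
    rw [← Real.rpow_mul hY0.le]
    refine Real.rpow_le_rpow_of_exponent_le hY ?_
    rw [one_div, ← div_eq_inv_mul, le_div_iff₀ hs0, hq]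
    nlinarith
  have hlog0 : 0 ≤ Real.log (2 + M / δ) := by
    refine Real.log_nonneg ?_
    have : 0 ≤ M / δ := by positivity
    linarith
  calc (N:ℝ) * (5 * (k + 2) * Real.log (2 + M / δ))
      ≤ ((4 * C * T + 2) * (Λ ^ (r + r * N₀ * η) * Y ^ (2 * η))) *
          (5 * (k + 2) * (3 * C / η * Λ ^ (r * N₀ * η) * Y ^ (2 * η))) := by gcongr
    _ = K₁ * ((Λ ^ (r + r * N₀ * η) * Λ ^ (r * N₀ * η)) * (Y ^ (2 * η) * Y ^ (2 * η))) := by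
        rw [hK₁]; ring
    _ = K₁ * (Λ ^ q * Y ^ (4 * η)) := by
        rw [← Real.rpow_add hΛ0, ← Real.rpow_add hY0, hq]
        congr 3 <;> ring_nf
    _ ≤ K₁ * (Λ ^ q * (Y ^ (1 / s)) ^ (1 - q)) := by gcongr

/-! ### Linear ordinary differential equations with parameters -/

/-- The terms of the Picard series of `V' = M V + G`, `V(0) = V₀`. -/
def picardTerm {X E : Type*} [NormedAddCommGroup E] [NormedSpace ℝ E] (M : ℝ → X → E →L[ℝ] E)
    (G : ℝ → X → E) (V₀ : X → E) : ℕ → ℝ → X → E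
  | 0, t, x => V₀ x + ∫ τ in 0..t, G τ x
  | m + 1, t, x => ∫ τ in 0..t, M τ x (picardTerm M G V₀ m τ x)

section LinearODE

variable {X E : Type*} [TopologicalSpace X] [NormedAddCommGroup E] [NormedSpace ℝ E]
  {M : ℝ → X → E →L[ℝ] E} {G : ℝ → X → E} {V₀ : X → E}

theorem continuous_picardTerm (hM : Continuous (Function.uncurry M))
    (hG : Continuous (Function.uncurry G)) (hV : Continuous V₀) (m : ℕ) :
    Continuous (Function.uncurry (picardTerm M G V₀ m)) := by
  have key : ∀ H : ℝ → X → E, Continuous (Function.uncurry H) →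
      Continuous fun p : ℝ × X => ∫ τ in 0..p.1, H τ p.2 := by
    intro H hH
    refine intervalIntegral.continuous_parametric_intervalIntegral_of_continuous
      (f := fun (p : ℝ × X) τ => H τ p.2) (s := fun p : ℝ × X => p.1) ?_ continuous_fst
    exact hH.comp (continuous_snd.prodMk (continuous_snd.comp continuous_fst))
  induction m with
  | zero => exact (hV.comp continuous_snd).add (key G hG)
  | succ m ih => exact key (fun τ x => M τ x (picardTerm M G V₀ m τ x)) (hM.clm_apply ih)

/-- Each integration contributes a factor Kt/m. The point x is fixed and K, B may depend on it, so
coefficients unbounded in the parameter are allowed, as is needed for symbols growing in ξ. -/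
theorem norm_picardTerm_le {T K B : ℝ} {x : X} (hM : Continuous (Function.uncurry M))
    (hG : Continuous (Function.uncurry G)) (hV : Continuous V₀)
    (hK : ∀ t ∈ Icc 0 T, ‖M t x‖ ≤ K) (hB : ∀ t ∈ Icc 0 T, ‖picardTerm M G V₀ 0 t x‖ ≤ B) (m : ℕ) :
    ∀ t ∈ Icc 0 T, ‖picardTerm M G V₀ m t x‖ ≤ B * ((K * t) ^ m / m.factorial) := by
  induction m with
  | zero => simpa using hB
  | succ m ih =>
    intro t ht
    have hsub : ∀ τ ∈ Icc 0 t, τ ∈ Icc 0 T := fun τ hτ => ⟨hτ.1, hτ.2.trans ht.2⟩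
    have hc : Continuous fun τ => picardTerm M G V₀ m τ x :=
      (continuous_picardTerm hM hG hV m).comp (continuous_id.prodMk continuous_const)
    have hMc : Continuous fun τ => M τ x := hM.comp (continuous_id.prodMk continuous_const)
    have h1 : ‖∫ τ in 0..t, M τ x (picardTerm M G V₀ m τ x)‖
        ≤ ∫ τ in 0..t, K * (B * ((K * τ) ^ m / m.factorial)) := by
      refine intervalIntegral.norm_integral_le_of_norm_le ht.1 (ae_of_all _ fun τ hτ => ?_) ?_
      · have hτ' := hsub τ ⟨hτ.1.le, hτ.2⟩
        refine (ContinuousLinearMap.le_opNorm _ _).trans ?_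
        have := hK τ hτ'
        have := ih τ hτ'
        have hK0 : 0 ≤ K := (norm_nonneg _).trans (hK τ hτ')
        gcongr
      · exact Continuous.intervalIntegrable (by fun_prop) _ _
    refine h1.trans (le_of_eq ?_)
    have : ∀ τ : ℝ, K * (B * ((K * τ) ^ m / m.factorial)) = K * B * K ^ m / m.factorial * τ ^ m := by
      intro τ; rw [mul_pow]; ring
    simp only [this]
    rw [intervalIntegral.integral_const_mul, integral_pow, Nat.factorial_succ]
    push_cast
    have : (m.factorial : ℝ) ≠ 0 := by positivity
    have : (m : ℝ) + 1 ≠ 0 := by positivity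
    field_simp
    ring

/-- Global solvability of linear ordinary differential equations depending measurably on a
parameter. -/
theorem exists_linearODE_solution [CompleteSpace E] {T : ℝ} (hT : 0 ≤ T) [MeasurableSpace X]
    [OpensMeasurableSpace X] [SecondCountableTopologyEither X E] (hM : Continuous (Function.uncurry M))
    (hG : Continuous (Function.uncurry G)) (hV : Continuous V₀) :
    ∃ V : ℝ → X → E, (∀ x, V 0 x = V₀ x) ∧
      (∀ x, ∀ t ∈ Icc 0 T, HasDerivWithinAt (fun t => V t x) (M t x (V t x) + G t x) (Icc 0 T) t) ∧
      ∀ t ∈ Icc 0 T, StronglyMeasurable (V t) := by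
  have hcont := continuous_picardTerm hM hG hV
  have hcx : ∀ m x, Continuous fun t => picardTerm M G V₀ m t x := fun m x =>
    (hcont m).comp (continuous_id.prodMk continuous_const)
  have hMc : ∀ x, Continuous fun τ => M τ x := fun x =>
    hM.comp (continuous_id.prodMk continuous_const)
  have hGc : ∀ x, Continuous fun τ => G τ x := fun x =>
    hG.comp (continuous_id.prodMk continuous_const)
  have hbound : ∀ x, ∃ u : ℕ → ℝ, Summable u ∧ ∃ K, 0 ≤ K ∧ (∀ t ∈ Icc 0 T, ‖M t x‖ ≤ K) ∧
      ∀ m, ∀ t ∈ Icc 0 T, ‖picardTerm M G V₀ m t x‖ ≤ u m := by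
    intro x
    obtain ⟨K, hK⟩ := isCompact_Icc.exists_bound_of_continuousOn (s := Icc 0 T)
      (hMc x).continuousOn
    obtain ⟨B, hB⟩ := isCompact_Icc.exists_bound_of_continuousOn (s := Icc 0 T)
      (hcx 0 x).continuousOn
    have hK0 : 0 ≤ K := (norm_nonneg _).trans (hK 0 ⟨le_rfl, hT⟩)
    have hB0 : 0 ≤ B := (norm_nonneg _).trans (hB 0 ⟨le_rfl, hT⟩)
    refine ⟨fun m => B * ((K * T) ^ m / m.factorial),
      (Real.summable_pow_div_factorial (K * T)).mul_left B, K, hK0, hK, fun m t ht => ?_⟩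
    refine (norm_picardTerm_le hM hG hV hK hB m t ht).trans ?_
    change _ ≤ B * ((K * T) ^ m / m.factorial)
    have := ht.1
    have := ht.2
    gcongr
  have hsummable : ∀ x, ∀ t ∈ Icc 0 T, Summable fun m => picardTerm M G V₀ m t x := by
    intro x t ht
    obtain ⟨u, hu, -, -, -, h⟩ := hbound x
    exact Summable.of_norm_bounded hu fun m => h m t ht
  set V : ℝ → X → E := fun t x => ∑' m, picardTerm M G V₀ m t x with hVdef
  have hVc : ∀ x, ContinuousOn (fun t => V t x) (Icc 0 T) := by
    intro x
    obtain ⟨u, hu, -, -, -, h⟩ := hbound x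
    exact continuousOn_tsum (fun m => (hcx m x).continuousOn) hu h
  have hint : ∀ x, ∀ t ∈ Icc 0 T,
      V t x = V₀ x + ∫ τ in 0..t, (M τ x (V τ x) + G τ x) := by
    intro x t ht
    obtain ⟨u, hu, K, hK0, hK, h⟩ := hbound x
    have hsub : ∀ τ ∈ Icc 0 t, τ ∈ Icc 0 T := fun τ hτ => ⟨hτ.1, hτ.2.trans ht.2⟩
    -- Termwise integration of the series, dominated by K u_m. This turns the recursion for the
    -- terms into the integral equation for the sum.
    have h1 : HasSum (fun m => picardTerm M G V₀ (m + 1) t x) (∫ τ in 0..t, M τ x (V τ x)) := by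
      refine intervalIntegral.hasSum_integral_of_dominated_convergence
        (F := fun m τ => M τ x (picardTerm M G V₀ m τ x)) (fun m _ => K * u m) ?_ ?_ ?_ ?_ ?_
      · exact fun m => ((hMc x).clm_apply (hcx m x)).aestronglyMeasurable
      · refine fun m => ae_of_all _ fun τ hτ => ?_
        rw [uIoc_of_le ht.1] at hτ
        have hτ' := hsub τ ⟨hτ.1.le, hτ.2⟩
        refine (ContinuousLinearMap.le_opNorm _ _).trans ?_
        have := hK τ hτ'
        have := h m τ hτ'
        gcongr
      · exact ae_of_all _ fun _ _ => hu.mul_left K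
      · simp
      · refine ae_of_all _ fun τ hτ => ?_
        rw [uIoc_of_le ht.1] at hτ
        exact (M τ x).hasSum (hsummable x τ (hsub τ ⟨hτ.1.le, hτ.2⟩)).hasSum
    have h2 : V t x = picardTerm M G V₀ 0 t x + ∫ τ in 0..t, M τ x (V τ x) := by
      rw [← h1.tsum_eq, hVdef]
      exact (hsummable x t ht).tsum_eq_zero_add
    rw [h2, intervalIntegral.integral_add]
    · simp only [picardTerm]
      abel
    · refine ContinuousOn.intervalIntegrable_of_Icc ht.1 ?_
      exact (hMc x).continuousOn.clm_apply ((hVc x).mono hsub)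
    · exact (hGc x).intervalIntegrable _ _
  refine ⟨V, fun x => by simpa using hint x 0 ⟨le_rfl, hT⟩, fun x t ht => ?_, fun t ht => ?_⟩
  · have hc : ContinuousOn (fun τ => M τ x (V τ x) + G τ x) (Icc 0 T) :=
      ((hMc x).continuousOn.clm_apply (hVc x)).add (hGc x).continuousOn
    -- The `Fact` supplies the filter instance that makes the fundamental theorem of calculus
    -- available within `Icc`, end points included.
    have : Fact (t ∈ Icc 0 T) := ⟨ht⟩
    have h1 := intervalIntegral.integral_hasDerivWithinAt_right (a := 0) (b := t)
      (f := fun τ => M τ x (V τ x) + G τ x) (s := Icc 0 T) (t := Icc 0 T)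
      (ContinuousOn.intervalIntegrable_of_Icc ht.1
        (hc.mono (Icc_subset_Icc le_rfl ht.2)))
      (hc.stronglyMeasurableAtFilter_nhdsWithin measurableSet_Icc t) (hc t ht)
    exact (h1.const_add (V₀ x)).congr (fun τ hτ => hint x τ hτ) (hint x t ht)
  -- Every Picard term is continuous in x, but the series converges only pointwise in x; hence
  -- measurability rather than continuity.
  · have hm : ∀ m, StronglyMeasurable (picardTerm M G V₀ m t) := fun m =>
      ((hcont m).comp (continuous_const.prodMk continuous_id)).stronglyMeasurable
    refine stronglyMeasurable_of_tendsto atTop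
      (f := fun (N : ℕ) x => ∑ m ∈ Finset.range N, picardTerm M G V₀ m t x) (fun N => ?_) ?_
    · exact Finset.stronglyMeasurable_fun_sum _ fun m _ => hm m
    · rw [tendsto_pi_nhds]
      exact fun x => (hsummable x t ht).hasSum.tendsto_sum_nat

end LinearODE

/-! ### The energy estimate -/

/-- The energy estimate for `v'' + A v + (b + e) v + d v' = F`, `w = v'`. -/
theorem energy_estimate {T : ℝ} {A : ℝ → ℝ} {b e d F v w : ℝ → ℂ} {m β Φ L : ℝ}
    (hA : ContDiff ℝ ∞ A) (hA0 : ∀ t ∈ Icc 0 T, 0 ≤ A t)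
    (hv : ∀ t ∈ Icc 0 T, HasDerivWithinAt v (w t) (Icc 0 T) t)
    (hw : ∀ t ∈ Icc 0 T, HasDerivWithinAt w
      (F t - (A t : ℂ) * v t - (b t + e t) * v t - d t * w t) (Icc 0 T) t)
    (hm : 1 ≤ m) (hβ : 0 ≤ β)
    (hb : ∀ t ∈ Icc 0 T, ‖b t‖ ≤ β * √(A t)) (he : ∀ t ∈ Icc 0 T, ‖e t‖ ≤ β * m)
    (hd : ∀ t ∈ Icc 0 T, ‖d t‖ ≤ β) (hF : ∀ t ∈ Icc 0 T, ‖F t‖ ≤ Φ)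
    (hL : ∫ t in 0..T, |deriv A t| / (A t + m ^ 2) ≤ L) :
    ∀ t ∈ Icc 0 T, ‖v t‖ ^ 2 + ‖w t‖ ^ 2 ≤ Real.exp ((1 + 4 * β + m) * T + L) *
      (‖w 0‖ ^ 2 + (A 0 + m ^ 2) * ‖v 0‖ ^ 2 + T * Φ ^ 2) := by
  intro t ht
  have hT : 0 ≤ T := ht.1.trans ht.2
  have h0T : (0:ℝ) ∈ Icc 0 T := ⟨le_rfl, hT⟩
  have hAd : Differentiable ℝ A := hA.differentiable (by simp)
  have hAc' : Continuous (deriv A) := (contDiff_infty_iff_deriv.1 hA).2.continuous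
  have hAc := hA.continuous
  have hm0 : 0 < m := by linarith
  have hpos : ∀ t ∈ Icc 0 T, 0 < A t + m ^ 2 := fun t ht => by
    have := hA0 t ht
    positivity
  -- The growth rate of E: 1 from the source, β each from b and e, 2β from d, m from the cross term
  -- 2m²⟨v,w⟩, and the quotient from A'|v|².
  set κ : ℝ → ℝ := fun t => 1 + 4 * β + m + |deriv A t| / (A t + m ^ 2) with hκ
  have hκc' : ContinuousOn (fun t => |deriv A t| / (A t + m ^ 2)) (Icc 0 T) :=
    hAc'.abs.continuousOn.div (by fun_prop) fun x hx => (hpos x hx).ne'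
  have hκc : ContinuousOn κ (Icc 0 T) := continuousOn_const.add hκc'
  have hκ0 : ∀ t ∈ Icc 0 T, 0 ≤ κ t := fun t ht => by
    have := hpos t ht
    positivity
  set E : ℝ → ℝ := fun t => ‖w t‖ ^ 2 + (A t + m ^ 2) * ‖v t‖ ^ 2 with hE
  set E' : ℝ → ℝ := fun t =>
    2 * inner ℝ (w t) (F t - (A t : ℂ) * v t - (b t + e t) * v t - d t * w t) +
      (deriv A t * ‖v t‖ ^ 2 + (A t + m ^ 2) * (2 * inner ℝ (v t) (w t))) with hE'
  have hEd : ∀ t ∈ Icc 0 T, HasDerivWithinAt E (E' t) (Icc 0 T) t := fun t ht =>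
    (hw t ht).norm_sq.add
      ((((hAd t).hasDerivAt.hasDerivWithinAt).add_const _).mul (hv t ht).norm_sq)
  have hE'le : ∀ t ∈ Icc 0 T, E' t ≤ κ t * E t + Φ ^ 2 := by
    intro t ht
    have hP := hpos t ht
    have hAt := hA0 t ht
    set x := ‖v t‖ with hx
    set y := ‖w t‖ with hy
    have hx0 : 0 ≤ x := norm_nonneg _
    have hy0 : 0 ≤ y := norm_nonneg _
    have hsq : √(A t) ^ 2 = A t := Real.sq_sqrt hAt
    set S := √(A t) with hS
    have hS0 : 0 ≤ S := Real.sqrt_nonneg _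
    have i1 : inner ℝ (w t) (F t - (A t : ℂ) * v t - (b t + e t) * v t - d t * w t)
        = inner ℝ (w t) (F t) - A t * inner ℝ (v t) (w t) - inner ℝ (w t) (b t * v t)
          - inner ℝ (w t) (e t * v t) - inner ℝ (w t) (d t * w t) := by
      rw [add_mul, inner_sub_right, inner_sub_right, inner_sub_right, inner_add_right,
        ← Complex.real_smul, real_inner_smul_right, real_inner_comm (w t) (v t)]
      ring
    have cs : ∀ z : ℂ, |inner ℝ (w t) z| ≤ y * ‖z‖ := fun z => abs_real_inner_le_norm _ _
    have j1 : inner ℝ (w t) (F t) ≤ y * Φ :=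
      (le_abs_self _).trans ((cs _).trans (by gcongr; exact hF t ht))
    have j2 : -inner ℝ (w t) (b t * v t) ≤ y * (β * S * x) := by
      refine (neg_le_abs _).trans ((cs _).trans ?_)
      rw [norm_mul]
      have := hb t ht
      gcongr
    have j3 : -inner ℝ (w t) (e t * v t) ≤ y * (β * m * x) := by
      refine (neg_le_abs _).trans ((cs _).trans ?_)
      rw [norm_mul]
      have := he t ht
      gcongr
    have j4 : -inner ℝ (w t) (d t * w t) ≤ y * (β * y) := by
      refine (neg_le_abs _).trans ((cs _).trans ?_)
      rw [norm_mul]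
      have := hd t ht
      gcongr
    have j5 : inner ℝ (v t) (w t) ≤ x * y :=
      (le_abs_self _).trans (abs_real_inner_le_norm _ _)
    have j6 : deriv A t * x ^ 2 ≤ |deriv A t| / (A t + m ^ 2) * E t := by
      have : (A t + m ^ 2) * x ^ 2 ≤ E t := by
        rw [hE]; simp only; nlinarith [sq_nonneg y]
      calc deriv A t * x ^ 2 ≤ |deriv A t| * x ^ 2 := by gcongr; exact le_abs_self _
        _ = |deriv A t| / (A t + m ^ 2) * ((A t + m ^ 2) * x ^ 2) := by field_simp
        _ ≤ _ := by gcongr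
    have hEt : E t = y ^ 2 + (S ^ 2 + m ^ 2) * x ^ 2 := by rw [hsq]
    have k1 : 2 * (y * (S * x)) ≤ E t := by
      rw [hEt]; nlinarith [sq_nonneg (y - S * x), mul_nonneg (sq_nonneg m) (sq_nonneg x)]
    have k2 : 2 * (y * (m * x)) ≤ E t := by
      rw [hEt]; nlinarith [sq_nonneg (y - m * x), mul_nonneg (sq_nonneg S) (sq_nonneg x)]
    have k3 : y ^ 2 ≤ E t := by
      rw [hEt]; nlinarith [mul_nonneg (sq_nonneg m) (sq_nonneg x), mul_nonneg (sq_nonneg S) (sq_nonneg x)]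
    have k4 : 2 * (y * Φ) ≤ E t + Φ ^ 2 := by nlinarith [sq_nonneg (y - Φ)]
    have l1 := mul_le_mul_of_nonneg_left k1 hβ
    have l2 := mul_le_mul_of_nonneg_left k2 hβ
    have l3 := mul_le_mul_of_nonneg_left k3 hβ
    have l4 := mul_le_mul_of_nonneg_left k2 hm0.le
    have l5 := mul_le_mul_of_nonneg_left j5 (sq_nonneg m)
    -- Here 2A⟨v,w⟩ from differentiating A|v|² cancels against the principal term of the equation.
    have e1 : E' t = 2 * inner ℝ (w t) (F t) + 2 * -inner ℝ (w t) (b t * v t)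
        + 2 * -inner ℝ (w t) (e t * v t) + 2 * -inner ℝ (w t) (d t * w t) + deriv A t * x ^ 2
        + 2 * (m ^ 2 * inner ℝ (v t) (w t)) := by
      simp only [hE', i1, ← hx]; ring
    have e2 : κ t * E t = E t + 4 * (β * E t) + m * E t + |deriv A t| / (A t + m ^ 2) * E t := by
      simp only [hκ]; ring
    rw [e1, e2]
    linarith
  set I : ℝ → ℝ := fun t => ∫ τ in 0..t, κ τ with hI
  have hId : ∀ t ∈ Icc 0 T, HasDerivWithinAt I (κ t) (Icc 0 T) t := by
    intro t ht
    have : Fact (t ∈ Icc 0 T) := ⟨ht⟩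
    exact intervalIntegral.integral_hasDerivWithinAt_right (s := Icc 0 T) (t := Icc 0 T)
      (ContinuousOn.intervalIntegrable_of_Icc ht.1
        (hκc.mono (Icc_subset_Icc le_rfl ht.2)))
      (hκc.stronglyMeasurableAtFilter_nhdsWithin measurableSet_Icc t) (hκc t ht)
  have hI0 : ∀ t ∈ Icc 0 T, 0 ≤ I t := fun t ht =>
    intervalIntegral.integral_nonneg ht.1 fun τ hτ => hκ0 τ ⟨hτ.1, hτ.2.trans ht.2⟩
  have hIT : I t ≤ (1 + 4 * β + m) * T + L := by
    have h1 : I t ≤ I T := by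
      have hsub : Icc t T ⊆ Icc 0 T := Icc_subset_Icc ht.1 le_rfl
      have := intervalIntegral.integral_add_adjacent_intervals (f := κ) (μ := volume)
        (a := 0) (b := t) (c := T)
        (ContinuousOn.intervalIntegrable_of_Icc ht.1 (hκc.mono (Icc_subset_Icc le_rfl ht.2)))
        (ContinuousOn.intervalIntegrable_of_Icc ht.2 (hκc.mono hsub))
      have h2 : 0 ≤ ∫ τ in t..T, κ τ :=
        intervalIntegral.integral_nonneg ht.2 fun τ hτ => hκ0 τ (hsub hτ)
      simp only [hI]
      linarith
    refine h1.trans ?_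
    simp only [hI, hκ]
    rw [intervalIntegral.integral_add (by simp)
      (ContinuousOn.intervalIntegrable_of_Icc hT hκc'), intervalIntegral.integral_const,
      smul_eq_mul]
    linarith
  -- Grönwall's argument. The term Φ²t absorbs the source because the integrating factor exp(-I) is
  -- at most 1.
  have hanti : AntitoneOn (fun t => E t * Real.exp (-I t) - Φ ^ 2 * t) (Icc 0 T) := by
    have hder : ∀ t ∈ Icc 0 T, HasDerivWithinAt (fun t => E t * Real.exp (-I t) - Φ ^ 2 * t)
        (E' t * Real.exp (-I t) + E t * (Real.exp (-I t) * -κ t) - Φ ^ 2 * 1) (Icc 0 T) t :=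
      fun t ht => ((hEd t ht).mul (hId t ht).neg.exp).sub ((hasDerivWithinAt_id t _).const_mul _)
    refine antitoneOn_of_hasDerivWithinAt_nonpos (convex_Icc 0 T)
      (fun t ht => (hder t ht).continuousWithinAt)
      (fun t ht => (hder t (interior_subset ht)).mono interior_subset) fun t ht => ?_
    have ht' := interior_subset ht
    have h1 := hE'le t ht'
    have h2 : 0 < Real.exp (-I t) := Real.exp_pos _
    have h3 : Real.exp (-I t) ≤ 1 := Real.exp_le_one_iff.2 (by linarith [hI0 t ht'])
    nlinarith [mul_le_mul_of_nonneg_right h1 h2.le, sq_nonneg Φ]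
  have hfin := hanti h0T ht ht.1
  have hI00 : I 0 = 0 := by simp [hI]
  simp only [hI00, neg_zero, Real.exp_zero, mul_one, mul_zero, sub_zero] at hfin
  have hvE : ‖v t‖ ^ 2 + ‖w t‖ ^ 2 ≤ E t := by
    have := hA0 t ht
    have h1 : 1 ≤ A t + m ^ 2 := by nlinarith
    simp only [hE]
    nlinarith [mul_le_mul_of_nonneg_right h1 (sq_nonneg ‖v t‖)]
  refine hvE.trans ?_
  have h4 : E t = Real.exp (I t) * (E t * Real.exp (-I t)) := by
    rw [mul_left_comm, ← Real.exp_add]; simp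
  rw [h4]
  have h6 : Φ ^ 2 * t ≤ T * Φ ^ 2 := by nlinarith [ht.2, sq_nonneg Φ]
  have h7 : 0 ≤ E t := by
    have := hpos t ht
    simp only [hE]
    positivity
  gcongr
  simp only [hE] at hfin ⊢
  linarith

/-! ### Gevrey decay -/

/-- The weight `exp(-γ (1+|ξ|)^{1/s})`. -/
def gevreyDecay {n : ℕ} (s γ : ℝ) (ξ : Space n) : ℝ := Real.exp (-γ * (1 + ‖ξ‖) ^ (1 / s))

theorem gevreyDecay_pos {n : ℕ} (s γ : ℝ) (ξ : Space n) : 0 < gevreyDecay s γ ξ := Real.exp_pos _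

theorem continuous_gevreyDecay {n : ℕ} {s : ℝ} (hs : 1 ≤ s) (γ : ℝ) :
    Continuous (gevreyDecay s γ : Space n → ℝ) := by
  unfold gevreyDecay
  have : Continuous fun ξ : Space n => (1 + ‖ξ‖) ^ (1 / s) :=
    (continuous_const.add continuous_norm).rpow_const fun ξ => Or.inr (by positivity)
  fun_prop

theorem gevreyDecay_add {n : ℕ} (s γ γ' : ℝ) (ξ : Space n) :
    gevreyDecay s (γ + γ') ξ = gevreyDecay s γ ξ * gevreyDecay s γ' ξ := by
  unfold gevreyDecay
  rw [← Real.exp_add]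
  ring_nf

/-- Take x^p/p! ≤ e^x at x = (γ/s) Y^{1/s} and raise it to the power s. This is where exponential
decay in Y^{1/s} produces the Gevrey factor (p!)^s. -/
theorem pow_mul_gevreyDecay_le {n : ℕ} {s γ : ℝ} (hs : 1 ≤ s) (hγ : 0 < γ) (p : ℕ) (ξ : Space n) :
    (1 + ‖ξ‖) ^ p * gevreyDecay s γ ξ ≤ ((s / γ) ^ s) ^ p * (p.factorial : ℝ) ^ s := by
  have hs0 : 0 < s := by linarith
  have hY : 0 < 1 + ‖ξ‖ := by positivity
  set Y := 1 + ‖ξ‖ with hYdef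
  have h1 := Real.pow_div_factorial_le_exp (γ / s * Y ^ (1 / s)) (by positivity) p
  have h2 := Real.rpow_le_rpow (by positivity) h1 hs0.le
  have h3 : Real.exp (γ / s * Y ^ (1 / s)) ^ s = (gevreyDecay s γ ξ)⁻¹ := by
    rw [gevreyDecay, ← Real.exp_neg, ← Real.exp_mul, ← hYdef]
    congr 1
    field_simp
  have h4 : ((γ / s * Y ^ (1 / s)) ^ p / p.factorial) ^ s
      = ((γ / s) ^ s) ^ p * Y ^ p / (p.factorial : ℝ) ^ s := by
    rw [Real.div_rpow (by positivity) (by positivity), mul_pow,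
      Real.mul_rpow (by positivity) (by positivity), ← Real.rpow_natCast (Y ^ (1 / s)),
      ← Real.rpow_mul hY.le, ← Real.rpow_mul hY.le, Real.rpow_pow_comm (by positivity)]
    congr 2
    rw [show 1 / s * p * s = p by field_simp, Real.rpow_natCast]
  rw [h3, h4, div_le_iff₀ (by positivity)] at h2
  have hd := gevreyDecay_pos s γ ξ
  have h5 : ((s / γ) ^ s) ^ p * ((γ / s) ^ s) ^ p = 1 := by
    rw [← mul_pow, ← Real.mul_rpow (by positivity) (by positivity)]
    have : s / γ * (γ / s) = 1 := by field_simp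
    rw [this, Real.one_rpow, one_pow]
  calc Y ^ p * gevreyDecay s γ ξ
      = ((s / γ) ^ s) ^ p * (((γ / s) ^ s) ^ p * Y ^ p) * gevreyDecay s γ ξ := by
        rw [← mul_assoc, h5, one_mul]
    _ ≤ ((s / γ) ^ s) ^ p * ((gevreyDecay s γ ξ)⁻¹ * (p.factorial : ℝ) ^ s) * gevreyDecay s γ ξ := by
        gcongr
    _ = _ := by field_simp

theorem integrable_gevreyDecay {n : ℕ} {s γ : ℝ} (hs : 1 ≤ s) (hγ : 0 < γ) :
    Integrable (gevreyDecay s γ : Space n → ℝ) := by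
  have h := (integrable_one_add_norm (E := Space n) (μ := volume) (r := (n + 1 : ℕ))
    (by simp)).const_mul (((s / γ) ^ s) ^ (n + 1) * ((n + 1).factorial : ℝ) ^ s)
  refine h.mono' (continuous_gevreyDecay hs γ).aestronglyMeasurable (ae_of_all _ fun ξ => ?_)
  rw [Real.norm_of_nonneg (gevreyDecay_pos _ _ _).le, Real.rpow_neg (by positivity),
    Real.rpow_natCast, ← div_eq_mul_inv, le_div_iff₀ (by positivity), mul_comm]
  exact pow_mul_gevreyDecay_le hs hγ (n + 1) ξ

/-- The multinomial coefficient |α|!/α! is one term of the expansion of (1 + ⋯ + 1)^{|α|} = n^{|α|}.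
-/
theorem factorial_order_le {n : ℕ} (α : Fin n → ℕ) :
    ((order α).factorial : ℝ) ≤ (n : ℝ) ^ order α * ∏ i, ((α i).factorial : ℝ) := by
  have h1 := Nat.multinomial_spec (Finset.univ) α
  have h2 := Finset.sum_pow_eq_sum_piAntidiag (R := ℕ) (Finset.univ) (fun _ : Fin n => 1) (order α)
  simp only [Finset.sum_const, Finset.card_univ, Fintype.card_fin, smul_eq_mul, mul_one, one_pow,
    Finset.prod_const_one, Nat.cast_id] at h2
  have h3 : Nat.multinomial Finset.univ α ≤ n ^ order α := by
    rw [h2]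
    exact Finset.single_le_sum (f := fun k => Nat.multinomial Finset.univ k)
      (fun _ _ => Nat.zero_le _) (by simp [Finset.mem_piAntidiag, order])
  have h4 : (order α).factorial ≤ n ^ order α * ∏ i, (α i).factorial := by
    rw [order] at h3 ⊢
    rw [← h1, mul_comm]
    gcongr
  exact_mod_cast h4

theorem weight_pos {n : ℕ} (s : ℝ) (α : Fin n → ℕ) : 0 < weight s α := by
  unfold weight
  have : 0 < ∏ i, ((α i).factorial : ℝ) := Finset.prod_pos fun i _ => by positivity
  positivity

theorem factorial_order_rpow_le {n : ℕ} {s : ℝ} (hs : 1 ≤ s) (α : Fin n → ℕ) :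
    ((order α).factorial : ℝ) ^ s ≤ ((n : ℝ) ^ s) ^ order α * weight s α := by
  have h := Real.rpow_le_rpow (by positivity) (factorial_order_le α) (by linarith : 0 ≤ s)
  rwa [Real.mul_rpow (by positivity) (Finset.prod_nonneg fun i _ => by positivity),
    ← Real.rpow_pow_comm (by positivity)] at h

/-! ### Differentiation under the integral sign within a convex set -/

/-- The mean value inequality on the convex set S dominates the difference quotients, end points
included. The derivative L is prescribed only through its values on vectors, so no measurability of
the operator-valued map G' is required. -/
theorem hasFDerivWithinAt_integral_of_dominated {Ω H : Type*} [MeasurableSpace Ω] {μ : Measure Ω}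
    [NormedAddCommGroup H] [NormedSpace ℝ H] {S : Set H} (hS : Convex ℝ S) {G : H → Ω → ℂ}
    {G' : H → Ω → H →L[ℝ] ℂ} {L : H →L[ℝ] ℂ} {bd : Ω → ℝ} {p : H} (hp : p ∈ S)
    (hG : ∀ q ∈ S, Integrable (G q) μ) (hG' : ∀ v, Integrable (fun ζ => G' p ζ v) μ)
    (hL : ∀ v, L v = ∫ ζ, G' p ζ v ∂μ)
    (hd : ∀ ζ, ∀ q ∈ S, HasFDerivWithinAt (fun q => G q ζ) (G' q ζ) S q)
    (hb : ∀ ζ, ∀ q ∈ S, ‖G' q ζ‖ ≤ bd ζ) (hbi : Integrable bd μ) :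
    HasFDerivWithinAt (fun q => ∫ ζ, G q ζ ∂μ) L S p := by
  rw [hasFDerivWithinAt_iff_tendsto]
  have key : ∀ q ∈ S, ∫ ζ, (G q ζ - G p ζ - G' p ζ (q - p)) ∂μ
      = ∫ ζ, G q ζ ∂μ - ∫ ζ, G p ζ ∂μ - L (q - p) := by
    intro q hq
    rw [hL, ← integral_sub (hG q hq) (hG p hp)]
    exact integral_sub ((hG q hq).sub (hG p hp)) (hG' _)
  have hint : Tendsto (fun q => ∫ ζ, ‖q - p‖⁻¹ * ‖G q ζ - G p ζ - G' p ζ (q - p)‖ ∂μ) (𝓝[S] p)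
      (𝓝 (∫ _, (0:ℝ) ∂μ)) := by
    refine tendsto_integral_filter_of_dominated_convergence (fun ζ => 2 * bd ζ) ?_ ?_
      (hbi.const_mul 2) ?_
    · filter_upwards [self_mem_nhdsWithin] with q hq
      exact (((hG q hq).sub (hG p hp)).sub (hG' _)).aestronglyMeasurable.norm.const_mul _
    · filter_upwards [self_mem_nhdsWithin] with q hq
      refine ae_of_all _ fun ζ => ?_
      have h1 := hS.norm_image_sub_le_of_norm_hasFDerivWithin_le (hd ζ) (hb ζ) hp hq
      have h2 : ‖G' p ζ (q - p)‖ ≤ bd ζ * ‖q - p‖ :=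
        (ContinuousLinearMap.le_opNorm _ _).trans (by gcongr; exact hb ζ p hp)
      rw [norm_mul, norm_inv, norm_norm, norm_norm]
      have h3 : ‖G q ζ - G p ζ - G' p ζ (q - p)‖ ≤ 2 * bd ζ * ‖q - p‖ :=
        (norm_sub_le _ _).trans (by linarith)
      have hbd : 0 ≤ bd ζ := (norm_nonneg _).trans (hb ζ p hp)
      rcases (norm_nonneg (q - p)).eq_or_lt with h0 | h0
      · rw [← h0]; simpa using hbd
      · rw [inv_mul_le_iff₀ h0]; linarith
    · exact ae_of_all _ fun ζ => hasFDerivWithinAt_iff_tendsto.1 (hd ζ p hp)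
  rw [integral_zero] at hint
  refine squeeze_zero' (Eventually.of_forall fun q => by positivity) ?_ hint
  filter_upwards [self_mem_nhdsWithin] with q hq
  rw [← key q hq, integral_const_mul]
  gcongr
  exact norm_integral_le_integral_norm _

/-! ### Fourier synthesis -/

/-- The character `exp(2πi ξ·x)`. -/
def wave {n : ℕ} (ξ x : Space n) : ℂ := Complex.exp ((2 * Real.pi * inner ℝ ξ x : ℝ) * Complex.I)

/-- The Fourier multiplier `2πi ξ_i` of `∂_{x_i}`. -/
def freq {n : ℕ} (i : Fin n) (ξ : Space n) : ℂ := (2 * Real.pi * ξ i : ℝ) * Complex.I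

/-- The function `x ↦ ∫ exp(2πi ξ·x) w(ξ) dξ`. -/
def synth {n : ℕ} (w : Space n → ℂ) (x : Space n) : ℂ := ∫ ξ, wave ξ x * w ξ

theorem norm_wave {n : ℕ} (ξ x : Space n) : ‖wave ξ x‖ = 1 := Complex.norm_exp_ofReal_mul_I _

theorem continuous_wave {n : ℕ} : Continuous fun p : Space n × Space n => wave p.1 p.2 := by
  unfold wave
  fun_prop

theorem continuous_freq {n : ℕ} (i : Fin n) : Continuous (freq i : Space n → ℂ) := by
  unfold freq
  fun_prop

theorem norm_freq_le {n : ℕ} (i : Fin n) (ξ : Space n) : ‖freq i ξ‖ ≤ 2 * Real.pi * (1 + ‖ξ‖) := by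
  rw [freq, norm_mul, Complex.norm_I, mul_one, Complex.norm_real, norm_mul,
    Real.norm_of_nonneg (by positivity)]
  have := PiLp.norm_apply_le ξ i
  gcongr
  linarith

theorem norm_synth_le {n : ℕ} (w : Space n → ℂ) (x : Space n) : ‖synth w x‖ ≤ ∫ ξ, ‖w ξ‖ := by
  refine (norm_integral_le_integral_norm _).trans (le_of_eq ?_)
  simp [norm_wave]

theorem integrable_wave_mul {n : ℕ} {w : Space n → ℂ} (hw : Integrable w) (x : Space n) :
    Integrable fun ξ => wave ξ x * w ξ := by
  refine hw.bdd_mul (c := 1) ?_ (ae_of_all _ fun ξ => (norm_wave ξ x).le)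
  exact (continuous_wave.comp (continuous_id.prodMk continuous_const)).aestronglyMeasurable

/-- Time-dependent symbols `w(t,ξ)`, smooth in `t ∈ [0,T]`, all of whose time derivatives have
Gevrey decay in `ξ` with the same rate `γ`. -/
structure IsGevreySymbol {n : ℕ} (T s γ : ℝ) (B : ℕ → ℝ) (w : ℝ → Space n → ℂ) : Prop where
  contDiffOn : ∀ ξ, ContDiffOn ℝ ∞ (fun t => w t ξ) (Icc 0 T)
  measurable : ∀ t ∈ Icc 0 T, AEStronglyMeasurable (w t) volume
  bound : ∀ k, ∀ t ∈ Icc 0 T, ∀ ξ,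
    ‖iteratedDerivWithin k (fun t => w t ξ) (Icc 0 T) t‖ ≤ B k * gevreyDecay s γ ξ

section Symbol

variable {n : ℕ} {T s γ : ℝ} {B : ℕ → ℝ} {w : ℝ → Space n → ℂ}

theorem IsGevreySymbol.norm_le (hw : IsGevreySymbol T s γ B w) {t : ℝ} (ht : t ∈ Icc 0 T)
    (ξ : Space n) : ‖w t ξ‖ ≤ B 0 * gevreyDecay s γ ξ := by
  simpa using hw.bound 0 t ht ξ

theorem IsGevreySymbol.nonneg (hw : IsGevreySymbol T s γ B w) (hT : 0 ≤ T) (k : ℕ) : 0 ≤ B k :=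
  nonneg_of_mul_nonneg_left ((norm_nonneg _).trans (hw.bound k 0 ⟨le_rfl, hT⟩ 0))
    (gevreyDecay_pos _ _ _)

theorem IsGevreySymbol.integrable (hw : IsGevreySymbol T s γ B w) (hs : 1 ≤ s) (hγ : 0 < γ)
    {t : ℝ} (ht : t ∈ Icc 0 T) : Integrable (w t) :=
  ((integrable_gevreyDecay hs hγ).const_mul (B 0)).mono' (hw.measurable t ht)
    (ae_of_all _ fun ξ => hw.norm_le ht ξ)

theorem IsGevreySymbol.hasDerivWithinAt (hw : IsGevreySymbol T s γ B w) (ξ : Space n) {t : ℝ}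
    (ht : t ∈ Icc 0 T) :
    HasDerivWithinAt (fun t => w t ξ) (derivWithin (fun t => w t ξ) (Icc 0 T) t) (Icc 0 T) t :=
  ((hw.contDiffOn ξ).differentiableOn (by simp) t ht).hasDerivWithinAt

/-- The derivative is a pointwise limit of difference quotients along one sequence of times common
to all ξ. -/
theorem aestronglyMeasurable_derivWithin (hT : 0 < T)
    (hw : ∀ t ∈ Icc 0 T, AEStronglyMeasurable (w t) volume)
    (hd : ∀ ξ, ∀ t ∈ Icc 0 T, DifferentiableWithinAt ℝ (fun t => w t ξ) (Icc 0 T) t)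
    {t : ℝ} (ht : t ∈ Icc 0 T) :
    AEStronglyMeasurable (fun ξ => derivWithin (fun t => w t ξ) (Icc 0 T) t) volume := by
  have hne : (𝓝[Icc 0 T \ {t}] t).NeBot :=
    accPt_principal_iff_nhdsWithin.1 ((uniqueDiffOn_Icc hT t ht).accPt)
  obtain ⟨u, hu⟩ := exists_seq_tendsto (𝓝[Icc 0 T \ {t}] t)
  have hmem : ∀ᶠ m in atTop, u m ∈ Icc 0 T \ {t} := hu.eventually self_mem_nhdsWithin
  obtain ⟨m₀, hm₀⟩ := eventually_atTop.1 hmem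
  refine aestronglyMeasurable_of_tendsto_ae atTop
    (f := fun m ξ => slope (fun t => w t ξ) t (u (m + m₀))) (fun m => ?_) (ae_of_all _ fun ξ => ?_)
  · have h1 := hw _ (hm₀ (m + m₀) (by omega)).1
    have h2 := hw t ht
    simp only [slope, vsub_eq_sub]
    exact (h1.sub h2).const_smul _
  · have := (hasDerivWithinAt_iff_tendsto_slope.1 (hd ξ t ht).hasDerivWithinAt).comp hu
    exact this.comp (tendsto_add_atTop_nat m₀)

theorem IsGevreySymbol.derivWithin (hw : IsGevreySymbol T s γ B w) (hT : 0 < T) :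
    IsGevreySymbol T s γ (fun k => B (k + 1))
      (fun t ξ => derivWithin (fun t => w t ξ) (Icc 0 T) t) where
  contDiffOn ξ := by
    have h : ContDiffOn ℝ (∞ + 1) (fun t => w t ξ) (Icc 0 T) := by simpa using hw.contDiffOn ξ
    exact ((contDiffOn_succ_iff_derivWithin (uniqueDiffOn_Icc hT)).1 h).2.2
  measurable t ht := aestronglyMeasurable_derivWithin hT hw.measurable
    (fun ξ t ht => (hw.hasDerivWithinAt ξ ht).differentiableWithinAt) ht
  bound k t ht ξ := by
    have := hw.bound (k + 1) t ht ξ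
    rwa [iteratedDerivWithin_succ'] at this

theorem IsGevreySymbol.mul_left {δ K : ℝ} {m : Space n → ℂ} (hw : IsGevreySymbol T s γ B w)
    (hT : 0 ≤ T) (hm : Continuous m) (hK : ∀ ξ, ‖m ξ‖ * gevreyDecay s δ ξ ≤ K) :
    IsGevreySymbol T s (γ - δ) (fun k => K * B k) (fun t ξ => m ξ * w t ξ) where
  contDiffOn ξ := contDiffOn_const.mul (hw.contDiffOn ξ)
  measurable t ht := hm.aestronglyMeasurable.mul (hw.measurable t ht)
  bound k t ht ξ := by
    rw [iteratedDerivWithin_const_mul_field, norm_mul]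
    have h1 := hw.bound k t ht ξ
    have h2 : gevreyDecay s γ ξ = gevreyDecay s δ ξ * gevreyDecay s (γ - δ) ξ := by
      rw [← gevreyDecay_add]; congr 1; ring
    calc ‖m ξ‖ * _ ≤ ‖m ξ‖ * (B k * gevreyDecay s γ ξ) := by gcongr
      _ = (‖m ξ‖ * gevreyDecay s δ ξ) * (B k * gevreyDecay s (γ - δ) ξ) := by rw [h2]; ring
      _ ≤ K * (B k * gevreyDecay s (γ - δ) ξ) := by
          have := hw.nonneg hT k
          have := (gevreyDecay_pos s (γ - δ) ξ).le
          gcongr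
          exact hK ξ
      _ = _ := by ring

/-- One factor of frequency is paid for with half of the decay rate. After finitely many derivatives
the rate is still positive, which is enough for smoothness; the sharp Gevrey constants are obtained
in `exists_norm_mderiv_synth_le`, where all factors are absorbed at once. -/
theorem IsGevreySymbol.freq_mul (hw : IsGevreySymbol T s γ B w) (hT : 0 ≤ T) (hs : 1 ≤ s)
    (hγ : 0 < γ) (i : Fin n) :
    ∃ B', IsGevreySymbol T s (γ / 2) B' (fun t ξ => freq i ξ * w t ξ) := by
  have h := hw.mul_left (δ := γ / 2) hT (continuous_freq i)
    (K := 2 * Real.pi * (((s / (γ / 2)) ^ s) ^ 1 * (Nat.factorial 1 : ℝ) ^ s)) fun ξ => by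
      have h1 := pow_mul_gevreyDecay_le hs (half_pos hγ) 1 ξ
      have h2 := norm_freq_le i ξ
      have h3 := (gevreyDecay_pos s (γ / 2) ξ).le
      calc _ ≤ 2 * Real.pi * (1 + ‖ξ‖) * gevreyDecay s (γ / 2) ξ := by gcongr
        _ = 2 * Real.pi * ((1 + ‖ξ‖) ^ 1 * gevreyDecay s (γ / 2) ξ) := by ring
        _ ≤ _ := by gcongr
  rw [sub_half] at h
  exact ⟨_, h⟩

/-- The derivative of `(t,x) ↦ ∫ exp(2πi ξ·x) w(t,ξ) dξ`. -/
def synthFDeriv (T : ℝ) (w : ℝ → Space n → ℂ) (p : ℝ × Space n) : ℝ × Space n →L[ℝ] ℂ :=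
  (ContinuousLinearMap.fst ℝ ℝ (Space n)).smulRight
      (synth (fun ξ => derivWithin (fun t => w t ξ) (Icc 0 T) p.1) p.2) +
    ∑ i, ((EuclideanSpace.proj i : Space n →L[ℝ] ℝ).comp
      (ContinuousLinearMap.snd ℝ ℝ (Space n))).smulRight (synth (fun ξ => freq i ξ * w p.1 ξ) p.2)

theorem hasFDerivAt_wave (ξ x : Space n) : HasFDerivAt (fun x => wave ξ x)
    ((innerSL ℝ ξ).smulRight (2 * Real.pi * Complex.I * wave ξ x)) x := by
  have h1 : HasFDerivAt (fun x => inner ℝ ξ x) (innerSL ℝ ξ) x := (innerSL ℝ ξ).hasFDerivAt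
  have h2 := (Complex.ofRealCLM.hasFDerivAt.comp x (h1.const_mul (2 * Real.pi))).mul_const'
    Complex.I
  refine h2.cexp.congr_fderiv ?_
  ext v
  simp [wave]
  ring

theorem hasFDerivWithinAt_synth (hw : IsGevreySymbol T s γ B w) (hT : 0 < T) (hs : 1 ≤ s)
    (hγ : 0 < γ) {p : ℝ × Space n} (hp : p ∈ Icc 0 T ×ˢ (univ : Set (Space n))) :
    HasFDerivWithinAt (fun p : ℝ × Space n => synth (w p.1) p.2) (synthFDeriv T w p)
      (Icc 0 T ×ˢ univ) p := by
  have hw1 := hw.derivWithin hT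
  have hfreq : ∀ i, ∃ B', IsGevreySymbol T s (γ / 2) B' (fun t ξ => freq i ξ * w t ξ) :=
    hw.freq_mul hT.le hs hγ
  -- Links two forms of the derivative: `synthFDeriv` is written coordinatewise, so that it consists
  -- of syntheses again, while differentiating the character gives an inner product.
  have hsum : ∀ ξ v : Space n, ∑ i, v i • (freq i ξ) = 2 * Real.pi * Complex.I * inner ℝ ξ v := by
    intro ξ v
    simp only [freq, PiLp.inner_apply, Complex.real_smul]
    push_cast
    rw [Finset.mul_sum]
    refine Finset.sum_congr rfl fun i _ => ?_
    simp
    ring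
  refine hasFDerivWithinAt_integral_of_dominated
    (G := fun p ξ => wave ξ p.2 * w p.1 ξ)
    (G' := fun p ξ => (ContinuousLinearMap.fst ℝ ℝ (Space n)).smulRight
        (wave ξ p.2 * _root_.derivWithin (fun t => w t ξ) (Icc 0 T) p.1) +
      ((innerSL ℝ ξ).comp (ContinuousLinearMap.snd ℝ ℝ (Space n))).smulRight
        (2 * Real.pi * Complex.I * wave ξ p.2 * w p.1 ξ))
    (bd := fun ξ => B 1 * gevreyDecay s γ ξ + 2 * Real.pi * (B 0 *
      (((s / (γ / 2)) ^ s) ^ 1 * (Nat.factorial 1 : ℝ) ^ s * gevreyDecay s (γ / 2) ξ)))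
    ((convex_Icc 0 T).prod convex_univ) hp ?_ ?_ ?_ ?_ ?_ ?_
  · exact fun q hq => integrable_wave_mul (hw.integrable hs hγ hq.1) _
  · intro v
    have h1 := (integrable_wave_mul (hw1.integrable hs hγ hp.1) p.2).smul v.1
    have h2 : Integrable fun ξ => ∑ i, v.2 i • (wave ξ p.2 * (freq i ξ * w p.1 ξ)) :=
      integrable_finsetSum _ fun i _ => by
        obtain ⟨B', hB'⟩ := hfreq i
        exact (integrable_wave_mul (hB'.integrable hs (half_pos hγ) hp.1) p.2).smul (v.2 i)
    refine (h1.add h2).congr (ae_of_all _ fun ξ => ?_)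
    have := hsum ξ v.2
    simp only [Complex.real_smul] at this
    simp only [Pi.add_apply, Pi.smul_apply, Complex.real_smul, _root_.add_apply,
      ContinuousLinearMap.smulRight_apply, ContinuousLinearMap.coe_fst', innerSL_apply_apply,
      ContinuousLinearMap.coe_comp, Function.comp_apply, ContinuousLinearMap.coe_snd']
    congr 1
    have e : ∀ i, (v.2 i : ℂ) * (wave ξ p.2 * (freq i ξ * w p.1 ξ)) =
      (v.2 i : ℂ) * freq i ξ * (wave ξ p.2 * w p.1 ξ) := fun i => by ring
    simp only [e]
    rw [← Finset.sum_mul, this]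
    ring
  · intro v
    have h1 := (integrable_wave_mul (hw1.integrable hs hγ hp.1) p.2).smul v.1
    have h2 : ∀ i ∈ Finset.univ, Integrable fun ξ => v.2 i • (wave ξ p.2 * (freq i ξ * w p.1 ξ)) :=
      fun i _ => by
        obtain ⟨B', hB'⟩ := hfreq i
        exact (integrable_wave_mul (hB'.integrable hs (half_pos hγ) hp.1) p.2).smul (v.2 i)
    have h3 : (synthFDeriv T w p) v = ∫ ξ, ((v.1 • fun ξ => wave ξ p.2 *
        _root_.derivWithin (fun t => w t ξ) (Icc 0 T) p.1) ξ +
        ∑ i, v.2 i • (wave ξ p.2 * (freq i ξ * w p.1 ξ))) := by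
      rw [integral_add h1 (integrable_finsetSum _ h2), integral_finsetSum _ h2]
      simp only [synthFDeriv, _root_.add_apply, ContinuousLinearMap.smulRight_apply,
        ContinuousLinearMap.coe_fst', _root_.sum_apply, Pi.smul_apply, integral_smul,
        ContinuousLinearMap.coe_comp, Function.comp_apply, ContinuousLinearMap.coe_snd', synth]
      rfl
    rw [h3]
    refine integral_congr_ae (ae_of_all _ fun ξ => ?_)
    have := hsum ξ v.2
    simp only [Complex.real_smul] at this
    simp only [Pi.smul_apply, Complex.real_smul, _root_.add_apply,
      ContinuousLinearMap.smulRight_apply, ContinuousLinearMap.coe_fst', innerSL_apply_apply,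
      ContinuousLinearMap.coe_comp, Function.comp_apply, ContinuousLinearMap.coe_snd']
    congr 1
    have e : ∀ i, (v.2 i : ℂ) * (wave ξ p.2 * (freq i ξ * w p.1 ξ)) =
      (v.2 i : ℂ) * freq i ξ * (wave ξ p.2 * w p.1 ξ) := fun i => by ring
    simp only [e]
    rw [← Finset.sum_mul, this]
    ring
  · intro ξ q hq
    have h1 : HasFDerivWithinAt (fun p : ℝ × Space n => wave ξ p.2) _ (Icc 0 T ×ˢ univ) q :=
      ((hasFDerivAt_wave ξ q.2).comp q hasFDerivAt_snd).hasFDerivWithinAt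
    have h2 : HasFDerivWithinAt (fun p : ℝ × Space n => w p.1 ξ) _ (Icc 0 T ×ˢ univ) q :=
      (hw.hasDerivWithinAt ξ hq.1).hasFDerivWithinAt.comp q hasFDerivWithinAt_fst
        (fun x hx => hx.1)
    refine (h1.mul h2).congr_fderiv ?_
    ext v <;> simp
    ring
  · intro ξ q hq
    have b0 := hw.norm_le hq.1 ξ
    have b1 := hw1.norm_le hq.1 ξ
    have h4 := pow_mul_gevreyDecay_le hs (half_pos hγ) 1 ξ
    have hB := hw.nonneg hT.le 0
    have hd := (gevreyDecay_pos s (γ / 2) ξ).le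
    refine ContinuousLinearMap.opNorm_le_bound _ ?_ fun v => ?_
    · have := hw.nonneg hT.le 1
      have := (gevreyDecay_pos s γ ξ).le
      positivity
    · have n1 : ‖v.1‖ ≤ ‖v‖ := norm_fst_le v
      have n2 : ‖v.2‖ ≤ ‖v‖ := norm_snd_le v
      have n3 : ‖(inner ℝ ξ v.2 : ℝ)‖ ≤ ‖ξ‖ * ‖v.2‖ := norm_inner_le_norm _ _
      have n4 : ‖ξ‖ * (B 0 * gevreyDecay s γ ξ) ≤ B 0 * (((s / (γ / 2)) ^ s) ^ 1 *
          (Nat.factorial 1 : ℝ) ^ s * gevreyDecay s (γ / 2) ξ) := by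
        rw [← add_halves γ, gevreyDecay_add, add_halves]
        calc ‖ξ‖ * (B 0 * (gevreyDecay s (γ / 2) ξ * gevreyDecay s (γ / 2) ξ))
            ≤ (1 + ‖ξ‖) * (B 0 * (gevreyDecay s (γ / 2) ξ * gevreyDecay s (γ / 2) ξ)) := by
              gcongr; linarith
          _ = B 0 * ((1 + ‖ξ‖) ^ 1 * gevreyDecay s (γ / 2) ξ * gevreyDecay s (γ / 2) ξ) := by ring
          _ ≤ _ := by gcongr
      simp only [_root_.add_apply, ContinuousLinearMap.smulRight_apply,
        ContinuousLinearMap.coe_fst', innerSL_apply_apply, ContinuousLinearMap.coe_comp,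
        Function.comp_apply, ContinuousLinearMap.coe_snd']
      refine (norm_add_le _ _).trans ?_
      rw [norm_smul, norm_smul, norm_mul, norm_mul, norm_mul, norm_mul, norm_mul, norm_wave,
        Complex.norm_I, Complex.norm_real, Real.norm_of_nonneg Real.pi_pos.le]
      simp only [Complex.norm_ofNat, mul_one, one_mul]
      have m1 : ‖v.1‖ * ‖_root_.derivWithin (fun t => w t ξ) (Icc 0 T) q.1‖
          ≤ ‖v‖ * (B 1 * gevreyDecay s γ ξ) := by gcongr
      have m2 : ‖(inner ℝ ξ v.2 : ℝ)‖ * (2 * Real.pi * ‖w q.1 ξ‖)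
          ≤ (‖ξ‖ * ‖v‖) * (2 * Real.pi * (B 0 * gevreyDecay s γ ξ)) := by
        gcongr
        exact n3.trans (by gcongr)
      calc _ ≤ ‖v‖ * (B 1 * gevreyDecay s γ ξ)
            + (‖ξ‖ * ‖v‖) * (2 * Real.pi * (B 0 * gevreyDecay s γ ξ)) := add_le_add m1 m2
        _ = (B 1 * gevreyDecay s γ ξ) * ‖v‖
            + 2 * Real.pi * (‖ξ‖ * (B 0 * gevreyDecay s γ ξ)) * ‖v‖ := by ring
        _ ≤ _ := by
            rw [add_mul]
            gcongr
  · exact ((integrable_gevreyDecay hs hγ).const_mul _).add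
      (((integrable_gevreyDecay hs (half_pos hγ)).const_mul _).const_mul _ |>.const_mul _)

end Symbol

section Symbol

variable {n : ℕ} {T s γ : ℝ} {B : ℕ → ℝ} {w : ℝ → Space n → ℂ}

/-- Induction on the order of smoothness: `synthFDeriv` is built from syntheses of ∂_t w and of the
products of w with the frequencies, which are again Gevrey symbols, with other constants and a
smaller rate. -/
theorem contDiffOn_synth (hw : IsGevreySymbol T s γ B w) (hT : 0 < T) (hs : 1 ≤ s)
    (hγ : 0 < γ) :
    ContDiffOn ℝ ∞ (fun p : ℝ × Space n => synth (w p.1) p.2) (Icc 0 T ×ˢ univ) := by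
  have hu : UniqueDiffOn ℝ (Icc 0 T ×ˢ (univ : Set (Space n))) :=
    (uniqueDiffOn_Icc hT).prod uniqueDiffOn_univ
  rw [contDiffOn_infty]
  intro m
  induction m generalizing γ B w with
  | zero =>
    rw [Nat.cast_zero, contDiffOn_zero]
    exact fun p hp => (hasFDerivWithinAt_synth hw hT hs hγ hp).continuousWithinAt
  | succ m ih =>
    rw [Nat.cast_succ, contDiffOn_succ_iff_hasFDerivWithinAt_of_uniqueDiffOn hu]
    refine ⟨by simp, synthFDeriv T w, ?_, fun p hp => hasFDerivWithinAt_synth hw hT hs hγ hp⟩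
    unfold synthFDeriv
    refine ContDiffOn.add (contDiffOn_const.smulRight (ih (hw.derivWithin hT) hγ))
      (ContDiffOn.sum fun i _ => contDiffOn_const.smulRight ?_)
    obtain ⟨B', hB'⟩ := hw.freq_mul hT.le hs hγ i
    exact ih hB' (half_pos hγ)

theorem hasDerivWithinAt_synth (hw : IsGevreySymbol T s γ B w) (hT : 0 < T) (hs : 1 ≤ s)
    (hγ : 0 < γ) {t : ℝ} (ht : t ∈ Icc 0 T) (x : Space n) :
    HasDerivWithinAt (fun τ => synth (w τ) x)
      (synth (fun ξ => derivWithin (fun t => w t ξ) (Icc 0 T) t) x) (Icc 0 T) t := by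
  have h := (hasFDerivWithinAt_synth hw hT hs hγ (p := (t, x)) ⟨ht, trivial⟩).comp_hasDerivWithinAt
    (f := fun τ : ℝ => (τ, x)) (f' := ((1 : ℝ), (0 : Space n))) (s := Icc 0 T) t
    ((hasDerivWithinAt_id t _).prodMk (hasDerivWithinAt_const _ _ _)) (fun τ hτ => ⟨hτ, trivial⟩)
  simpa [synthFDeriv, Function.comp_def] using h

theorem iteratedDerivWithin_synth (hw : IsGevreySymbol T s γ B w) (hT : 0 < T) (hs : 1 ≤ s)
    (hγ : 0 < γ) (k : ℕ) {t : ℝ} (ht : t ∈ Icc 0 T) (x : Space n) :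
    iteratedDerivWithin k (fun τ => synth (w τ) x) (Icc 0 T) t
      = synth (fun ξ => iteratedDerivWithin k (fun t => w t ξ) (Icc 0 T) t) x := by
  induction k generalizing w B with
  | zero => simp
  | succ k ih =>
    rw [iteratedDerivWithin_succ']
    have h : EqOn (_root_.derivWithin (fun τ => synth (w τ) x) (Icc 0 T))
        (fun τ => synth (fun ξ => _root_.derivWithin (fun t => w t ξ) (Icc 0 T) τ) x) (Icc 0 T) :=
      fun τ hτ => (hasDerivWithinAt_synth hw hT hs hγ hτ x).derivWithin (uniqueDiffOn_Icc hT τ hτ)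
    rw [iteratedDerivWithin_congr h ht, ih (hw.derivWithin hT)]
    congr 1
    ext ξ
    rw [iteratedDerivWithin_succ']

theorem IsGevreySymbol.iteratedDerivWithin (hw : IsGevreySymbol T s γ B w) (hT : 0 < T) (k : ℕ) :
    IsGevreySymbol T s γ (fun j => B (k + j))
      (fun t ξ => iteratedDerivWithin k (fun t => w t ξ) (Icc 0 T) t) := by
  induction k generalizing w B with
  | zero => simpa using hw
  | succ k ih =>
    have := ih (hw.derivWithin hT)
    simp only [iteratedDerivWithin_succ']
    convert this using 2
    ring_nf

end Symbol

/-- Fourier symbols with Gevrey decay. -/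
structure HasGevreyDecay {n : ℕ} (s γ B : ℝ) (w : Space n → ℂ) : Prop where
  measurable : AEStronglyMeasurable w volume
  bound : ∀ ξ, ‖w ξ‖ ≤ B * gevreyDecay s γ ξ

theorem IsGevreySymbol.hasGevreyDecay {n : ℕ} {T s γ : ℝ} {B : ℕ → ℝ} {w : ℝ → Space n → ℂ}
    (hw : IsGevreySymbol T s γ B w) {t : ℝ} (ht : t ∈ Icc 0 T) : HasGevreyDecay s γ (B 0) (w t) :=
  ⟨hw.measurable t ht, hw.norm_le ht⟩

namespace HasGevreyDecay

variable {n : ℕ} {s γ B : ℝ} {w : Space n → ℂ}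

theorem nonneg (hw : HasGevreyDecay s γ B w) : 0 ≤ B :=
  nonneg_of_mul_nonneg_left ((norm_nonneg _).trans (hw.bound 0)) (gevreyDecay_pos _ _ _)

/-- Regarding w as constant in time on an auxiliary interval makes the results on syntheses in (t,x)
specialise to functions of x alone. -/
theorem isGevreySymbol (hw : HasGevreyDecay s γ B w) (T : ℝ) :
    IsGevreySymbol T s γ (fun _ => B) (fun _ => w) where
  contDiffOn _ := contDiffOn_const
  measurable _ _ := hw.measurable
  bound k t _ ξ := by
    cases k with
    | zero => simpa using hw.bound ξ
    | succ k =>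
      simp only [iteratedDerivWithin_const, Nat.succ_ne_zero, if_false, norm_zero]
      exact mul_nonneg hw.nonneg (gevreyDecay_pos _ _ _).le

theorem freq_mul (hw : HasGevreyDecay s γ B w) (hs : 1 ≤ s) (hγ : 0 < γ) (i : Fin n) :
    ∃ B', HasGevreyDecay s (γ / 2) B' (fun ξ => freq i ξ * w ξ) := by
  obtain ⟨B', hB'⟩ := (hw.isGevreySymbol 1).freq_mul zero_le_one hs hγ i
  exact ⟨_, hB'.hasGevreyDecay (t := 0) (by simp)⟩

theorem contDiff_synth (hw : HasGevreyDecay s γ B w) (hs : 1 ≤ s) (hγ : 0 < γ) :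
    ContDiff ℝ ∞ (synth w) := by
  have h := contDiffOn_synth (hw.isGevreySymbol 1) one_pos hs hγ
  rw [← contDiffOn_univ]
  exact h.comp (f := fun x : Space n => ((0 : ℝ), x))
    (contDiff_const.prodMk contDiff_id).contDiffOn (fun x _ => ⟨by simp, trivial⟩)

theorem pderiv_synth (hw : HasGevreyDecay s γ B w) (hs : 1 ≤ s) (hγ : 0 < γ) (i : Fin n) :
    pderiv i (synth w) = synth (fun ξ => freq i ξ * w ξ) := by
  ext x
  have h := (hasFDerivWithinAt_synth (hw.isGevreySymbol 1) one_pos hs hγ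
    (p := ((0 : ℝ), x)) ⟨by simp, trivial⟩).comp (f := fun x : Space n => ((0 : ℝ), x))
    (s := univ) x (hasFDerivAt_prodMk_right (0 : ℝ) x).hasFDerivWithinAt
    (fun x _ => ⟨by simp, trivial⟩)
  have h2 := (hasFDerivWithinAt_univ.1 h).hasLineDerivAt (EuclideanSpace.single i 1)
  refine h2.lineDeriv.trans ?_
  simp [synthFDeriv, PiLp.single_apply]

theorem iterate_pderiv_synth (hw : HasGevreyDecay s γ B w) (hs : 1 ≤ s) (hγ : 0 < γ) (i : Fin n)
    (k : ℕ) : (pderiv i)^[k] (synth w) = synth (fun ξ => freq i ξ ^ k * w ξ) ∧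
      ∃ γ' > 0, ∃ B', HasGevreyDecay s γ' B' (fun ξ => freq i ξ ^ k * w ξ) := by
  induction k with
  | zero => exact ⟨by simp, γ, hγ, B, by simpa using hw⟩
  | succ k ih =>
    obtain ⟨h1, γ', hγ', B', hB'⟩ := ih
    obtain ⟨B'', hB''⟩ := hB'.freq_mul hs hγ' i
    have e : (fun ξ => freq i ξ ^ (k + 1) * w ξ) = fun ξ => freq i ξ * (freq i ξ ^ k * w ξ) := by
      ext ξ; ring
    rw [Function.iterate_succ_apply', h1, hB'.pderiv_synth hs hγ', e]
    exact ⟨rfl, _, half_pos hγ', B'', hB''⟩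

theorem foldr_pderiv_synth (hw : HasGevreyDecay s γ B w) (hs : 1 ≤ s) (hγ : 0 < γ)
    (α : Fin n → ℕ) (l : List (Fin n)) :
    l.foldr (fun i w => (pderiv i)^[α i] w) (synth w)
      = synth (fun ξ => (l.map fun i => freq i ξ ^ α i).prod * w ξ) ∧
    ∃ γ' > 0, ∃ B', HasGevreyDecay s γ' B' (fun ξ => (l.map fun i => freq i ξ ^ α i).prod * w ξ) := by
  induction l with
  | nil => exact ⟨by simp, γ, hγ, B, by simpa using hw⟩
  | cons i l ih =>
    obtain ⟨h1, γ', hγ', B', hB'⟩ := ih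
    obtain ⟨h2, h3⟩ := hB'.iterate_pderiv_synth hs hγ' i (α i)
    simp only [List.foldr_cons, List.map_cons, List.prod_cons, mul_assoc]
    rw [h1, h2]
    exact ⟨rfl, h3⟩

theorem mderiv_synth (hw : HasGevreyDecay s γ B w) (hs : 1 ≤ s) (hγ : 0 < γ)
    (α : Fin n → ℕ) : mderiv α (synth w) = synth (fun ξ => (∏ i, freq i ξ ^ α i) * w ξ) := by
  have := (hw.foldr_pderiv_synth hs hγ α (List.finRange n)).1
  rw [mderiv, this]
  simp only [← List.ofFn_eq_map, List.prod_ofFn]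

end HasGevreyDecay

theorem norm_prod_freq_le {n : ℕ} (α : Fin n → ℕ) (ξ : Space n) :
    ‖∏ i, freq i ξ ^ α i‖ ≤ (2 * Real.pi * (1 + ‖ξ‖)) ^ order α := by
  rw [norm_prod, order, ← Finset.prod_pow_eq_pow_sum]
  refine Finset.prod_le_prod (fun _ _ => norm_nonneg _) fun i _ => ?_
  rw [norm_pow]
  gcongr
  exact norm_freq_le i ξ

/-- Fourier synthesis of a symbol with Gevrey decay is a Gevrey function, uniformly. -/
theorem exists_norm_mderiv_synth_le (n : ℕ) {s γ : ℝ} (hs : 1 ≤ s) (hγ : 0 < γ) :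
    ∃ C > (0 : ℝ), ∀ (B : ℝ) (w : Space n → ℂ), HasGevreyDecay s γ B w →
      ∀ α x, ‖mderiv α (synth w) x‖ ≤ B * (C ^ (order α + 1) * weight s α) := by
  set I : ℝ := ∫ ξ : Space n, gevreyDecay s (γ / 2) ξ with hI
  have hI0 : 0 ≤ I := integral_nonneg fun ξ => (gevreyDecay_pos _ _ _).le
  set A : ℝ := 2 * Real.pi * (s / (γ / 2)) ^ s * (n : ℝ) ^ s with hA
  have hA0 : 0 ≤ A := by positivity
  refine ⟨A + I + 1, by positivity, fun B w hw α x => ?_⟩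
  rw [hw.mderiv_synth hs hγ]
  refine (norm_synth_le _ _).trans ?_
  have hB := hw.nonneg
  -- The decay is split in two halves: one absorbs Y^{|α|} and yields (|α|!)^s, the other is left
  -- for integrability.
  have hpt : ∀ ξ, ‖(∏ i, freq i ξ ^ α i) * w ξ‖ ≤
      B * (A ^ order α * weight s α) * gevreyDecay s (γ / 2) ξ := by
    intro ξ
    have hd := (gevreyDecay_pos s (γ / 2) ξ).le
    rw [norm_mul]
    calc _ ≤ (2 * Real.pi * (1 + ‖ξ‖)) ^ order α * (B * gevreyDecay s γ ξ) := by
          gcongr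
          · exact norm_prod_freq_le α ξ
          · exact hw.bound ξ
      _ = B * ((2 * Real.pi) ^ order α * ((1 + ‖ξ‖) ^ order α * gevreyDecay s (γ / 2) ξ)) *
            gevreyDecay s (γ / 2) ξ := by
          rw [← add_halves γ, gevreyDecay_add, add_halves, mul_pow]; ring
      _ ≤ B * ((2 * Real.pi) ^ order α * (((s / (γ / 2)) ^ s) ^ order α *
            (((n : ℝ) ^ s) ^ order α * weight s α))) * gevreyDecay s (γ / 2) ξ := by
          have h1 := pow_mul_gevreyDecay_le hs (half_pos hγ) (order α) ξ
          have h2 := mul_le_mul_of_nonneg_left (factorial_order_rpow_le hs α)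
            (by positivity : 0 ≤ ((s / (γ / 2)) ^ s) ^ order α)
          have h3 := h1.trans h2
          refine mul_le_mul_of_nonneg_right (mul_le_mul_of_nonneg_left
            (mul_le_mul_of_nonneg_left h3 (by positivity)) hB) hd
      _ = _ := by rw [hA, mul_pow, mul_pow]; ring
  have h1 : ∫ ξ, ‖(∏ i, freq i ξ ^ α i) * w ξ‖ ≤ B * (A ^ order α * weight s α) * I := by
    rw [hI, ← integral_const_mul]
    exact integral_mono_of_nonneg (ae_of_all _ fun _ => norm_nonneg _)
      ((integrable_gevreyDecay hs (half_pos hγ)).const_mul _) (ae_of_all _ hpt)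
  refine h1.trans ?_
  have hwt := (weight_pos s α).le
  calc B * (A ^ order α * weight s α) * I = B * (A ^ order α * I * weight s α) := by ring
    _ ≤ B * ((A + I + 1) ^ order α * (A + I + 1) * weight s α) := by
        gcongr <;> linarith
    _ = _ := by rw [pow_succ]

/-- A net of symbols with moderate bounds gives a moderate net of functions. -/
theorem isSmoothGevreyModerate_synth {n : ℕ} {T s γ : ℝ} (hT : 0 < T) (hs : 1 ≤ s) (hγ : 0 < γ)
    {w : ℝ → ℝ → Space n → ℂ} {B : ℝ → ℕ → ℝ}
    (hw : ∀ ε ∈ Ioc (0 : ℝ) 1, IsGevreySymbol T s γ (B ε) (w ε))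
    (hB : ∀ k, ∃ N : ℕ, ∃ C > (0 : ℝ), ∀ ε ∈ Ioc (0 : ℝ) 1, B ε k ≤ C * ε⁻¹ ^ N) :
    IsSmoothGevreyModerate s T (fun ε t => synth (w ε t)) := by
  obtain ⟨C, hC, hCb⟩ := exists_norm_mderiv_synth_le n hs hγ
  -- Since the rate γ does not depend on ε, neither does the constant C, and N = 0 works: only the
  -- time derivatives cost powers of ε⁻¹.
  refine ⟨fun ε hε => contDiffOn_synth (hw ε hε) hT hs hγ, fun K _ => ⟨0, C, hC, fun k => ?_⟩⟩
  obtain ⟨N, D, hD, hN⟩ := hB k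
  refine ⟨N, D, hD, fun α t ht x _ ε hε => ?_⟩
  have h1 : mixedDeriv T k α (fun t => synth (w ε t)) t x
      = mderiv α (synth fun ξ => iteratedDerivWithin k (fun t => w ε t ξ) (Icc 0 T) t) x := by
    rw [mixedDeriv]
    congr 1
    ext y
    exact iteratedDerivWithin_synth (hw ε hε) hT hs hγ k ht y
  have h2 := hCb _ _ (((hw ε hε).iteratedDerivWithin hT k).hasGevreyDecay ht) α x
  have hε1 : 1 ≤ ε⁻¹ := (one_le_inv₀ hε.1).2 hε.2
  have hwt := (weight_pos s α).le
  rw [h1]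
  refine h2.trans ?_
  have h3 : C ^ (order α + 1) * weight s α ≤
      C ^ (order α + 1) * weight s α * ε⁻¹ ^ (0 + order α) :=
    le_mul_of_one_le_right (by positivity) (one_le_pow₀ hε1)
  exact mul_le_mul (hN ε hε) h3 (by positivity) (by have := hε.1; positivity)

theorem isGevreyModerate_synth {n : ℕ} {s γ B : ℝ} (hs : 1 ≤ s) (hγ : 0 < γ) {w : ℝ → Space n → ℂ}
    (hw : ∀ ε ∈ Ioc (0 : ℝ) 1, HasGevreyDecay s γ B (w ε)) :
    IsGevreyModerate s (fun ε => synth (w ε)) := by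
  obtain ⟨C, hC, hCb⟩ := exists_norm_mderiv_synth_le n hs hγ
  refine ⟨fun ε hε => (hw ε hε).contDiff_synth hs hγ, fun K _ =>
    ⟨(1 + |B|) * C + C, by positivity, 0, fun α x _ ε hε => ?_⟩⟩
  have hε1 : 1 ≤ ε⁻¹ := (one_le_inv₀ hε.1).2 hε.2
  have hwt := (weight_pos s α).le
  have hB : B ≤ 1 + |B| := by linarith [le_abs_self B]
  refine (hCb _ _ (hw ε hε) α x).trans ?_
  calc B * (C ^ (order α + 1) * weight s α)
      ≤ (1 + |B|) * (C ^ (order α + 1) * weight s α) := by gcongr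
    _ = C ^ order α * ((1 + |B|) * C) * weight s α := by rw [pow_succ]; ring
    _ ≤ ((1 + |B|) * C + C) ^ order α * ((1 + |B|) * C + C) * weight s α := by
        have : 0 ≤ (1 + |B|) * C := by positivity
        gcongr <;> linarith
    _ = ((1 + |B|) * C + C) ^ (order α + 1) * weight s α := by rw [pow_succ]
    _ ≤ _ := le_mul_of_one_le_right (by positivity) (one_le_pow₀ hε1)

open scoped FourierTransform LineDeriv

/-! ### Fourier transforms of compactly supported Gevrey functions -/

theorem fourier_eq_wave {n : ℕ} (g : Space n → ℂ) (ξ : Space n) :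
    𝓕 g ξ = ∫ y, wave ξ (-y) * g y := by
  rw [Real.fourier_eq']
  congr 1
  ext y
  rw [wave, smul_eq_mul, inner_neg_right, real_inner_comm]
  push_cast
  ring_nf

theorem fourierInv_eq_synth {n : ℕ} (w : Space n → ℂ) : 𝓕⁻ w = synth w := by
  ext x
  rw [Real.fourierInv_eq']
  rfl

theorem wave_sub {n : ℕ} (ξ x y : Space n) : wave ξ (x - y) = wave ξ x * wave ξ (-y) := by
  rw [wave, wave, wave, ← Complex.exp_add, sub_eq_add_neg, inner_add_right]
  push_cast
  ring_nf

theorem mderiv_single {n : ℕ} (i : Fin n) (m : ℕ) (g : Space n → ℂ) :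
    mderiv (Pi.single i m) g = (pderiv i)^[m] g := by
  have h : ∀ l : List (Fin n), l.Nodup →
      l.foldr (fun j w => (pderiv j)^[(Pi.single i m : Fin n → ℕ) j] w) g
        = if i ∈ l then (pderiv i)^[m] g else g := by
    intro l hl
    induction l with
    | nil => simp
    | cons j l ih =>
      rw [List.nodup_cons] at hl
      rw [List.foldr_cons, ih hl.2]
      by_cases hij : i = j
      · subst hij
        simp [hl.1]
      · rw [Pi.single_eq_of_ne' hij]
        simp [hij]
  rw [mderiv, h _ (List.nodup_finRange n), if_pos (List.mem_finRange i)]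

theorem order_single {n : ℕ} (i : Fin n) (m : ℕ) : order (Pi.single i m) = m := by
  simp [order]

theorem weight_single {n : ℕ} (s : ℝ) (i : Fin n) (m : ℕ) :
    weight s (Pi.single i m) = (m.factorial : ℝ) ^ s := by
  rw [weight, Finset.prod_eq_single i]
  · simp
  · intro j _ hj
    simp [Pi.single_eq_of_ne hj]
  · simp

/-- Carrying a Schwartz representative of each iterated derivative keeps it integrable and records
its support along with its Fourier transform. -/
theorem fourier_iterate_pderiv {n : ℕ} (i : Fin n) (m : ℕ) (g : 𝓢(Space n, ℂ)) :
    ∃ G : 𝓢(Space n, ℂ), (G : Space n → ℂ) = (pderiv i)^[m] g ∧ tsupport G ⊆ tsupport g ∧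
      ∀ ξ, 𝓕 (G : Space n → ℂ) ξ = freq i ξ ^ m * 𝓕 (g : Space n → ℂ) ξ := by
  induction m with
  | zero => exact ⟨g, rfl, subset_rfl, by simp⟩
  | succ m ih =>
    obtain ⟨G, hG, hs, hF⟩ := ih
    refine ⟨∂_{(EuclideanSpace.single i (1:ℝ) : Space n)} G, ?_,
      (SchwartzMap.tsupport_lineDerivOp_subset _ G).trans hs, fun ξ => ?_⟩
    · rw [Function.iterate_succ_apply', ← hG]
      ext x
      exact SchwartzMap.lineDerivOp_apply _ _ _
    · rw [← SchwartzMap.fourier_coe, SchwartzMap.fourier_lineDerivOp_eq]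
      have ht : (inner ℝ · (EuclideanSpace.single i (1:ℝ) : Space n)).HasTemperateGrowth := by
        fun_prop
      rw [_root_.smul_apply, SchwartzMap.smulLeftCLM_apply_apply ht, SchwartzMap.fourier_coe,
        hF ξ]
      simp [freq, EuclideanSpace.inner_single_right]
      ring

/-- Taking the largest coordinate reduces moments in |ξ| to moments in a single ξ_i, so that only
pure derivatives in one variable are needed. -/
theorem exists_norm_le_mul_coord {n : ℕ} (hn : 0 < n) (ξ : Space n) : ∃ i, ‖ξ‖ ≤ n * |ξ i| := by
  have : Nonempty (Fin n) := ⟨⟨0, hn⟩⟩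
  obtain ⟨i, -, hi⟩ := Finset.exists_max_image Finset.univ (fun i => |ξ i|) Finset.univ_nonempty
  refine ⟨i, ?_⟩
  have h1 : ‖ξ‖ ≤ ∑ j, |ξ j| := by
    rw [EuclideanSpace.norm_eq]
    refine Real.sqrt_le_iff.2 ⟨Finset.sum_nonneg fun _ _ => abs_nonneg _, ?_⟩
    have := Finset.sum_sq_le_sq_sum_of_nonneg (s := Finset.univ) (f := fun j => |ξ j|)
      (fun _ _ => abs_nonneg _)
    simpa using this
  refine h1.trans ((Finset.sum_le_card_nsmul _ _ _ hi).trans ?_)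
  simp

/-- Gevrey decay from bounds on all moments. -/
theorem le_gevreyDecay_of_moments {n : ℕ} {s A C : ℝ} (hs : 1 ≤ s) (hA : 0 < A) (hC : 0 ≤ C)
    {ξ : Space n} {q : ℝ} (hq : 0 ≤ q)
    (h : ∀ m : ℕ, (1 + ‖ξ‖) ^ m * q ≤ C * A ^ m * (m.factorial : ℝ) ^ s) :
    q ≤ 2 ^ s * C * gevreyDecay s (s / (2 * A ^ (1 / s))) ξ := by
  have hs0 : 0 < s := by linarith
  have hY : 0 < 1 + ‖ξ‖ := by positivity
  set Y := 1 + ‖ξ‖ with hYdef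
  set c : ℝ := 1 / (2 * A ^ (1 / s)) with hc
  -- The power 1/s turns (m!)^s into m!. With c = 1/(2A^{1/s}) the terms of the exponential series
  -- are dominated by a geometric series of ratio 1/2.
  have hterm : ∀ m : ℕ, (c * Y ^ (1 / s)) ^ m / m.factorial * q ^ (1 / s)
      ≤ C ^ (1 / s) * (1 / 2) ^ m := by
    intro m
    have h1 := Real.rpow_le_rpow (by positivity) (h m) (by positivity : 0 ≤ 1 / s)
    rw [Real.mul_rpow (by positivity) hq, Real.mul_rpow (by positivity) (by positivity),
      Real.mul_rpow hC (by positivity), ← Real.rpow_mul (by positivity : (0:ℝ) ≤ m.factorial),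
      mul_one_div_cancel hs0.ne', Real.rpow_one, ← Real.rpow_pow_comm hY.le,
      ← Real.rpow_pow_comm hA.le] at h1
    have hA' : 0 < A ^ (1 / s) := by positivity
    have e : (c * Y ^ (1 / s)) ^ m / m.factorial * q ^ (1 / s)
        = c ^ m / m.factorial * ((Y ^ (1 / s)) ^ m * q ^ (1 / s)) := by rw [mul_pow]; ring
    rw [e]
    refine (mul_le_mul_of_nonneg_left h1 (by positivity)).trans (le_of_eq ?_)
    have : (m.factorial : ℝ) ≠ 0 := by positivity
    rw [hc, one_div_pow, mul_pow, one_div_pow]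
    field_simp
  have hexp : Real.exp (c * Y ^ (1 / s)) * q ^ (1 / s) ≤ 2 * C ^ (1 / s) := by
    have h1 : HasSum (fun m : ℕ => (c * Y ^ (1 / s)) ^ m / m.factorial)
        (Real.exp (c * Y ^ (1 / s))) := by
      rw [Real.exp_eq_exp_ℝ]
      exact NormedSpace.expSeries_div_hasSum_exp _
    have h2 := (hasSum_geometric_two).mul_left (C ^ (1 / s))
    rw [mul_comm 2]
    exact hasSum_le hterm (h1.mul_right _) h2
  have h3 := Real.rpow_le_rpow (by positivity) hexp hs0.le
  rw [Real.mul_rpow (by positivity) (by positivity), Real.mul_rpow (by positivity) (by positivity),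
    ← Real.rpow_mul hq, ← Real.rpow_mul hC, one_div_mul_cancel hs0.ne', Real.rpow_one,
    Real.rpow_one, ← Real.exp_mul] at h3
  have e : gevreyDecay s (s / (2 * A ^ (1 / s))) ξ = (Real.exp (c * Y ^ (1 / s) * s))⁻¹ := by
    rw [gevreyDecay, ← Real.exp_neg, ← hYdef, hc]
    congr 1
    ring
  rw [e, ← div_eq_mul_inv, le_div_iff₀ (Real.exp_pos _), mul_comm]
  exact h3

/-- The Fourier transform of compactly supported Gevrey functions has Gevrey decay, uniformly. -/
theorem exists_fourier_decay {n : ℕ} (hn : 0 < n) {s A : ℝ} (hs : 1 ≤ s) (hA : 0 < A)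
    {K : Set (Space n)} (hK : IsCompact K) :
    ∃ γ > 0, ∃ D ≥ 0, ∀ (g : Space n → ℂ) (C : ℝ), ContDiff ℝ ∞ g → tsupport g ⊆ K →
      (∀ α x, ‖mderiv α g x‖ ≤ C * A ^ order α * weight s α) →
      HasGevreyDecay s γ (D * C) (𝓕 g) := by
  set V : ℝ := volume.real K with hV
  -- The 2 comes from (1 + |ξ|)^m ≤ 2^m (1 + |ξ|^m), the n from passing to one coordinate, and the
  -- `+ 1` makes the m-th power dominate the zeroth moment too.
  set A₁ : ℝ := 2 * (n * A + 1) with hA₁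
  have hA₁0 : 0 < A₁ := by positivity
  refine ⟨s / (2 * A₁ ^ (1 / s)), by have : 0 < s := by linarith
                                     positivity, 2 ^ s * (2 * V), by positivity, ?_⟩
  intro g C hg hgK hC
  have hC0 : 0 ≤ C := by
    have := (norm_nonneg _).trans (hC 0 0)
    simpa [order, weight] using this
  have hcs : HasCompactSupport g := hK.of_isClosed_subset (isClosed_tsupport g) hgK
  set g' : 𝓢(Space n, ℂ) := hcs.toSchwartzMap hg with hg'
  have hgg : (g' : Space n → ℂ) = g := rfl
  -- The moment is bounded by the L¹ norm of ∂_i^m g, hence by the volume of K times its supremum.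
  have hmom : ∀ i m ξ, |ξ i| ^ m * ‖𝓕 g ξ‖ ≤ V * (C * A ^ m * (m.factorial : ℝ) ^ s) := by
    intro i m ξ
    obtain ⟨G, hG, hsupp, hF⟩ := fourier_iterate_pderiv i m g'
    rw [hgg] at hG hsupp hF
    have h1 : ‖𝓕 (G : Space n → ℂ) ξ‖ ≤ ∫ y, ‖G y‖ := by
      rw [fourier_eq_wave]
      refine (norm_integral_le_integral_norm _).trans (le_of_eq ?_)
      simp [norm_wave]
    have h2 : ∫ y, ‖G y‖ ≤ V * (C * A ^ m * (m.factorial : ℝ) ^ s) := by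
      have hsub : Function.support (fun y => ‖G y‖) ⊆ K := fun y hy =>
        hgK (hsupp (subset_tsupport _ (by simpa using hy)))
      rw [← setIntegral_eq_integral_of_forall_compl_eq_zero
        (fun y hy => Function.notMem_support.1 fun h => hy (hsub h))]
      have := norm_setIntegral_le_of_norm_le_const (μ := volume) (s := K) (f := fun y => ‖G y‖)
        (C := C * A ^ m * (m.factorial : ℝ) ^ s) hK.measure_lt_top (fun y _ => by
          have := hC (Pi.single i m) y
          rw [mderiv_single, order_single, weight_single, ← hG] at this
          simpa using this)
      rw [mul_comm]
      exact (le_abs_self _).trans this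
    rw [hF, norm_mul, norm_pow] at h1
    refine le_trans ?_ (h1.trans h2)
    gcongr
    rw [freq, norm_mul, Complex.norm_I, mul_one, Complex.norm_real, norm_mul,
      Real.norm_of_nonneg (by positivity)]
    refine le_mul_of_one_le_left (abs_nonneg _) ?_
    have := Real.pi_gt_three
    linarith
  constructor
  · have : Continuous (𝓕 g) := by
      have := (𝓕 g').continuous
      rwa [SchwartzMap.fourier_coe, hgg] at this
    exact this.aestronglyMeasurable
  · intro ξ
    have key := le_gevreyDecay_of_moments (s := s) (A := A₁) (C := 2 * V * C) (ξ := ξ) hs hA₁0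
      (by positivity) (norm_nonneg (𝓕 g ξ)) (fun m => ?_)
    · refine key.trans (le_of_eq (by ring))
    obtain ⟨i, hi⟩ := exists_norm_le_mul_coord hn ξ
    have hf1 : 1 ≤ (m.factorial : ℝ) ^ s :=
      Real.one_le_rpow (by exact_mod_cast m.factorial_pos) (by linarith)
    have hY : (1 + ‖ξ‖) ^ m ≤ 2 ^ m * (1 + ‖ξ‖ ^ m) := by
      rcases le_total ‖ξ‖ 1 with h | h
      · calc (1 + ‖ξ‖) ^ m ≤ (2:ℝ) ^ m := by gcongr; linarith
          _ ≤ _ := le_mul_of_one_le_right (by positivity) (by linarith [pow_nonneg (norm_nonneg ξ) m])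
      · calc (1 + ‖ξ‖) ^ m ≤ (2 * ‖ξ‖) ^ m := by gcongr; linarith
          _ = 2 ^ m * ‖ξ‖ ^ m := mul_pow _ _ _
          _ ≤ _ := by gcongr; linarith
    have h0 := hmom i 0 ξ
    have h1 := hmom i m ξ
    simp only [pow_zero, one_mul, mul_one, Nat.factorial_zero, Nat.cast_one, Real.one_rpow] at h0
    have hq := norm_nonneg (𝓕 g ξ)
    have e1 : ‖ξ‖ ^ m * ‖𝓕 g ξ‖ ≤ (n * A) ^ m * (V * C * (m.factorial : ℝ) ^ s) := by
      calc ‖ξ‖ ^ m * ‖𝓕 g ξ‖ ≤ (n * |ξ i|) ^ m * ‖𝓕 g ξ‖ := by gcongr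
        _ = (n:ℝ) ^ m * (|ξ i| ^ m * ‖𝓕 g ξ‖) := by rw [mul_pow]; ring
        _ ≤ (n:ℝ) ^ m * (V * (C * A ^ m * (m.factorial : ℝ) ^ s)) := by gcongr
        _ = _ := by rw [mul_pow]; ring
    have e2 : (n * A) ^ m ≤ (n * A + 1) ^ m := by gcongr; linarith
    have e3 : 1 ≤ (n * A + 1) ^ m := one_le_pow₀ (by nlinarith [mul_nonneg (Nat.cast_nonneg n : (0:ℝ) ≤ n) hA.le])
    have hVC : 0 ≤ V * C := by positivity
    have e4 : ‖𝓕 g ξ‖ ≤ (n * A + 1) ^ m * (V * C * (m.factorial : ℝ) ^ s) := by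
      calc ‖𝓕 g ξ‖ ≤ 1 * (V * C * 1) := by linarith
        _ ≤ _ := by gcongr
    calc (1 + ‖ξ‖) ^ m * ‖𝓕 g ξ‖ ≤ 2 ^ m * (1 + ‖ξ‖ ^ m) * ‖𝓕 g ξ‖ := by gcongr
      _ = 2 ^ m * (‖𝓕 g ξ‖ + ‖ξ‖ ^ m * ‖𝓕 g ξ‖) := by ring
      _ ≤ 2 ^ m * ((n * A + 1) ^ m * (V * C * (m.factorial : ℝ) ^ s) +
            (n * A + 1) ^ m * (V * C * (m.factorial : ℝ) ^ s)) := by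
          have := e1.trans (mul_le_mul_of_nonneg_right e2
            (by positivity : 0 ≤ V * C * (m.factorial : ℝ) ^ s))
          gcongr
      _ = _ := by rw [hA₁, mul_pow]; ring

/-! ### Regularised data -/

theorem integrable_scaled {n : ℕ} (φ : 𝓢(Space n, ℂ)) {ρ : ℝ} (hρ : 0 < ρ) :
    Integrable (scaled φ ρ) := by
  unfold scaled
  exact ((integrable_comp_smul_iff volume φ (inv_ne_zero hρ.ne')).2 φ.integrable).const_mul _

theorem integral_norm_scaled {n : ℕ} (φ : 𝓢(Space n, ℂ)) {ρ : ℝ} (hρ : 0 < ρ) :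
    ∫ x, ‖scaled φ ρ x‖ = ∫ x, ‖φ x‖ := by
  have h := Measure.integral_comp_inv_smul_of_nonneg (volume : Measure (Space n))
    (fun x => ‖φ x‖) hρ.le
  simp only [finrank_euclideanSpace, Fintype.card_fin, smul_eq_mul] at h
  have hp : 0 < ρ ^ n := by positivity
  simp only [scaled, norm_mul, Complex.norm_real, norm_inv, Real.norm_of_nonneg hp.le]
  rw [integral_const_mul, h, inv_mul_cancel_left₀ hp.ne']

theorem norm_fourier_scaled_le {n : ℕ} (φ : 𝓢(Space n, ℂ)) {ρ : ℝ} (hρ : 0 < ρ) (ξ : Space n) :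
    ‖𝓕 (scaled φ ρ) ξ‖ ≤ ∫ x, ‖φ x‖ := by
  rw [fourier_eq_wave, ← integral_norm_scaled φ hρ]
  refine (norm_integral_le_integral_norm _).trans (le_of_eq ?_)
  simp [norm_wave]

theorem continuous_fourier {n : ℕ} {g : Space n → ℂ} (hg : Integrable g) : Continuous (𝓕 g) :=
  VectorFourier.fourierIntegral_continuous Real.continuous_fourierChar
    (by exact continuous_inner) hg

theorem HasGevreyDecay.integrable {n : ℕ} {s γ B : ℝ} {w : Space n → ℂ}
    (hw : HasGevreyDecay s γ B w) (hs : 1 ≤ s) (hγ : 0 < γ) : Integrable w :=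
  (hw.isGevreySymbol 1).integrable hs hγ (t := 0) (by simp)

theorem HasGevreyDecay.mul {n : ℕ} {s γ B D : ℝ} {w m : Space n → ℂ}
    (hw : HasGevreyDecay s γ B w) (hm : Continuous m) (hD : ∀ ξ, ‖m ξ‖ ≤ D) :
    HasGevreyDecay s γ (B * D) (fun ξ => w ξ * m ξ) where
  measurable := hw.measurable.mul hm.aestronglyMeasurable
  bound ξ := by
    have := hw.nonneg
    have := (gevreyDecay_pos s γ ξ).le
    rw [norm_mul]
    calc _ ≤ B * gevreyDecay s γ ξ * D := by
          gcongr
          · exact hw.bound ξ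
          · exact hD ξ
      _ = _ := by ring

/-- Insert Fourier inversion of g into the convolution, exchange the integrals and substitute z = x
- y; the character then factors, and the integral in z is the transform of the mollifier. -/
theorem mollifyData_eq_synth {n : ℕ} {s γ B : ℝ} (hs : 1 ≤ s) (hγ : 0 < γ) (φ : 𝓢(Space n, ℂ))
    {ρ : ℝ} (hρ : 0 < ρ) {g : Space n → ℂ} (hg : Continuous g) (hgi : Integrable g)
    (hw : HasGevreyDecay s γ B (𝓕 g)) :
    mollifyData φ ρ g = synth (fun ξ => 𝓕 g ξ * 𝓕 (scaled φ ρ) ξ) := by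
  ext x
  have hwi := hw.integrable hs hγ
  have hinv : ∀ y, g y = ∫ ξ, wave ξ y * 𝓕 g ξ := by
    intro y
    have := congrFun (hg.fourierInv_fourier_eq hgi hwi) y
    rw [fourierInv_eq_synth] at this
    exact this.symm
  have hφ := integrable_scaled φ hρ
  have hφx : Integrable fun y => scaled φ ρ (x - y) := hφ.comp_sub_left x
  have hprod : Integrable (Function.uncurry fun y ξ => wave ξ y * 𝓕 g ξ * scaled φ ρ (x - y))
      ((volume : Measure (Space n)).prod volume) := by
    have h1 := hφx.mul_prod hwi
    have h2 := h1.bdd_mul (c := 1) (f := fun p : Space n × Space n => wave p.2 p.1)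
      (continuous_wave.comp continuous_swap).aestronglyMeasurable
      (ae_of_all _ fun p => (norm_wave _ _).le)
    refine h2.congr (ae_of_all _ fun p => ?_)
    simp only [Function.uncurry]
    ring
  calc mollifyData φ ρ g x = ∫ y, ∫ ξ, wave ξ y * 𝓕 g ξ * scaled φ ρ (x - y) := by
        rw [mollifyData]
        congr 1
        ext y
        rw [integral_mul_const, ← hinv]
    _ = ∫ ξ, ∫ y, wave ξ y * 𝓕 g ξ * scaled φ ρ (x - y) := integral_integral_swap hprod
    _ = synth (fun ξ => 𝓕 g ξ * 𝓕 (scaled φ ρ) ξ) x := by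
        rw [synth]
        congr 1
        ext ξ
        have h1 : ∫ y, wave ξ y * 𝓕 g ξ * scaled φ ρ (x - y)
            = ∫ z, wave ξ (x - z) * 𝓕 g ξ * scaled φ ρ z := by
          rw [← integral_sub_left_eq_self (fun z => wave ξ (x - z) * 𝓕 g ξ * scaled φ ρ z) volume x]
          simp
        rw [h1, fourier_eq_wave (scaled φ ρ), ← integral_const_mul, ← integral_const_mul]
        congr 1
        ext z
        rw [wave_sub]
        ring

/-- The decay of the Fourier transform of a compactly supported Gevrey function. -/
theorem IsGevreyCompact.exists_decay {n : ℕ} (hn : 0 < n) {s : ℝ} (hs : 1 ≤ s) {g : Space n → ℂ}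
    (hg : IsGevreyCompact s g) : ∃ γ > 0, ∃ B, HasGevreyDecay s γ B (𝓕 g) := by
  obtain ⟨⟨hsm, hb⟩, hc⟩ := hg
  obtain ⟨C, hC, hCb⟩ := hb (tsupport g) hc
  obtain ⟨γ, hγ, D, -, h⟩ := exists_fourier_decay hn hs hC hc (K := tsupport g)
  refine ⟨γ, hγ, D * C, h g C hsm subset_rfl fun α x => ?_⟩
  by_cases hx : x ∈ tsupport g
  · have := hCb α x hx
    rwa [pow_succ, mul_comm (C ^ order α)] at this
  -- The Gevrey constant is available only on a compact set. Off the support all derivatives vanish,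
  -- so the constant of the support is global.
  · have h0 : mderiv α g x = 0 := by
      have key : ∀ v : Space n → ℂ, tsupport v ⊆ tsupport g → ∀ i,
          tsupport (pderiv i v) ⊆ tsupport g := by
        intro v hv i
        refine (closure_minimal ?_ (isClosed_tsupport v)).trans hv
        intro y hy
        by_contra hy'
        refine hy ?_
        have h1 : v =ᶠ[𝓝 y] fun _ => 0 := notMem_tsupport_iff_eventuallyEq.1 hy'
        rw [pderiv, h1.lineDeriv_eq]
        simp [lineDeriv]
      have key2 : ∀ i k (v : Space n → ℂ), tsupport v ⊆ tsupport g →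
          tsupport ((pderiv i)^[k] v) ⊆ tsupport g := by
        intro i k
        induction k with
        | zero => exact fun v hv => hv
        | succ k ih => exact fun v hv => ih _ (key v hv i)
      have key3 : ∀ l : List (Fin n),
          tsupport (l.foldr (fun i w => (pderiv i)^[α i] w) g) ⊆ tsupport g := by
        intro l
        induction l with
        | nil => exact subset_rfl
        | cons i l ih => exact key2 i (α i) _ ih
      exact image_eq_zero_of_notMem_tsupport fun h => hx (key3 _ h)
    rw [h0, norm_zero]
    have := weight_pos s α
    positivity

/-! ### The regularised right-hand side -/

theorem _root_.Continuous.wave {X : Type*} [TopologicalSpace X] {n : ℕ} {f g : X → Space n}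
    (hf : Continuous f) (hg : Continuous g) : Continuous fun x => wave (f x) (g x) :=
  continuous_wave.comp (hf.prodMk hg)

/-- The point of `[0,T]` closest to `t`. -/
def clamp (T t : ℝ) : ℝ := max 0 (min T t)

theorem clamp_mem {T : ℝ} (hT : 0 ≤ T) (t : ℝ) : clamp T t ∈ Icc 0 T :=
  ⟨le_max_left _ _, max_le hT (min_le_left _ _)⟩

theorem continuous_clamp (T : ℝ) : Continuous (clamp T) := by
  unfold clamp
  fun_prop

/-- The convolution of `κ ∈ C_c^∞(ℝ)` and a function of `t`. -/
def timeConv (κ : ℝ → ℝ) (H : ℝ → ℂ) (t : ℝ) : ℂ := ∫ τ, (κ (t - τ) : ℂ) * H τ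

theorem hasDerivAt_timeConv {κ : ℝ → ℝ} {H : ℝ → ℂ} (hκ : ContDiff ℝ ∞ κ)
    (hc : HasCompactSupport κ) (hH : Continuous H) (t : ℝ) :
    HasDerivAt (timeConv κ H) (timeConv (deriv κ) H t) t := by
  have h := hc.hasDerivAt_convolution_left (ContinuousLinearMap.lsmul ℝ ℝ)
    (hκ.of_le (by simp)) (hH.locallyIntegrable (μ := volume)) t
  have e : ∀ k : ℝ → ℝ, timeConv k H = convolution k H (ContinuousLinearMap.lsmul ℝ ℝ) volume := by
    intro k
    ext t
    rw [convolution_eq_swap]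
    simp [timeConv]
  rw [e, e]
  exact h

theorem hasCompactSupport_iteratedDeriv {κ : ℝ → ℝ} (hc : HasCompactSupport κ) (k : ℕ) :
    HasCompactSupport (iteratedDeriv k κ) := by
  induction k with
  | zero => simpa using hc
  | succ k ih => rw [iteratedDeriv_succ]; exact ih.deriv

theorem contDiff_iteratedDeriv {F : Type*} [NormedAddCommGroup F] [NormedSpace ℝ F] {κ : ℝ → F}
    (hκ : ContDiff ℝ ∞ κ) (k : ℕ) : ContDiff ℝ ∞ (iteratedDeriv k κ) := by
  induction k with
  | zero => simpa using hκ
  | succ k ih => rw [iteratedDeriv_succ]; exact (contDiff_infty_iff_deriv.1 ih).2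

theorem iteratedDeriv_timeConv {κ : ℝ → ℝ} {H : ℝ → ℂ} (hκ : ContDiff ℝ ∞ κ)
    (hc : HasCompactSupport κ) (hH : Continuous H) (k : ℕ) :
    iteratedDeriv k (timeConv κ H) = timeConv (iteratedDeriv k κ) H := by
  induction k with
  | zero => simp
  | succ k ih =>
    rw [iteratedDeriv_succ, ih, iteratedDeriv_succ]
    ext t
    exact (hasDerivAt_timeConv (contDiff_iteratedDeriv hκ k)
      (hasCompactSupport_iteratedDeriv hc k) hH t).deriv

theorem contDiff_timeConv {κ : ℝ → ℝ} {H : ℝ → ℂ} (hκ : ContDiff ℝ ∞ κ)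
    (hc : HasCompactSupport κ) (hH : Continuous H) : ContDiff ℝ ∞ (timeConv κ H) := by
  refine contDiff_of_differentiable_iteratedDeriv fun m _ => ?_
  rw [iteratedDeriv_timeConv hκ hc hH]
  exact fun t => (hasDerivAt_timeConv (contDiff_iteratedDeriv hκ m)
    (hasCompactSupport_iteratedDeriv hc m) hH t).differentiableAt

theorem norm_timeConv_le {κ : ℝ → ℝ} {H : ℝ → ℂ} (hκ : Continuous κ)
    (hc : HasCompactSupport κ) {D : ℝ} (hD : ∀ τ, ‖H τ‖ ≤ D) (t : ℝ) :
    ‖timeConv κ H t‖ ≤ (∫ τ, |κ τ|) * D := by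
  have hi : Integrable fun τ => |κ τ| := (hκ.integrable_of_hasCompactSupport hc).abs
  have h1 : ‖timeConv κ H t‖ ≤ ∫ τ, |κ (t - τ)| * D := by
    refine norm_integral_le_of_norm_le ((hi.comp_sub_left t).mul_const D) (ae_of_all _ fun τ => ?_)
    rw [norm_mul, Complex.norm_real, Real.norm_eq_abs]
    gcongr
    exact hD τ
  rwa [integral_mul_const, integral_sub_left_eq_self (fun τ => |κ τ|) volume t] at h1

/-- The substitution u = t - τ places the integral on the fixed compact support of κ, where joint
continuity of the integrand suffices. -/
theorem continuous_timeConv {X : Type*} [TopologicalSpace X] [FirstCountableTopology X]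
    [LocallyCompactSpace X] {κ : ℝ → ℝ} {H : ℝ → X → ℂ} (hκ : Continuous κ)
    (hc : HasCompactSupport κ) (hH : Continuous (Function.uncurry H)) :
    Continuous fun p : ℝ × X => timeConv κ (fun τ => H τ p.2) p.1 := by
  have e : ∀ p : ℝ × X, timeConv κ (fun τ => H τ p.2) p.1
      = ∫ u in tsupport κ, (κ u : ℂ) * H (p.1 - u) p.2 := by
    intro p
    rw [timeConv, setIntegral_eq_integral_of_forall_compl_eq_zero
      (fun u hu => by simp [image_eq_zero_of_notMem_tsupport hu]),
      ← integral_sub_left_eq_self (fun u => (κ u : ℂ) * H (p.1 - u) p.2) volume p.1]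
    simp
  simp only [e]
  refine continuous_parametric_integral_of_continuous
    (f := fun (p : ℝ × X) u => (κ u : ℂ) * H (p.1 - u) p.2) ?_ hc
  have h1 : Continuous fun q : (ℝ × X) × ℝ => H (q.1.1 - q.2) q.1.2 :=
    hH.comp (((continuous_fst.comp continuous_fst).sub continuous_snd).prodMk
      (continuous_snd.comp continuous_fst))
  exact (Complex.continuous_ofReal.comp (hκ.comp continuous_snd)).mul h1

/-- The scaled mollifier `ψ_ρ(t) = ρ⁻¹ ψ(t/ρ)`. -/
def scaledReal (ψ : ℝ → ℝ) (ρ : ℝ) (t : ℝ) : ℝ := ρ⁻¹ * ψ (ρ⁻¹ * t)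

theorem iteratedDeriv_scaledReal {ψ : ℝ → ℝ} (hψ : ContDiff ℝ ∞ ψ) (ρ : ℝ) (k : ℕ) :
    iteratedDeriv k (scaledReal ψ ρ) = fun t => ρ⁻¹ ^ k * scaledReal (iteratedDeriv k ψ) ρ t := by
  ext t
  have h1 : ContDiff ℝ k ψ := hψ.of_le (by exact_mod_cast le_top)
  unfold scaledReal
  rw [iteratedDeriv_const_mul _ (by fun_prop), iteratedDeriv_comp_const_mul h1]
  ring

theorem hasCompactSupport_scaledReal {ψ : ℝ → ℝ} (hψ : HasCompactSupport ψ) {ρ : ℝ} (hρ : 0 < ρ) :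
    HasCompactSupport (scaledReal ψ ρ) :=
  HasCompactSupport.mul_left
    (hψ.comp_homeomorph (Homeomorph.mulLeft₀ ρ⁻¹ (inv_ne_zero hρ.ne')))

theorem integral_abs_scaledReal (ψ : ℝ → ℝ) {ρ : ℝ} (hρ : 0 < ρ) :
    ∫ t, |scaledReal ψ ρ t| = ∫ t, |ψ t| := by
  simp only [scaledReal, abs_mul, abs_inv, abs_of_pos hρ]
  rw [integral_const_mul, Measure.integral_comp_mul_left (fun t => |ψ t|), inv_inv,
    abs_of_pos hρ, smul_eq_mul, inv_mul_cancel_left₀ hρ.ne']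

/-- The Fourier transform in `x` of a function on `[0,T] × ℝⁿ`, extended constantly in time. -/
def clampedFourier {n : ℕ} (T : ℝ) (f : ℝ → Space n → ℂ) (τ : ℝ) (ξ : Space n) : ℂ :=
  𝓕 (f (clamp T τ)) ξ

/-- The symbol of the regularised right-hand side. -/
def sourceSymbol {n : ℕ} (T : ℝ) (ψ : ℝ → ℝ) (φ : 𝓢(Space n, ℂ)) (ρ : ℝ) (f : ℝ → Space n → ℂ)
    (t : ℝ) (ξ : Space n) : ℂ :=
  𝓕 (scaled φ ρ) ξ * timeConv (scaledReal ψ ρ) (fun τ => clampedFourier T f τ ξ) t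

section Source

variable {n : ℕ} {s T : ℝ} {f : ℝ → Space n → ℂ}

/-- Joint continuity combines continuity in x at one fixed time with the case α = 0 of the
continuity in time, which is uniform in x. -/
theorem IsContinuousGevreyCompact.continuous_clamp (hT : 0 ≤ T)
    (hf : IsContinuousGevreyCompact s T f) :
    Continuous fun p : ℝ × Space n => f (clamp T p.1) p.2 := by
  obtain ⟨K, hK, A, hA, hreg, hcont⟩ := hf
  rw [continuous_iff_continuousAt]
  intro p
  rw [Metric.continuousAt_iff']
  intro δ hδ
  have hc : Continuous (f (clamp T p.1)) := (hreg _ (clamp_mem hT p.1)).1.continuous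
  have h1 : ∀ᶠ q : ℝ × Space n in 𝓝 p, dist (f (clamp T p.1) q.2) (f (clamp T p.1) p.2) < δ / 2 :=
    Metric.continuousAt_iff'.1 ((hc.comp continuous_snd).continuousAt (x := p)) _ (half_pos hδ)
  have h2 := hcont _ (clamp_mem hT p.1) (δ / 2) (half_pos hδ)
  have ht : Tendsto (fun q : ℝ × Space n => clamp T q.1) (𝓝 p) (𝓝[Icc 0 T] (clamp T p.1)) :=
    tendsto_nhdsWithin_iff.2 ⟨((VeryWeakWave.continuous_clamp T).comp continuous_fst).continuousAt,
      Eventually.of_forall fun q => clamp_mem hT _⟩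
  filter_upwards [h1, ht.eventually h2] with q h3 h4
  have h5 := h4 0 q.2
  have e : ∀ v : Space n → ℂ, mderiv 0 v = v := by
    intro v
    have : ∀ l : List (Fin n), l.foldr (fun i w => (pderiv i)^[(0 : Fin n → ℕ) i] w) v = v := by
      intro l
      induction l with
      | nil => rfl
      | cons i l ih => rw [List.foldr_cons, ih]; rfl
    exact this _
  simp only [e, order, weight, Pi.zero_apply, Finset.sum_const_zero, pow_zero, mul_one,
    Nat.factorial_zero, Nat.cast_one, Finset.prod_const_one, Real.one_rpow] at h5
  rw [← dist_eq_norm] at h5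
  have := dist_triangle (f (clamp T q.1) q.2) (f (clamp T p.1) q.2) (f (clamp T p.1) p.2)
  linarith

theorem mderiv_add_sub_le {A C δ : ℝ} {g g' : Space n → ℂ}
    (hC : ∀ α x, ‖mderiv α g x‖ ≤ C * A ^ order α * weight s α)
    (hδ : ∀ α x, ‖mderiv α g' x - mderiv α g x‖ ≤ δ * A ^ order α * weight s α) :
    ∀ α x, ‖mderiv α g' x‖ ≤ (C + δ) * A ^ order α * weight s α := by
  intro α x
  have h1 := norm_le_norm_add_norm_sub' (mderiv α g' x) (mderiv α g x)
  have := hC α x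
  have := hδ α x
  linarith

/-- The Gevrey constant C of f(t) may depend on t. Continuity in t makes it locally bounded and
compactness of [0,T] makes it uniform, so that one rate and one constant serve all times. -/
theorem IsContinuousGevreyCompact.exists_decay (hn : 0 < n) (hs : 1 ≤ s)
    (hf : IsContinuousGevreyCompact s T f) :
    (∃ K, IsCompact K ∧ ∀ t ∈ Icc 0 T, tsupport (f t) ⊆ K) ∧
    ∃ γ > 0, ∃ B ≥ 0, ∀ t ∈ Icc 0 T, HasGevreyDecay s γ B (𝓕 (f t)) := by
  obtain ⟨K, hK, A, hA, hreg, hcont⟩ := hf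
  refine ⟨⟨K, hK, fun t ht => (hreg t ht).2.1⟩, ?_⟩
  obtain ⟨γ, hγ, D, hD, h⟩ := exists_fourier_decay hn hs hA hK
  -- The repeated membership is the shape of the induction predicate, which has to make sense for
  -- sets S not contained in [0,T].
  have hunif : ∃ C ≥ (0 : ℝ), ∀ t ∈ Icc 0 T, t ∈ Icc 0 T → ∀ α x,
      ‖mderiv α (f t) x‖ ≤ C * A ^ order α * weight s α := by
    refine isCompact_Icc.induction_on (s := Icc 0 T)
      (p := fun S => ∃ C ≥ (0 : ℝ), ∀ t ∈ S, t ∈ Icc 0 T → ∀ α x,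
        ‖mderiv α (f t) x‖ ≤ C * A ^ order α * weight s α)
      ⟨0, le_rfl, by simp⟩ ?_ ?_ ?_
    · rintro S S' hSS ⟨C, hC0, hC⟩
      exact ⟨C, hC0, fun t ht => hC t (hSS ht)⟩
    · rintro S S' ⟨C, hC0, hC⟩ ⟨C', hC0', hC'⟩
      refine ⟨C + C', by positivity, fun t ht hti α x => ?_⟩
      have hw := (weight_pos s α).le
      rcases ht with ht | ht
      · refine (hC t ht hti α x).trans ?_
        gcongr
        linarith
      · refine (hC' t ht hti α x).trans ?_
        gcongr
        linarith
    · intro t ht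
      obtain ⟨C, hC⟩ := (hreg t ht).2.2
      refine ⟨_, hcont t ht 1 one_pos, |C| + 1, by positivity, fun t' ht' _ α x => ?_⟩
      refine (mderiv_add_sub_le hC ht' α x).trans ?_
      have hw := (weight_pos s α).le
      gcongr
      exact le_abs_self C
  obtain ⟨C, hC0, hC⟩ := hunif
  exact ⟨γ, hγ, D * C, by positivity, fun t ht =>
    h (f t) C (hreg t ht).1 (hreg t ht).2.1 (hC t ht ht)⟩

/-- The supports lie in one compact set K, so the transform is an integral over K with a jointly
continuous integrand. -/
theorem IsContinuousGevreyCompact.continuous_fourier (hn : 0 < n) (hs : 1 ≤ s) (hT : 0 ≤ T)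
    (hf : IsContinuousGevreyCompact s T f) :
    Continuous (Function.uncurry (clampedFourier T f)) := by
  obtain ⟨⟨K, hK, hsupp⟩, -⟩ := hf.exists_decay hn hs
  have e : Function.uncurry (clampedFourier T f) = fun p : ℝ × Space n => ∫ y in K, wave p.2 (-y) * f (clamp T p.1) y := by
    ext p
    rw [Function.uncurry, clampedFourier, fourier_eq_wave, setIntegral_eq_integral_of_forall_compl_eq_zero]
    intro y hy
    rw [image_eq_zero_of_notMem_tsupport fun h => hy (hsupp _ (clamp_mem hT _) h), mul_zero]
  rw [e]
  refine continuous_parametric_integral_of_continuous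
    (f := fun (p : ℝ × Space n) y => wave p.2 (-y) * f (clamp T p.1) y) ?_ hK
  have h1 := hf.continuous_clamp hT
  have h2 : Continuous fun q : (ℝ × Space n) × Space n => wave q.1.2 (-q.2) :=
    (continuous_snd.comp continuous_fst).wave continuous_snd.neg
  have h3 : Continuous fun q : (ℝ × Space n) × Space n => f (clamp T q.1.1) q.2 :=
    h1.comp ((continuous_fst.comp continuous_fst).prodMk continuous_snd)
  exact h2.mul h3

variable {ψ : ℝ → ℝ} {φ : 𝓢(Space n, ℂ)} {ρ : ℝ}

theorem contDiff_scaledReal (hψ : ContDiff ℝ ∞ ψ) : ContDiff ℝ ∞ (scaledReal ψ ρ) := by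
  unfold scaledReal
  fun_prop

theorem continuous_sourceSymbol (hn : 0 < n) (hs : 1 ≤ s) (hT : 0 ≤ T)
    (hf : IsContinuousGevreyCompact s T f) (hψ : ContDiff ℝ ∞ ψ) (hψc : HasCompactSupport ψ)
    (hρ : 0 < ρ) : Continuous (Function.uncurry (sourceSymbol T ψ φ ρ f)) := by
  have h1 := continuous_timeConv (κ := scaledReal ψ ρ) (contDiff_scaledReal hψ).continuous
    (hasCompactSupport_scaledReal hψc hρ) (hf.continuous_fourier hn hs hT)
  exact ((continuous_fourier (integrable_scaled φ hρ)).comp continuous_snd).mul h1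

theorem contDiff_sourceSymbol (hn : 0 < n) (hs : 1 ≤ s) (hT : 0 ≤ T)
    (hf : IsContinuousGevreyCompact s T f) (hψ : ContDiff ℝ ∞ ψ) (hψc : HasCompactSupport ψ)
    (hρ : 0 < ρ) (ξ : Space n) : ContDiff ℝ ∞ fun t => sourceSymbol T ψ φ ρ f t ξ := by
  have hH : Continuous fun τ => clampedFourier T f τ ξ :=
    Continuous.uncurry_right ξ (hf.continuous_fourier hn hs hT)
  exact contDiff_const.mul (contDiff_timeConv (contDiff_scaledReal hψ)
    (hasCompactSupport_scaledReal hψc hρ) hH)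

/-- All time derivatives fall on the mollifier in t: the k-th one costs ρ^{-k} and none of the decay
in ξ. -/
theorem isGevreySymbol_sourceSymbol (hn : 0 < n) (hs : 1 ≤ s) (hT : 0 < T)
    (hf : IsContinuousGevreyCompact s T f) (hψ : ContDiff ℝ ∞ ψ) (hψc : HasCompactSupport ψ)
    (hρ : 0 < ρ) {γ B : ℝ}
    (hd : ∀ t ∈ Icc 0 T, HasGevreyDecay s γ B (𝓕 (f t))) :
    IsGevreySymbol T s γ (fun k => (∫ x, ‖φ x‖) * B * (ρ⁻¹ ^ k * ∫ τ, |iteratedDeriv k ψ τ|))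
      (sourceSymbol T ψ φ ρ f) where
  contDiffOn ξ := (contDiff_sourceSymbol hn hs hT.le hf hψ hψc hρ ξ).contDiffOn
  measurable t _ := (Continuous.uncurry_left t
    (continuous_sourceSymbol hn hs hT.le hf hψ hψc hρ)).aestronglyMeasurable
  bound k t ht ξ := by
    have hH : Continuous fun τ => clampedFourier T f τ ξ :=
      Continuous.uncurry_right ξ (hf.continuous_fourier hn hs hT.le)
    have hsm := contDiff_scaledReal (ρ := ρ) hψ
    have hcs := hasCompactSupport_scaledReal hψc hρ
    have hφ : 0 ≤ ∫ x, ‖φ x‖ := integral_nonneg fun _ => norm_nonneg _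
    have h2 := norm_timeConv_le (contDiff_iteratedDeriv hsm k).continuous
      (hasCompactSupport_iteratedDeriv hcs k) (H := fun τ => clampedFourier T f τ ξ)
      (D := B * gevreyDecay s γ ξ)
      (fun τ => (hd _ (clamp_mem hT.le τ)).bound ξ) t
    have h3 : ∫ τ, |iteratedDeriv k (scaledReal ψ ρ) τ|
        = ρ⁻¹ ^ k * ∫ τ, |iteratedDeriv k ψ τ| := by
      rw [iteratedDeriv_scaledReal hψ, ← integral_abs_scaledReal (iteratedDeriv k ψ) hρ,
        ← integral_const_mul]
      simp [abs_mul, abs_of_pos hρ]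
    rw [iteratedDerivWithin_eq_iteratedDeriv (uniqueDiffOn_Icc hT)
      (((contDiff_sourceSymbol hn hs hT.le hf hψ hψc hρ ξ).of_le
        (by exact_mod_cast le_top)).contDiffAt) ht]
    unfold sourceSymbol
    rw [iteratedDeriv_const_mul_field, iteratedDeriv_timeConv hsm hcs hH, norm_mul]
    rw [h3] at h2
    calc _ ≤ (∫ x, ‖φ x‖) * (ρ⁻¹ ^ k * (∫ τ, |iteratedDeriv k ψ τ|) * (B * gevreyDecay s γ ξ)) := by
          gcongr
          exact norm_fourier_scaled_le φ hρ ξ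
      _ = _ := by ring

/-- At each time the mollification in x is a synthesis. Fubini in (τ, ξ) applies because the
integrand is dominated by the product of |ψ_ρ(t - τ)| and the Gevrey weight. -/
theorem mollifySource_eq_synth (hn : 0 < n) (hs : 1 ≤ s) (hT : 0 < T)
    (hf : IsContinuousGevreyCompact s T f) (ψ : 𝓓((⊤ : TopologicalSpace.Opens ℝ), ℝ)) (hρ : 0 < ρ) :
    mollifySource T ψ φ ρ f = fun t => synth (sourceSymbol T ψ φ ρ f t) := by
  obtain ⟨⟨K, hK, hsupp⟩, γ, hγ, B, hB, hd⟩ := hf.exists_decay hn hs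
  ext t x
  set κ := scaledReal ψ ρ with hκ
  have hsm : ContDiff ℝ ∞ κ := contDiff_scaledReal ψ.contDiff
  have hcs : HasCompactSupport κ := hasCompactSupport_scaledReal ψ.hasCompactSupport hρ
  have hHc := hf.continuous_fourier hn hs hT.le
  have hcont : ∀ τ, Continuous (f (clamp T τ)) := fun τ =>
    (hf.continuous_clamp hT.le).comp (Continuous.prodMk (continuous_const (y := τ)) continuous_id)
  have hprod : Integrable (Function.uncurry fun (τ : ℝ) (ξ : Space n) => (κ (t - τ) : ℂ) *
      (wave ξ x * (clampedFourier T f τ ξ * 𝓕 (scaled φ ρ) ξ)))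
      ((volume : Measure ℝ).prod volume) := by
    have hi : Integrable fun τ => κ (t - τ) :=
      (hsm.continuous.integrable_of_hasCompactSupport hcs).comp_sub_left t
    have h1 := (hi.norm.mul_prod (integrable_gevreyDecay (n := n) hs hγ)).mul_const
      (B * ∫ x, ‖φ x‖)
    refine h1.mono' ?_ (ae_of_all _ fun p => ?_)
    · refine Continuous.aestronglyMeasurable ?_
      have c1 : Continuous fun p : ℝ × Space n => (κ (t - p.1) : ℂ) :=
        Complex.continuous_ofReal.comp (hsm.continuous.comp (continuous_const.sub continuous_fst))
      have c2 : Continuous fun p : ℝ × Space n => wave p.2 x :=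
        continuous_snd.wave continuous_const
      exact c1.mul (c2.mul (hHc.mul
        ((VeryWeakWave.continuous_fourier (integrable_scaled φ hρ)).comp continuous_snd)))
    · simp only [Function.uncurry, norm_mul, Complex.norm_real, norm_wave, one_mul]
      have b1 := (hd _ (clamp_mem hT.le p.1)).bound p.2
      have b2 := norm_fourier_scaled_le φ hρ p.2
      have b3 := mul_nonneg hB (gevreyDecay_pos s γ p.2).le
      calc _ ≤ ‖κ (t - p.1)‖ * (B * gevreyDecay s γ p.2 * ∫ x, ‖φ x‖) := by
            gcongr
            exact b1
        _ = _ := by ring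
  have hstep : ∀ τ, (((ρ⁻¹ * ψ ((t - τ) / ρ) : ℝ) : ℂ)) * mollifyData φ ρ (f (max 0 (min T τ))) x
      = ∫ ξ, (κ (t - τ) : ℂ) * (wave ξ x * (clampedFourier T f τ ξ * 𝓕 (scaled φ ρ) ξ)) := by
    intro τ
    have hm := clamp_mem hT.le τ
    have h1 := mollifyData_eq_synth hs hγ φ hρ (hcont τ)
      ((hcont τ).integrable_of_hasCompactSupport
        (hK.of_isClosed_subset (isClosed_tsupport _) (hsupp _ hm))) (hd _ hm)
    have h2 : mollifyData φ ρ (f (max 0 (min T τ))) x = _ := congrFun h1 x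
    rw [h2, synth, ← integral_const_mul, hκ, scaledReal, div_eq_inv_mul]
    rfl
  rw [mollifySource]
  simp only [hstep]
  rw [integral_integral_swap hprod, synth]
  congr 1
  ext ξ
  rw [sourceSymbol, timeConv, ← integral_const_mul, ← integral_const_mul]
  congr 1
  ext τ
  ring

end Source

/-! ### Regularisations of distributions -/

section Distribution

variable {F : Type*} [NormedAddCommGroup F] [NormedSpace ℝ F]

/-- Distributions have finite order on compact sets. -/
theorem exists_order_bound (v : 𝓓'((⊤ : TopologicalSpace.Opens ℝ), F)) {K : Set ℝ}
    (hK : IsCompact K) : ∃ N : ℕ, ∃ C ≥ (0 : ℝ), ∀ η : 𝓓((⊤ : TopologicalSpace.Opens ℝ), ℝ),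
      tsupport η ⊆ K → ∀ D ≥ (0 : ℝ), (∀ j ≤ N, ∀ x, |iteratedDeriv j η x| ≤ D) → ‖v η‖ ≤ C * D := by
  set K' : TopologicalSpace.Compacts ℝ := ⟨K, hK⟩ with hK'
  have hsub : (K' : Set ℝ) ⊆ (⊤ : TopologicalSpace.Opens ℝ) := fun _ _ => trivial
  -- On test functions supported in K the topology is given by suprema of derivatives, so continuity
  -- of ‖L ·‖ yields finitely many of them; N is the largest order that occurs.
  set L := v.comp (TestFunction.ofSupportedInCLM ℝ (n := ⊤) (F := ℝ) hsub) with hL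
  set q : Seminorm ℝ _ := (normSeminorm ℝ F).comp L.toLinearMap with hq
  have hqc : Continuous q := continuous_norm.comp L.continuous
  obtain ⟨S, C, -, hC⟩ := Seminorm.bound_of_continuous
    (ContDiffMapSupportedIn.withSeminorms ℝ ℝ ℝ ⊤ K') q hqc
  refine ⟨S.sup id, C, C.2, fun η hη D hD hb => ?_⟩
  set η' : ContDiffMapSupportedIn ℝ ℝ ⊤ K' :=
    ContDiffMapSupportedIn.of_support_subset η.contDiff ((subset_tsupport _).trans hη) with hη'
  have h1 : L η' = v η := by
    rw [hL]
    change v (TestFunction.ofSupportedInCLM ℝ hsub η') = v η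
    congr 1
  have h2 := hC η'
  have h3 : q η' = ‖v η‖ := by rw [← h1]; rfl
  rw [h3] at h2
  refine h2.trans ?_
  change (C : ℝ) * _ ≤ _
  refine mul_le_mul_of_nonneg_left ?_ C.2
  refine Seminorm.finset_sup_apply_le hD fun i hi => ?_
  rw [ContDiffMapSupportedIn.seminorm_top_le_iff ℝ hD]
  intro x hx
  rw [norm_iteratedFDeriv_eq_norm_iteratedDeriv]
  exact hb i (Finset.le_sup (f := id) hi) x

/-- The derivative of a test function. -/
def derivTest (ψ : 𝓓((⊤ : TopologicalSpace.Opens ℝ), ℝ)) : 𝓓((⊤ : TopologicalSpace.Opens ℝ), ℝ) where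
  toFun := deriv ψ
  contDiff' := (contDiff_infty_iff_deriv.1 ψ.contDiff).2
  hasCompactSupport' := ψ.hasCompactSupport.deriv
  tsupport_subset' := fun _ _ => trivial

theorem coe_derivTest (ψ : 𝓓((⊤ : TopologicalSpace.Opens ℝ), ℝ)) :
    (derivTest ψ : ℝ → ℝ) = deriv ψ := rfl

theorem coe_iterate_derivTest (ψ : 𝓓((⊤ : TopologicalSpace.Opens ℝ), ℝ)) (k : ℕ) :
    (derivTest^[k] ψ : ℝ → ℝ) = iteratedDeriv k ψ := by
  induction k with
  | zero => simp
  | succ k ih => rw [Function.iterate_succ_apply', coe_derivTest, ih, iteratedDeriv_succ]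

theorem coe_mollifierAt (ψ : 𝓓((⊤ : TopologicalSpace.Opens ℝ), ℝ)) {μ : ℝ} (hμ : 0 < μ) (t : ℝ) :
    (mollifierAt ψ μ t : ℝ → ℝ) = fun τ => scaledReal ψ μ (t - τ) := by
  rw [mollifierAt, dif_pos hμ]
  ext τ
  simp [scaledReal, div_eq_inv_mul]

theorem iteratedDeriv_mollifierAt (ψ : 𝓓((⊤ : TopologicalSpace.Opens ℝ), ℝ)) {μ : ℝ} (hμ : 0 < μ)
    (t : ℝ) (j : ℕ) : iteratedDeriv j (mollifierAt ψ μ t) =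
      fun τ => (-1) ^ j * iteratedDeriv j (scaledReal ψ μ) (t - τ) := by
  rw [coe_mollifierAt ψ hμ, iteratedDeriv_comp_const_sub]
  rfl

theorem exists_tsupport_subset (ψ : 𝓓((⊤ : TopologicalSpace.Opens ℝ), ℝ)) (R M : ℝ) :
    ∃ K : Set ℝ, IsCompact K ∧ ∀ μ t : ℝ, 0 < μ → μ ≤ M → |t| ≤ R →
      tsupport (mollifierAt ψ μ t) ⊆ K := by
  obtain ⟨S, hS⟩ := (ψ.hasCompactSupport : IsCompact (tsupport ψ)).isBounded.exists_norm_le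
  refine ⟨Icc (-(R + M * |S|)) (R + M * |S|), isCompact_Icc, fun μ t hμ hM ht => ?_⟩
  refine closure_minimal (fun τ hτ => ?_) isClosed_Icc
  rw [Function.mem_support, coe_mollifierAt ψ hμ] at hτ
  have h1 : μ⁻¹ * (t - τ) ∈ tsupport ψ := by
    refine subset_tsupport _ fun h => hτ ?_
    simp [scaledReal, h]
  have h2 := hS _ h1
  rw [Real.norm_eq_abs, abs_mul, abs_inv, abs_of_pos hμ, inv_mul_le_iff₀ hμ] at h2
  have h3 : |t - τ| ≤ M * |S| := h2.trans
    ((mul_le_mul_of_nonneg_left (le_abs_self S) hμ.le).trans (by gcongr))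
  have h4 := abs_sub_abs_le_abs_sub τ t
  rw [abs_sub_comm] at h4
  exact abs_le.1 (by linarith)

theorem exists_bound_of_hasCompactSupport {g : ℝ → ℝ} (hg : Continuous g)
    (hc : HasCompactSupport g) : ∃ C ≥ (0 : ℝ), ∀ x, |g x| ≤ C := by
  obtain ⟨C, hC⟩ := hg.bounded_above_of_compact_support hc
  exact ⟨C, (norm_nonneg _).trans (hC 0), hC⟩

theorem abs_taylor_two_le {G : ℝ → ℝ} (hG : ContDiff ℝ ∞ G) {M : ℝ}
    (hM : ∀ x, |deriv (deriv G) x| ≤ M) (y h : ℝ) :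
    |G (y + h) - G y - h * deriv G y| ≤ M * h ^ 2 := by
  have hG' : ContDiff ℝ ∞ (deriv G) := (contDiff_infty_iff_deriv.1 hG).2
  have hd : Differentiable ℝ G := hG.differentiable (by simp)
  have hd' : Differentiable ℝ (deriv G) := hG'.differentiable (by simp)
  have hM0 : 0 ≤ M := (abs_nonneg _).trans (hM 0)
  have h1 : ∀ z ∈ Metric.closedBall y |h|, ‖deriv G z - deriv G y‖ ≤ M * |h| := by
    intro z hz
    have := Convex.norm_image_sub_le_of_norm_deriv_le (f := deriv G) (C := M) (x := y) (y := z)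
      (fun x _ => hd' x) (fun x _ => hM x) convex_univ trivial trivial
    refine this.trans ?_
    rw [Metric.mem_closedBall, Real.dist_eq] at hz
    gcongr
    exact hz
  have h2 := Convex.norm_image_sub_le_of_norm_hasDerivWithin_le
    (f := fun z => G z - z * deriv G y) (f' := fun z => deriv G z - deriv G y)
    (C := M * |h|) (x := y) (y := y + h) (s := Metric.closedBall y |h|)
    (fun z _ => by
      have := (hd z).hasDerivAt.sub ((hasDerivAt_id z).mul_const (deriv G y))
      rw [one_mul] at this
      exact this.hasDerivWithinAt) h1 (convex_closedBall _ _)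
    (Metric.mem_closedBall_self (abs_nonneg _)) (by simp [Metric.mem_closedBall])
  have e : G (y + h) - (y + h) * deriv G y - (G y - y * deriv G y)
      = G (y + h) - G y - h * deriv G y := by ring
  rw [Real.norm_eq_abs, e, add_sub_cancel_left, Real.norm_eq_abs] at h2
  refine h2.trans (le_of_eq ?_)
  rw [mul_assoc, abs_mul_abs_self, sq]

theorem scaledReal_deriv {ψ : ℝ → ℝ} (hψ : ContDiff ℝ ∞ ψ) (μ t : ℝ) :
    deriv (scaledReal ψ μ) t = μ⁻¹ * scaledReal (deriv ψ) μ t := by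
  have := congrFun (iteratedDeriv_scaledReal hψ μ 1) t
  simpa [iteratedDeriv_one] using this

/-- The first order Taylor remainder of the translated mollifier is a test function with support in
a fixed compact set, and its derivatives up to the order N of v on that set are O(h²). The finite
order bound transfers this to the values of v. -/
theorem hasDerivAt_mollify (v : 𝓓'((⊤ : TopologicalSpace.Opens ℝ), F))
    (ψ : 𝓓((⊤ : TopologicalSpace.Opens ℝ), ℝ)) {μ : ℝ} (hμ : 0 < μ) (t : ℝ) :
    HasDerivAt (mollify ψ μ v) (μ⁻¹ • mollify (derivTest ψ) μ v t) t := by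
  obtain ⟨K₁, hK₁, hsub₁⟩ := exists_tsupport_subset ψ (|t| + 1) μ
  obtain ⟨K₂, hK₂, hsub₂⟩ := exists_tsupport_subset (derivTest ψ) (|t| + 1) μ
  obtain ⟨N, C, hC, hb⟩ := exists_order_bound v (hK₁.union hK₂)
  set P := scaledReal ψ μ with hP
  have hPs : ContDiff ℝ ∞ P := contDiff_scaledReal ψ.contDiff
  have hPc : HasCompactSupport P := hasCompactSupport_scaledReal ψ.hasCompactSupport hμ
  have hbd : ∃ M ≥ (0 : ℝ), ∀ j ≤ N, ∀ x, |deriv (deriv (iteratedDeriv j P)) x| ≤ M := by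
    choose M hM0 hM using fun j => exists_bound_of_hasCompactSupport
      (contDiff_infty_iff_deriv.1 (contDiff_infty_iff_deriv.1 (contDiff_iteratedDeriv hPs j)).2).2.continuous
      (hasCompactSupport_iteratedDeriv hPc j).deriv.deriv
    refine ⟨∑ j ∈ Finset.range (N + 1), M j, Finset.sum_nonneg fun j _ => hM0 j, fun j hj x => ?_⟩
    exact (hM j x).trans (Finset.single_le_sum (f := M) (fun j _ => hM0 j)
      (Finset.mem_range.2 (by omega)))
  obtain ⟨M, hM0, hM⟩ := hbd
  rw [hasDerivAt_iff_isLittleO_nhds_zero]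
  have key : ∀ h : ℝ, |h| ≤ 1 →
      ‖mollify ψ μ v (t + h) - mollify ψ μ v t - h • (μ⁻¹ • mollify (derivTest ψ) μ v t)‖
        ≤ C * (M * h ^ 2) := by
    intro h hh
    set η : 𝓓((⊤ : TopologicalSpace.Opens ℝ), ℝ) := mollifierAt ψ μ (t + h) - mollifierAt ψ μ t
      - h • (μ⁻¹ • mollifierAt (derivTest ψ) μ t) with hη
    have e1 : v η = mollify ψ μ v (t + h) - mollify ψ μ v t
        - h • (μ⁻¹ • mollify (derivTest ψ) μ v t) := by
      simp only [hη, mollify, map_sub, map_smul]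
    have e2 : (η : ℝ → ℝ) = fun τ => P (t + h - τ) - P (t - τ) - h * deriv P (t - τ) := by
      ext τ
      have a1 := congrFun (coe_mollifierAt ψ hμ (t + h)) τ
      have a2 := congrFun (coe_mollifierAt ψ hμ t) τ
      have a3 := congrFun (coe_mollifierAt (derivTest ψ) hμ t) τ
      rw [hP, scaledReal_deriv ψ.contDiff]
      change mollifierAt ψ μ (t + h) τ - mollifierAt ψ μ t τ
        - h * (μ⁻¹ * mollifierAt (derivTest ψ) μ t τ) = _
      rw [a1, a2, a3, coe_derivTest]
    rw [← e1]
    refine hb η ?_ _ (by positivity) fun j hj x => ?_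
    · refine closure_minimal (fun τ hτ => ?_) (hK₁.union hK₂).isClosed
      by_contra hcon
      rw [mem_union, not_or] at hcon
      refine hτ ?_
      have z1 : mollifierAt ψ μ (t + h) τ = 0 := image_eq_zero_of_notMem_tsupport fun hm =>
        hcon.1 (hsub₁ _ _ hμ le_rfl ((abs_add_le t h).trans (by linarith)) hm)
      have z2 : mollifierAt ψ μ t τ = 0 := image_eq_zero_of_notMem_tsupport fun hm =>
        hcon.1 (hsub₁ _ _ hμ le_rfl (by linarith) hm)
      have z3 : mollifierAt (derivTest ψ) μ t τ = 0 := image_eq_zero_of_notMem_tsupport fun hm =>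
        hcon.2 (hsub₂ _ _ hμ le_rfl (by linarith) hm)
      change mollifierAt ψ μ (t + h) τ - mollifierAt ψ μ t τ
        - h * (μ⁻¹ * mollifierAt (derivTest ψ) μ t τ) = 0
      rw [z1, z2, z3]
      simp
    · have hPd : ContDiff ℝ ∞ (deriv P) := (contDiff_infty_iff_deriv.1 hPs).2
      have hle : (j : WithTop ℕ∞) ≤ ∞ := by exact_mod_cast le_top
      have c1 : ∀ a, ContDiff ℝ j fun τ => P (a - τ) := fun a =>
        (hPs.of_le hle).comp (contDiff_const.sub contDiff_id)
      have c2 : ContDiff ℝ j fun τ => deriv P (t - τ) :=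
        (hPd.of_le hle).comp (contDiff_const.sub contDiff_id)
      have e3 : iteratedDeriv j η x = (-1) ^ j * (iteratedDeriv j P (t - x + h)
          - iteratedDeriv j P (t - x) - h * deriv (iteratedDeriv j P) (t - x)) := by
        rw [e2, iteratedDeriv_fun_sub ((c1 _).sub (c1 _)).contDiffAt (contDiff_const.mul c2).contDiffAt,
          iteratedDeriv_fun_sub (c1 _).contDiffAt (c1 _).contDiffAt, iteratedDeriv_const_mul_field,
          iteratedDeriv_comp_const_sub, iteratedDeriv_comp_const_sub, iteratedDeriv_comp_const_sub,
          ← iteratedDeriv_succ', iteratedDeriv_succ]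
        simp only [smul_eq_mul]
        rw [show t + h - x = t - x + h by ring]
        ring
      rw [e3, abs_mul, abs_pow, abs_neg, abs_one, one_pow, one_mul]
      exact abs_taylor_two_le (contDiff_iteratedDeriv hPs j) (hM j hj) _ _
  have hO : (fun h => mollify ψ μ v (t + h) - mollify ψ μ v t
      - h • (μ⁻¹ • mollify (derivTest ψ) μ v t)) =O[𝓝 0] fun h : ℝ => h ^ 2 := by
    refine Asymptotics.IsBigO.of_bound (C * M) ?_
    filter_upwards [Metric.closedBall_mem_nhds (0:ℝ) one_pos] with h hh
    rw [Real.norm_of_nonneg (sq_nonneg h), mul_assoc]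
    exact key h (by simpa using hh)
  refine hO.trans_isLittleO ?_
  simpa using Asymptotics.isLittleO_pow_id (𝕜 := ℝ) (n := 2) (by norm_num)

theorem iteratedDeriv_mollify (v : 𝓓'((⊤ : TopologicalSpace.Opens ℝ), F))
    (ψ : 𝓓((⊤ : TopologicalSpace.Opens ℝ), ℝ)) {μ : ℝ} (hμ : 0 < μ) (k : ℕ) :
    iteratedDeriv k (mollify ψ μ v) = fun t => μ⁻¹ ^ k • mollify (derivTest^[k] ψ) μ v t := by
  induction k with
  | zero => simp
  | succ k ih =>
    rw [iteratedDeriv_succ, ih]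
    ext t
    refine ((hasDerivAt_mollify v (derivTest^[k] ψ) hμ t).const_smul (μ⁻¹ ^ k)).deriv.trans ?_
    rw [Function.iterate_succ_apply', smul_smul, pow_succ]

theorem contDiff_mollify (v : 𝓓'((⊤ : TopologicalSpace.Opens ℝ), F))
    (ψ : 𝓓((⊤ : TopologicalSpace.Opens ℝ), ℝ)) {μ : ℝ} (hμ : 0 < μ) :
    ContDiff ℝ ∞ (mollify ψ μ v) := by
  refine contDiff_of_differentiable_iteratedDeriv fun m _ => ?_
  rw [iteratedDeriv_mollify v ψ hμ]
  exact fun t => ((hasDerivAt_mollify v (derivTest^[m] ψ) hμ t).const_smul (μ⁻¹ ^ m)).differentiableAt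

/-- The exponent is the order of v plus one, for the normalising factor μ⁻¹ of the mollifier, and
one more for each derivative. That N does not depend on k is essential: with `k + 1` derivatives and
a root of order `k + 1`, its contribution disappears as k grows. -/
theorem exists_norm_mollify_le (v : 𝓓'((⊤ : TopologicalSpace.Opens ℝ), F))
    (ψ : 𝓓((⊤ : TopologicalSpace.Opens ℝ), ℝ)) (M : ℝ) {K : Set ℝ} (hK : IsCompact K) :
    ∃ N : ℕ, ∀ k : ℕ, ∃ C > (0 : ℝ), ∀ μ, 0 < μ → μ ≤ M → ∀ t ∈ K,
      ‖iteratedDeriv k (mollify ψ μ v) t‖ ≤ C * μ⁻¹ ^ (N + k) := by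
  obtain ⟨R, hR⟩ := hK.isBounded.exists_norm_le
  obtain ⟨K', hK', hsub⟩ := exists_tsupport_subset ψ R M
  obtain ⟨N, C, hC, hb⟩ := exists_order_bound v hK'
  refine ⟨N + 1, fun k => ?_⟩
  set κ := derivTest^[k] ψ with hκ
  choose B hB0 hB using fun j => exists_bound_of_hasCompactSupport
    (contDiff_iteratedDeriv κ.contDiff j).continuous
    (hasCompactSupport_iteratedDeriv κ.hasCompactSupport j)
  set S := ∑ j ∈ Finset.range (N + 1), B j with hS
  have hS0 : 0 ≤ S := Finset.sum_nonneg fun j _ => hB0 j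
  have hM1 : 0 < 1 + |M| := by positivity
  refine ⟨C * (S * (1 + |M|) ^ N) + 1, by positivity, fun μ hμ hμM t ht => ?_⟩
  rw [iteratedDeriv_mollify v ψ hμ, norm_smul, norm_pow, norm_inv, Real.norm_of_nonneg hμ.le]
  -- Derivatives of the mollifier keep within its support, so the compact set K' and the order N
  -- chosen for ψ serve every k.
  have hsupp : tsupport (mollifierAt κ μ t) ⊆ K' := by
    have h1 : Function.support (mollifierAt κ μ t) ⊆ tsupport (mollifierAt ψ μ t) := by
      intro τ hτ
      by_contra hcon
      have hev := notMem_tsupport_iff_eventuallyEq.1 hcon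
      refine hτ ?_
      have h2 : iteratedDeriv k (mollifierAt ψ μ t) τ = 0 := by
        rw [hev.iteratedDeriv_eq]
        simp [Pi.zero_def]
      rw [iteratedDeriv_mollifierAt ψ hμ, iteratedDeriv_scaledReal ψ.contDiff] at h2
      have h3 : scaledReal (iteratedDeriv k ψ) μ (t - τ) = 0 := by
        simpa [hμ.ne'] using h2
      rw [coe_mollifierAt κ hμ, hκ, coe_iterate_derivTest]
      exact h3
    exact (closure_minimal h1 (isClosed_tsupport _)).trans (hsub μ t hμ hμM (hR t ht))
  have hinv : 0 < μ⁻¹ := by positivity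
  have hD : ∀ j ≤ N, ∀ x, |iteratedDeriv j (mollifierAt κ μ t) x|
      ≤ S * (1 + |M|) ^ N * μ⁻¹ ^ (N + 1) := by
    intro j hj x
    rw [iteratedDeriv_mollifierAt κ hμ, iteratedDeriv_scaledReal κ.contDiff]
    simp only [scaledReal, abs_mul, abs_pow, abs_neg, abs_one, one_pow, one_mul, abs_of_pos hinv]
    have h1 : |iteratedDeriv j κ (μ⁻¹ * (t - x))| ≤ S :=
      (hB j _).trans (Finset.single_le_sum (f := B) (fun j _ => hB0 j)
        (Finset.mem_range.2 (by omega)))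
    have h2 : μ⁻¹ ^ j ≤ (1 + |M|) ^ N * μ⁻¹ ^ N := by
      rw [← mul_pow]
      have h3 : 1 ≤ (1 + |M|) * μ⁻¹ := by
        rw [← div_eq_mul_inv, one_le_div hμ]
        linarith [le_abs_self M]
      have h4 : μ⁻¹ ≤ (1 + |M|) * μ⁻¹ :=
        le_mul_of_one_le_left hinv.le (by linarith [abs_nonneg M])
      exact (pow_le_pow_left₀ hinv.le h4 j).trans (pow_le_pow_right₀ h3 hj)
    calc μ⁻¹ ^ j * (μ⁻¹ * |iteratedDeriv j κ (μ⁻¹ * (t - x))|)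
        ≤ ((1 + |M|) ^ N * μ⁻¹ ^ N) * (μ⁻¹ * S) := by gcongr
      _ = _ := by ring
  have h1 := hb _ hsupp _ (by positivity) hD
  calc μ⁻¹ ^ k * ‖mollify κ μ v t‖
      ≤ μ⁻¹ ^ k * (C * (S * (1 + |M|) ^ N * μ⁻¹ ^ (N + 1))) := by gcongr; exact h1
    _ = C * (S * (1 + |M|) ^ N) * μ⁻¹ ^ (N + 1 + k) := by rw [pow_add]; ring
    _ ≤ _ := by gcongr; linarith

theorem mollify_nonneg {v : 𝓓'((⊤ : TopologicalSpace.Opens ℝ), ℝ)}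
    (hv : ∀ η : 𝓓((⊤ : TopologicalSpace.Opens ℝ), ℝ), (∀ t, 0 ≤ η t) → 0 ≤ v η)
    {ψ : 𝓓((⊤ : TopologicalSpace.Opens ℝ), ℝ)} (hψ : ∀ t, 0 ≤ ψ t) {μ : ℝ} (hμ : 0 < μ) (t : ℝ) :
    0 ≤ mollify ψ μ v t := by
  refine hv _ fun τ => ?_
  rw [coe_mollifierAt ψ hμ]
  exact mul_nonneg (by positivity) (hψ _)

/-- A test function on the line which is equal to `1` on the ball of radius `R`. -/
theorem exists_cutoff {R : ℝ} (hR : 0 < R) : ∃ χ : 𝓓((⊤ : TopologicalSpace.Opens ℝ), ℝ),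
    (∀ t, 0 ≤ χ t) ∧ ∀ t, |t| ≤ R → χ t = 1 := by
  let b : ContDiffBump (0 : ℝ) := ⟨R, R + 1, hR, by linarith⟩
  refine ⟨⟨b, b.contDiff, b.hasCompactSupport, fun _ _ => trivial⟩, fun t => b.nonneg,
    fun t ht => b.one_of_mem_closedBall ?_⟩
  simpa [b] using ht

/-- Nonnegative distributions have order zero. -/
theorem exists_mollify_le_of_nonneg {v : 𝓓'((⊤ : TopologicalSpace.Opens ℝ), ℝ)}
    (hv : ∀ η : 𝓓((⊤ : TopologicalSpace.Opens ℝ), ℝ), (∀ t, 0 ≤ η t) → 0 ≤ v η)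
    (ψ : 𝓓((⊤ : TopologicalSpace.Opens ℝ), ℝ)) (M : ℝ) {K : Set ℝ} (hK : IsCompact K) :
    ∃ C > (0 : ℝ), ∀ μ, 0 < μ → μ ≤ M → ∀ t ∈ K, mollify ψ μ v t ≤ C * μ⁻¹ := by
  obtain ⟨R, hR⟩ := hK.isBounded.exists_norm_le
  obtain ⟨K', hK', hsub⟩ := exists_tsupport_subset ψ R M
  obtain ⟨R', hR'⟩ := hK'.isBounded.exists_norm_le
  obtain ⟨χ, hχ0, hχ1⟩ := exists_cutoff (R := |R'| + 1) (by positivity)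
  obtain ⟨B, hB0, hB⟩ := exists_bound_of_hasCompactSupport ψ.contDiff.continuous
    ψ.hasCompactSupport
  refine ⟨B * v χ + 1, by have := hv χ hχ0; positivity, fun μ hμ hμM t ht => ?_⟩
  -- The mollifier lies below μ⁻¹Bχ, and v is monotone because it is nonnegative.
  have h0 : 0 ≤ v ((μ⁻¹ * B) • χ - mollifierAt ψ μ t) := by
    refine hv _ fun τ => ?_
    have e : ((μ⁻¹ * B) • χ - mollifierAt ψ μ t) τ = μ⁻¹ * B * χ τ - mollifierAt ψ μ t τ := rfl
    rw [e, sub_nonneg]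
    by_cases hτ : τ ∈ K'
    · rw [hχ1 τ ((hR' τ hτ).trans (by linarith [le_abs_self R'])), coe_mollifierAt ψ hμ, mul_one]
      exact mul_le_mul_of_nonneg_left ((le_abs_self _).trans (hB _)) (by positivity)
    · have : mollifierAt ψ μ t τ = 0 :=
        image_eq_zero_of_notMem_tsupport fun h => hτ (hsub μ t hμ hμM (hR t ht) h)
      rw [this]
      have := hχ0 τ
      positivity
  rw [map_sub, map_smul, smul_eq_mul, sub_nonneg] at h0
  refine h0.trans ?_
  have : 0 < μ⁻¹ := by positivity
  nlinarith

theorem IsPositiveNet.pos {μ : ℝ → ℝ} (hμ : IsPositiveNet μ) {ε : ℝ} (hε : ε ∈ Ioc (0 : ℝ) 1) :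
    0 < μ ε := by
  obtain ⟨⟨p, -, c₁, -, c₂, hc₂, h⟩, -⟩ := hμ
  exact lt_of_lt_of_le (mul_pos hc₂ (Real.rpow_pos_of_pos hε.1 p)) (h ε hε).1

theorem IsPositiveNet.exists_inv_le {μ : ℝ → ℝ} (hμ : IsPositiveNet μ) :
    ∃ N : ℕ, ∃ C > (0 : ℝ), ∀ ε ∈ Ioc (0 : ℝ) 1, (μ ε)⁻¹ ≤ C * ε⁻¹ ^ N := by
  have hpos := fun ε hε => hμ.pos (ε := ε) hε
  obtain ⟨⟨p, hp, c₁, hc₁, c₂, hc₂, h⟩, -⟩ := hμ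
  refine ⟨⌈p⌉₊, c₂⁻¹, by positivity, fun ε hε => ?_⟩
  rw [inv_pow, ← mul_inv]
  have hε0 := hε.1
  refine inv_anti₀ (by positivity) (le_trans ?_ (h ε hε).1)
  gcongr
  rw [← Real.rpow_natCast]
  exact Real.rpow_le_rpow_of_exponent_ge hε.1 hε.2 (Nat.le_ceil p)

theorem isModerate_mollify (v : 𝓓'((⊤ : TopologicalSpace.Opens ℝ), F))
    (ψ : 𝓓((⊤ : TopologicalSpace.Opens ℝ), ℝ)) {μ : ℝ → ℝ} (hμ : IsPositiveNet μ) :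
    IsModerate (fun ε => mollify ψ (μ ε) v) := by
  refine ⟨fun ε hε => contDiff_mollify v ψ (hμ.pos hε), fun K hK k => ?_⟩
  obtain ⟨p, C', hC', hinv⟩ := hμ.exists_inv_le
  have hpos := fun ε hε => hμ.pos (ε := ε) hε
  obtain ⟨⟨q, hq, c₁, hc₁, c₂, hc₂, h⟩, -⟩ := hμ
  obtain ⟨N, hN⟩ := exists_norm_mollify_le v ψ c₁ hK
  obtain ⟨C, hC, hb⟩ := hN k
  refine ⟨p * (N + k), C * C' ^ (N + k), by positivity, fun ε hε t ht => ?_⟩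
  refine (hb _ (hpos ε hε) (h ε hε).2 t ht).trans ?_
  have h1 : (μ ε)⁻¹ ^ (N + k) ≤ (C' * ε⁻¹ ^ p) ^ (N + k) :=
    pow_le_pow_left₀ (inv_nonneg.2 (hpos ε hε).le) (hinv ε hε) _
  rw [mul_pow, ← pow_mul] at h1
  rw [mul_assoc]
  gcongr

end Distribution

/-! ### Reparametrisation of logarithmic scales -/

/-- The logarithm of `(min ε ε₀)⁻¹`. -/
def logSize (ε₀ ε : ℝ) : ℝ := Real.log (min ε ε₀)⁻¹

/-- The change of parameter `ε ↦ exp (-(log ε⁻¹)^θ)`, frozen for `ε ≥ ε₀`. -/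
def reparam (ε₀ θ ε : ℝ) : ℝ := Real.exp (-logSize ε₀ ε ^ θ)

section Reparam

variable {ε₀ θ ε : ℝ}

theorem one_le_logSize (h₀ : 0 < ε₀) (h₁ : ε₀ ≤ Real.exp (-1)) (hε : 0 < ε) :
    1 ≤ logSize ε₀ ε := by
  rw [logSize, Real.log_inv, le_neg, Real.log_le_iff_le_exp (lt_min hε h₀)]
  exact (min_le_right _ _).trans h₁

theorem log_inv_le_logSize (h₀ : 0 < ε₀) (hε : 0 < ε) : Real.log ε₀⁻¹ ≤ logSize ε₀ ε :=
  Real.log_le_log (inv_pos.2 h₀) (inv_anti₀ (lt_min hε h₀) (min_le_right _ _))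

/-- This is what makes any loss exp(MΛ) polynomial in ε⁻¹. -/
theorem exp_logSize_le (h₀ : 0 < ε₀) (h₁ : ε₀ ≤ 1) (hε : ε ∈ Ioc (0 : ℝ) 1) :
    Real.exp (logSize ε₀ ε) ≤ ε₀⁻¹ * ε⁻¹ := by
  have hε0 := hε.1
  rw [logSize, Real.exp_log (inv_pos.2 (lt_min hε.1 h₀)), ← mul_inv]
  exact inv_anti₀ (by positivity) (le_min (mul_le_of_le_one_left hε.1.le h₁)
    (mul_le_of_le_one_right h₀.le hε.2))

theorem logSize_of_le (h : ε ≤ ε₀) : logSize ε₀ ε = Real.log ε⁻¹ := by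
  rw [logSize, min_eq_left h]

theorem log_inv_reparam : Real.log (reparam ε₀ θ ε)⁻¹ = logSize ε₀ ε ^ θ := by
  rw [reparam, Real.log_inv, Real.log_exp, neg_neg]

theorem reparam_mem (h₀ : 0 < ε₀) (h₁ : ε₀ ≤ Real.exp (-1)) (hε : 0 < ε) :
    reparam ε₀ θ ε ∈ Ioc (0 : ℝ) 1 := by
  refine ⟨Real.exp_pos _, Real.exp_le_one_iff.2 (neg_nonpos.2 ?_)⟩
  exact Real.rpow_nonneg (zero_le_one.trans (one_le_logSize h₀ h₁ hε)) _

theorem logSize_rpow_le (h₀ : 0 < ε₀) (h₁ : ε₀ ≤ Real.exp (-1)) (hθ1 : θ ≤ 1) (hε : 0 < ε) :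
    logSize ε₀ ε ^ θ ≤ logSize ε₀ ε := by
  simpa using Real.rpow_le_rpow_of_exponent_le (one_le_logSize h₀ h₁ hε) hθ1

/-- For θ ≤ 1 the new parameter tends to zero no faster than ε, up to a constant; hence positive
nets stay positive nets after composition. -/
theorem mul_le_reparam (h₀ : 0 < ε₀) (h₁ : ε₀ ≤ Real.exp (-1)) (hθ1 : θ ≤ 1)
    (hε : ε ∈ Ioc (0 : ℝ) 1) : ε₀ * ε ≤ reparam ε₀ θ ε := by
  have hε0 := hε.1
  have h2 : ε₀ ≤ 1 := h₁.trans (Real.exp_le_one_iff.2 (by norm_num))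
  have h3 := exp_logSize_le h₀ h2 hε
  have h4 := Real.exp_le_exp.2 (neg_le_neg (logSize_rpow_le h₀ h₁ hθ1 hε.1))
  refine le_trans ?_ h4
  rw [Real.exp_neg, ← mul_inv] at *
  exact (le_inv_comm₀ (Real.exp_pos _) (by positivity)).1 h3

theorem eventually_reparam_eq (h₀ : 0 < ε₀) :
    ∀ᶠ ε in 𝓝[>] (0 : ℝ), reparam ε₀ θ ε = Real.exp (-(Real.log ε⁻¹ ^ θ)) := by
  filter_upwards [Ioo_mem_nhdsGT h₀] with ε hε
  rw [reparam, logSize_of_le hε.2.le]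

theorem tendsto_exp_neg_log_rpow (hθ : 0 < θ) :
    Tendsto (fun ε : ℝ => Real.exp (-(Real.log ε⁻¹ ^ θ))) (𝓝[>] 0) (𝓝[>] 0) := by
  refine tendsto_nhdsWithin_iff.2 ⟨?_, Eventually.of_forall fun ε => Real.exp_pos _⟩
  refine Real.tendsto_exp_atBot.comp (tendsto_neg_atTop_atBot.comp ?_)
  exact (tendsto_rpow_atTop hθ).comp (Real.tendsto_log_atTop.comp tendsto_inv_nhdsGT_zero)

theorem tendsto_reparam (h₀ : 0 < ε₀) (hθ : 0 < θ) :
    Tendsto (reparam ε₀ θ) (𝓝[>] 0) (𝓝[>] 0) :=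
  (tendsto_exp_neg_log_rpow hθ).congr' <| by
    filter_upwards [eventually_reparam_eq (θ := θ) h₀] with ε hε using hε.symm

/-- Freezing the parameter beyond ε₀ keeps it small throughout, so a property of small parameters
holds along the whole net. Uniform estimates are needed for every ε in (0,1], whereas the Levi
conditions and the logarithmic law are only eventual. -/
theorem exists_forall_reparam {P : ℝ → Prop} (hP : ∀ᶠ η in 𝓝[>] (0 : ℝ), P η) (hθ : 0 < θ) :
    ∃ ε₀ : ℝ, 0 < ε₀ ∧ ε₀ ≤ Real.exp (-1) ∧ ∀ ε, 0 < ε → P (reparam ε₀ θ ε) := by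
  obtain ⟨δ, hδ, hPδ⟩ := mem_nhdsGT_iff_exists_Ioo_subset.1 hP
  have h1 := (tendsto_exp_neg_log_rpow hθ).eventually (Ioo_mem_nhdsGT hδ)
  obtain ⟨ε₀, h2, h3⟩ := (h1.and (Ioc_mem_nhdsGT (Real.exp_pos (-1)))).exists
  refine ⟨ε₀, h3.1, h3.2, fun ε hε => hPδ ⟨Real.exp_pos _, lt_of_le_of_lt ?_ h2.2⟩⟩
  refine Real.exp_le_exp.2 (neg_le_neg ?_)
  refine Real.rpow_le_rpow (Real.log_nonneg ?_) (log_inv_le_logSize h3.1 hε) hθ.le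
  exact (one_le_inv₀ h3.1).2 (h3.2.trans (Real.exp_le_one_iff.2 (by norm_num)))

theorem IsLogScale.comp_reparam {r : ℝ} {μ : ℝ → ℝ} (hμ : IsLogScale r μ) (h₀ : 0 < ε₀)
    (h₁ : ε₀ ≤ Real.exp (-1)) (hθ : 0 < θ) (hθ1 : θ ≤ 1) :
    IsLogScale (θ * r) (μ ∘ reparam ε₀ θ) := by
  obtain ⟨⟨⟨p, hp, c₁, hc₁, c₂, hc₂, h⟩, ht⟩, κ, hκ, hev⟩ := hμ
  refine ⟨⟨⟨p, hp, c₁, hc₁, c₂ * ε₀ ^ p, by positivity, fun ε hε => ?_⟩,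
    ht.comp (tendsto_reparam h₀ hθ)⟩, κ, hκ, ?_⟩
  · have h2 := h _ (reparam_mem (θ := θ) h₀ h₁ hε.1)
    refine ⟨le_trans ?_ h2.1, h2.2⟩
    rw [mul_assoc, ← Real.mul_rpow h₀.le hε.1.le]
    have h3 := mul_le_reparam h₀ h₁ hθ1 hε
    have := mul_pos h₀ hε.1
    gcongr
  · filter_upwards [(tendsto_reparam h₀ hθ).eventually hev, Ioo_mem_nhdsGT h₀] with ε hε hε'
    rw [Function.comp_apply, hε, log_inv_reparam, logSize_of_le hε'.2.le, Real.rpow_mul]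
    rw [← logSize_of_le hε'.2.le]
    exact zero_le_one.trans (one_le_logSize h₀ h₁ hε'.1)

end Reparam

/-! ### Tempered nets of symbols -/

/-- Nets of symbols bounded by a power of `ε⁻¹`, a power of `1 + |ξ|`, and a Gevrey decay. -/
def IsTemperedNet {n : ℕ} {E : Type*} [NormedAddCommGroup E] (T s γ : ℝ)
    (G : ℝ → ℝ → Space n → E) : Prop :=
  ∃ p N : ℕ, ∃ C > (0 : ℝ), ∀ ε ∈ Ioc (0 : ℝ) 1, ∀ t ∈ Icc 0 T, ∀ ξ,
    ‖G ε t ξ‖ ≤ C * ε⁻¹ ^ N * (1 + ‖ξ‖) ^ p * gevreyDecay s γ ξ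

section Tempered

variable {n : ℕ} {E : Type*} [NormedAddCommGroup E] {T s γ γ' : ℝ}

theorem IsTemperedNet.mono {E' : Type*} [NormedAddCommGroup E'] {G : ℝ → ℝ → Space n → E}
    {H : ℝ → ℝ → Space n → E'} (hG : IsTemperedNet T s γ G)
    (h : ∀ ε ∈ Ioc (0 : ℝ) 1, ∀ t ∈ Icc 0 T, ∀ ξ, ‖H ε t ξ‖ ≤ ‖G ε t ξ‖) :
    IsTemperedNet T s γ H := by
  obtain ⟨p, N, C, hC, hb⟩ := hG
  exact ⟨p, N, C, hC, fun ε hε t ht ξ => (h ε hε t ht ξ).trans (hb ε hε t ht ξ)⟩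

theorem IsTemperedNet.add {G H : ℝ → ℝ → Space n → E} (hG : IsTemperedNet T s γ G)
    (hH : IsTemperedNet T s γ H) : IsTemperedNet T s γ (fun ε t ξ => G ε t ξ + H ε t ξ) := by
  obtain ⟨p, N, C, hC, hb⟩ := hG
  obtain ⟨p', N', C', hC', hb'⟩ := hH
  refine ⟨p + p', N + N', C + C', by positivity, fun ε hε t ht ξ => ?_⟩
  have h1 : 1 ≤ ε⁻¹ := (one_le_inv₀ hε.1).2 hε.2
  have h2 : 1 ≤ 1 + ‖ξ‖ := by linarith [norm_nonneg ξ]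
  have h3 := gevreyDecay_pos s γ ξ
  calc ‖G ε t ξ + H ε t ξ‖ ≤ _ := (norm_add_le _ _).trans
        (add_le_add (hb ε hε t ht ξ) (hb' ε hε t ht ξ))
    _ ≤ C * ε⁻¹ ^ (N + N') * (1 + ‖ξ‖) ^ (p + p') * gevreyDecay s γ ξ
        + C' * ε⁻¹ ^ (N + N') * (1 + ‖ξ‖) ^ (p + p') * gevreyDecay s γ ξ := by
      gcongr <;> first | assumption | omega
    _ = _ := by ring

theorem IsTemperedNet.sum {ι : Type*} (S : Finset ι) {G : ι → ℝ → ℝ → Space n → E}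
    (hG : ∀ i ∈ S, IsTemperedNet T s γ (G i)) :
    IsTemperedNet T s γ (fun ε t ξ => ∑ i ∈ S, G i ε t ξ) := by
  classical
  induction S using Finset.induction_on with
  | empty =>
    refine ⟨0, 0, 1, one_pos, fun ε _ t _ ξ => ?_⟩
    simpa using (gevreyDecay_pos s γ ξ).le
  | insert i S hi ih =>
    simp only [Finset.sum_insert hi]
    exact (hG i (Finset.mem_insert_self i S)).add
      (ih fun j hj => hG j (Finset.mem_insert_of_mem hj))

theorem IsTemperedNet.mul {A : Type*} [NormedRing A] {G H : ℝ → ℝ → Space n → A}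
    (hG : IsTemperedNet T s γ G) (hH : IsTemperedNet T s γ' H) :
    IsTemperedNet T s (γ + γ') (fun ε t ξ => G ε t ξ * H ε t ξ) := by
  obtain ⟨p, N, C, hC, hb⟩ := hG
  obtain ⟨p', N', C', hC', hb'⟩ := hH
  refine ⟨p + p', N + N', C * C', by positivity, fun ε hε t ht ξ => ?_⟩
  have hε0 := hε.1
  have h3 := (gevreyDecay_pos s γ ξ).le
  refine (norm_mul_le _ _).trans ((mul_le_mul (hb ε hε t ht ξ) (hb' ε hε t ht ξ) (norm_nonneg _)
    (by positivity)).trans_eq ?_)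
  rw [gevreyDecay_add, pow_add, pow_add]
  ring

theorem IsTemperedNet.coeff_mul {A : Type*} [NormedRing A] {G H : ℝ → ℝ → Space n → A}
    (hG : IsTemperedNet T s 0 G) (hH : IsTemperedNet T s γ H) :
    IsTemperedNet T s γ (fun ε t ξ => G ε t ξ * H ε t ξ) := by
  simpa using hG.mul hH

/-- A net whose square is tempered is tempered. -/
theorem IsTemperedNet.of_sq {G : ℝ → ℝ → Space n → E} {H : ℝ → ℝ → Space n → ℝ}
    (hH : IsTemperedNet T s γ H)
    (h : ∀ ε ∈ Ioc (0 : ℝ) 1, ∀ t ∈ Icc 0 T, ∀ ξ, ‖G ε t ξ‖ ^ 2 ≤ H ε t ξ) :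
    IsTemperedNet T s (γ / 2) G := by
  obtain ⟨p, N, C, hC, hb⟩ := hH
  refine ⟨p, N, 1 + C, by positivity, fun ε hε t ht ξ => ?_⟩
  have hε0 := hε.1
  have h1 : 1 ≤ ε⁻¹ ^ N := one_le_pow₀ ((one_le_inv₀ hε.1).2 hε.2)
  have h2 : 1 ≤ (1 + ‖ξ‖) ^ p := one_le_pow₀ (by linarith [norm_nonneg ξ])
  have h3 := gevreyDecay_pos s (γ / 2) ξ
  have h4 : gevreyDecay s γ ξ = gevreyDecay s (γ / 2) ξ ^ 2 := by
    rw [sq, ← gevreyDecay_add, add_halves]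
  refine le_of_sq_le_sq ?_ (by positivity)
  have h5 := (h ε hε t ht ξ).trans ((le_abs_self _).trans (hb ε hε t ht ξ))
  refine h5.trans ?_
  rw [h4, mul_pow]
  gcongr
  have h6 : 1 ≤ (1 + C) * ε⁻¹ ^ N * (1 + ‖ξ‖) ^ p := by
    have : 1 ≤ (1 + C) * ε⁻¹ ^ N := one_le_mul_of_one_le_of_one_le (by linarith) h1
    exact one_le_mul_of_one_le_of_one_le this h2
  calc C * ε⁻¹ ^ N * (1 + ‖ξ‖) ^ p ≤ (1 + C) * ε⁻¹ ^ N * (1 + ‖ξ‖) ^ p := by gcongr; linarith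
    _ ≤ _ := le_self_pow₀ h6 two_ne_zero

theorem isTemperedNet_const (c : E) : IsTemperedNet T s 0 (fun _ _ (_ : Space n) => c) := by
  refine ⟨0, 0, ‖c‖ + 1, by positivity, fun ε _ t _ ξ => ?_⟩
  simp [gevreyDecay]

theorem IsTemperedNet.weaken {G : ℝ → ℝ → Space n → E} (hG : IsTemperedNet T s γ G)
    (h : γ' ≤ γ) : IsTemperedNet T s γ' G := by
  obtain ⟨p, N, C, hC, hb⟩ := hG
  refine ⟨p, N, C, hC, fun ε hε t ht ξ => (hb ε hε t ht ξ).trans ?_⟩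
  have hε0 := hε.1
  have : gevreyDecay s γ ξ ≤ gevreyDecay s γ' ξ := by
    rw [gevreyDecay, gevreyDecay]
    gcongr
  gcongr

/-- Powers of `1 + |ξ|` are absorbed by the Gevrey decay. -/
theorem IsTemperedNet.exists_bound (hs : 1 ≤ s) (hγ : 0 < γ) {G : ℝ → ℝ → Space n → E}
    (hG : IsTemperedNet T s γ G) : ∃ N : ℕ, ∃ C > (0 : ℝ), ∀ ε ∈ Ioc (0 : ℝ) 1, ∀ t ∈ Icc 0 T, ∀ ξ,
      ‖G ε t ξ‖ ≤ C * ε⁻¹ ^ N * gevreyDecay s (γ / 2) ξ := by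
  obtain ⟨p, N, C, hC, hb⟩ := hG
  refine ⟨N, C * (((s / (γ / 2)) ^ s) ^ p * (p.factorial : ℝ) ^ s), by positivity,
    fun ε hε t ht ξ => (hb ε hε t ht ξ).trans ?_⟩
  have hε0 := hε.1
  have h1 : gevreyDecay s γ ξ = gevreyDecay s (γ / 2) ξ * gevreyDecay s (γ / 2) ξ := by
    rw [gevreyDecay, gevreyDecay, ← Real.exp_add]
    ring_nf
  have h2 := pow_mul_gevreyDecay_le hs (half_pos hγ) p ξ
  have h3 := (gevreyDecay_pos s (γ / 2) ξ).le
  calc C * ε⁻¹ ^ N * (1 + ‖ξ‖) ^ p * gevreyDecay s γ ξ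
      = C * ε⁻¹ ^ N * ((1 + ‖ξ‖) ^ p * gevreyDecay s (γ / 2) ξ) * gevreyDecay s (γ / 2) ξ := by
        rw [h1]; ring
    _ ≤ C * ε⁻¹ ^ N * (((s / (γ / 2)) ^ s) ^ p * (p.factorial : ℝ) ^ s)
        * gevreyDecay s (γ / 2) ξ := by gcongr
    _ = _ := by ring

end Tempered

/-! ### Second order ordinary differential equations -/

section SecondOrder

variable {T : ℝ} {q d F v w : ℝ → ℂ}

/-- Bootstrapping in the first order system for (v, w): each derivative is expressed by v, w and
smooth coefficients. -/
theorem contDiffOn_of_second_order (hT : 0 < T) (hq : ContDiff ℝ ∞ q) (hd : ContDiff ℝ ∞ d)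
    (hF : ContDiffOn ℝ ∞ F (Icc 0 T))
    (hv : ∀ t ∈ Icc 0 T, HasDerivWithinAt v (w t) (Icc 0 T) t)
    (hw : ∀ t ∈ Icc 0 T, HasDerivWithinAt w (F t - q t * v t - d t * w t) (Icc 0 T) t) :
    ContDiffOn ℝ ∞ v (Icc 0 T) ∧ ContDiffOn ℝ ∞ w (Icc 0 T) := by
  have hU := uniqueDiffOn_Icc hT
  have key : ∀ m : ℕ, ContDiffOn ℝ m v (Icc 0 T) ∧ ContDiffOn ℝ m w (Icc 0 T) := by
    intro m
    induction m with
    | zero =>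
      simp only [Nat.cast_zero, contDiffOn_zero]
      exact ⟨fun t ht => (hv t ht).continuousWithinAt, fun t ht => (hw t ht).continuousWithinAt⟩
    | succ m ih =>
      have hle : (m : ℕ∞ω) ≤ ∞ := by exact_mod_cast le_top
      push_cast
      rw [contDiffOn_succ_iff_derivWithin hU, contDiffOn_succ_iff_derivWithin hU]
      refine ⟨⟨fun t ht => (hv t ht).differentiableWithinAt, by simp, ih.2.congr fun t ht =>
        (hv t ht).derivWithin (hU t ht)⟩, fun t ht => (hw t ht).differentiableWithinAt, by simp, ?_⟩
      refine ContDiffOn.congr ?_ fun t ht => (hw t ht).derivWithin (hU t ht)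
      exact ((hF.of_le hle).sub (((hq.of_le hle).contDiffOn).mul ih.1)).sub
        (((hd.of_le hle).contDiffOn).mul ih.2)
  exact ⟨contDiffOn_infty.2 fun m => (key m).1, contDiffOn_infty.2 fun m => (key m).2⟩

/-- Leibniz's rule applied to the equation bounds each time derivative by lower ones, so a bound on
v and v' propagates to all orders. -/
theorem iteratedDerivWithin_second_order (hT : 0 < T) (hq : ContDiff ℝ ∞ q) (hd : ContDiff ℝ ∞ d)
    (hF : ContDiffOn ℝ ∞ F (Icc 0 T))
    (hv : ∀ t ∈ Icc 0 T, HasDerivWithinAt v (w t) (Icc 0 T) t)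
    (hw : ∀ t ∈ Icc 0 T, HasDerivWithinAt w (F t - q t * v t - d t * w t) (Icc 0 T) t)
    (k : ℕ) {t : ℝ} (ht : t ∈ Icc 0 T) :
    iteratedDerivWithin (k + 2) v (Icc 0 T) t = iteratedDerivWithin k F (Icc 0 T) t
      + ∑ i ∈ Finset.range (k + 1), -(k.choose i : ℂ) *
        (iteratedDerivWithin i q (Icc 0 T) t * iteratedDerivWithin (k - i) v (Icc 0 T) t)
      + ∑ i ∈ Finset.range (k + 1), -(k.choose i : ℂ) *
        (iteratedDerivWithin i d (Icc 0 T) t * iteratedDerivWithin (k - i + 1) v (Icc 0 T) t) := by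
  have hU := uniqueDiffOn_Icc hT
  obtain ⟨hvc, hwc⟩ := contDiffOn_of_second_order hT hq hd hF hv hw
  have e1 : EqOn (derivWithin v (Icc 0 T)) w (Icc 0 T) :=
    fun t ht => (hv t ht).derivWithin (hU t ht)
  have e2 : EqOn (derivWithin w (Icc 0 T)) (F - q * v - d * w) (Icc 0 T) :=
    fun t ht => (hw t ht).derivWithin (hU t ht)
  have e3 : ∀ j, iteratedDerivWithin (j + 1) v (Icc 0 T) t = iteratedDerivWithin j w (Icc 0 T) t :=
    fun j => by rw [iteratedDerivWithin_succ', iteratedDerivWithin_congr e1 ht]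
  have hle : (k : ℕ∞ω) ≤ ∞ := by exact_mod_cast le_top
  have hF' := (hF.of_le hle) t ht
  have hv' := (hvc.of_le hle) t ht
  have hw' := (hwc.of_le hle) t ht
  have hq' := (hq.of_le hle).contDiffAt.contDiffWithinAt (x := t) (s := Icc 0 T)
  have hd' := (hd.of_le hle).contDiffAt.contDiffWithinAt (x := t) (s := Icc 0 T)
  have hqv : ContDiffWithinAt ℝ k (q * v) (Icc 0 T) t := hq'.mul hv'
  have hdw : ContDiffWithinAt ℝ k (d * w) (Icc 0 T) t := hd'.mul hw'
  have hFqv : ContDiffWithinAt ℝ k (F - q * v) (Icc 0 T) t := hF'.sub hqv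
  rw [show k + 2 = (k + 1) + 1 from rfl, e3, iteratedDerivWithin_succ',
    iteratedDerivWithin_congr e2 ht,
    iteratedDerivWithin_sub ht hU hFqv hdw,
    iteratedDerivWithin_sub ht hU hF' hqv, iteratedDerivWithin_mul ht hU hq' hv',
    iteratedDerivWithin_mul ht hU hd' hw']
  simp only [e3, sub_eq_add_neg, ← Finset.sum_neg_distrib, neg_mul, mul_assoc]

end SecondOrder

/-- All time derivatives of a solution are tempered once the first two are. -/
theorem isTemperedNet_iteratedDerivWithin_of_second_order {n : ℕ} {T s γ : ℝ} (hT : 0 < T)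
    {q d F v w : ℝ → ℝ → Space n → ℂ}
    (hq : ∀ ε ∈ Ioc (0 : ℝ) 1, ∀ ξ, ContDiff ℝ ∞ fun t => q ε t ξ)
    (hd : ∀ ε ∈ Ioc (0 : ℝ) 1, ∀ ξ, ContDiff ℝ ∞ fun t => d ε t ξ)
    (hF : ∀ ε ∈ Ioc (0 : ℝ) 1, ∀ ξ, ContDiffOn ℝ ∞ (fun t => F ε t ξ) (Icc 0 T))
    (hv : ∀ ε ∈ Ioc (0 : ℝ) 1, ∀ ξ, ∀ t ∈ Icc 0 T,
      HasDerivWithinAt (fun t => v ε t ξ) (w ε t ξ) (Icc 0 T) t)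
    (hw : ∀ ε ∈ Ioc (0 : ℝ) 1, ∀ ξ, ∀ t ∈ Icc 0 T, HasDerivWithinAt (fun t => w ε t ξ)
      (F ε t ξ - q ε t ξ * v ε t ξ - d ε t ξ * w ε t ξ) (Icc 0 T) t)
    (hq' : ∀ k, IsTemperedNet T s 0
      (fun ε t ξ => iteratedDerivWithin k (fun t => q ε t ξ) (Icc 0 T) t))
    (hd' : ∀ k, IsTemperedNet T s 0
      (fun ε t ξ => iteratedDerivWithin k (fun t => d ε t ξ) (Icc 0 T) t))
    (hF' : ∀ k, IsTemperedNet T s γ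
      (fun ε t ξ => iteratedDerivWithin k (fun t => F ε t ξ) (Icc 0 T) t))
    (hv' : IsTemperedNet T s γ v) (hw' : IsTemperedNet T s γ w) (k : ℕ) :
    IsTemperedNet T s γ (fun ε t ξ => iteratedDerivWithin k (fun t => v ε t ξ) (Icc 0 T) t) := by
  have hU := uniqueDiffOn_Icc hT
  induction k using Nat.strong_induction_on with
  | _ k ih =>
    match k, ih with
    | 0, _ => simpa using hv'
    | 1, _ =>
      refine hw'.mono fun ε hε t ht ξ => le_of_eq ?_
      rw [iteratedDerivWithin_one, (hv ε hε ξ t ht).derivWithin (hU t ht)]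
    | k + 2, ih =>
      have h1 : IsTemperedNet T s γ (fun ε t ξ => iteratedDerivWithin k (fun t => F ε t ξ) (Icc 0 T) t
        + ∑ i ∈ Finset.range (k + 1), -(k.choose i : ℂ) *
          (iteratedDerivWithin i (fun t => q ε t ξ) (Icc 0 T) t *
            iteratedDerivWithin (k - i) (fun t => v ε t ξ) (Icc 0 T) t)
        + ∑ i ∈ Finset.range (k + 1), -(k.choose i : ℂ) *
          (iteratedDerivWithin i (fun t => d ε t ξ) (Icc 0 T) t *
            iteratedDerivWithin (k - i + 1) (fun t => v ε t ξ) (Icc 0 T) t)) := by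
        refine ((hF' k).add (.sum _ fun i hi => ?_)).add (.sum _ fun i hi => ?_)
        · exact (isTemperedNet_const _).coeff_mul ((hq' i).coeff_mul (ih (k - i) (by omega)))
        · exact (isTemperedNet_const _).coeff_mul ((hd' i).coeff_mul (ih (k - i + 1)
            (by have := Finset.mem_range.1 hi; omega)))
      refine h1.mono fun ε hε t ht ξ => le_of_eq ?_
      rw [iteratedDerivWithin_second_order hT (hq ε hε ξ) (hd ε hε ξ) (hF ε hε ξ) (hv ε hε ξ)
        (hw ε hε ξ) k ht]

/-- Solutions of a family of second order equations depending continuously on a parameter. -/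
theorem exists_second_order_solution {n : ℕ} {T : ℝ} (hT : 0 ≤ T) {q F : ℝ → Space n → ℂ}
    {d : ℝ → ℂ} {v₀ w₀ : Space n → ℂ} (hq : Continuous (Function.uncurry q))
    (hF : Continuous (Function.uncurry F)) (hd : Continuous d) (hv₀ : Continuous v₀)
    (hw₀ : Continuous w₀) :
    ∃ v w : ℝ → Space n → ℂ, (∀ ξ, v 0 ξ = v₀ ξ) ∧ (∀ ξ, w 0 ξ = w₀ ξ) ∧
      (∀ ξ, ∀ t ∈ Icc 0 T, HasDerivWithinAt (fun t => v t ξ) (w t ξ) (Icc 0 T) t) ∧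
      (∀ ξ, ∀ t ∈ Icc 0 T, HasDerivWithinAt (fun t => w t ξ)
        (F t ξ - q t ξ * v t ξ - d t * w t ξ) (Icc 0 T) t) ∧
      ∀ t ∈ Icc 0 T, StronglyMeasurable (v t) := by
  -- Constant matrix units. Writing the system matrix as a combination of them with scalar
  -- coefficients gives its continuity in operator norm directly.
  let N₁ : (ℂ × ℂ) →L[ℝ] (ℂ × ℂ) := (ContinuousLinearMap.inr ℝ ℂ ℂ).comp (.fst ℝ ℂ ℂ)
  let N₂ : (ℂ × ℂ) →L[ℝ] (ℂ × ℂ) := (ContinuousLinearMap.inr ℝ ℂ ℂ).comp (.snd ℝ ℂ ℂ)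
  let N₃ : (ℂ × ℂ) →L[ℝ] (ℂ × ℂ) := (ContinuousLinearMap.inl ℝ ℂ ℂ).comp (.snd ℝ ℂ ℂ)
  let M : ℝ → Space n → (ℂ × ℂ) →L[ℝ] (ℂ × ℂ) := fun t ξ => N₃ - q t ξ • N₁ - d t • N₂
  have hM : Continuous (Function.uncurry M) :=
    (continuous_const.sub (hq.smul continuous_const)).sub
      ((hd.comp continuous_fst).smul continuous_const)
  have hG : Continuous (Function.uncurry fun t ξ => ((0 : ℂ), F t ξ)) :=
    continuous_const.prodMk hF
  obtain ⟨V, hV0, hV, hVm⟩ := exists_linearODE_solution hT hM hG (hv₀.prodMk hw₀)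
  refine ⟨fun t ξ => (V t ξ).1, fun t ξ => (V t ξ).2, fun ξ => congrArg Prod.fst (hV0 ξ),
    fun ξ => congrArg Prod.snd (hV0 ξ), fun ξ t ht => ?_, fun ξ t ht => ?_,
    fun t ht => (hVm t ht).fst⟩
  · have h : HasDerivWithinAt (fun t => (V t ξ).1) (M t ξ (V t ξ) + (0, F t ξ)).1 (Icc 0 T) t :=
      (ContinuousLinearMap.fst ℝ ℂ ℂ).hasFDerivAt.comp_hasDerivWithinAt t (hV ξ t ht)
    refine h.congr_deriv ?_
    simp [M, N₁, N₂, N₃]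
  · have h : HasDerivWithinAt (fun t => (V t ξ).2) (M t ξ (V t ξ) + (0, F t ξ)).2 (Icc 0 T) t :=
      (ContinuousLinearMap.snd ℝ ℂ ℂ).hasFDerivAt.comp_hasDerivWithinAt t (hV ξ t ht)
    refine h.congr_deriv ?_
    simp [M, N₁, N₂, N₃]
    ring

/-! ### The symbol of the operator -/

/-- Nets of symbols which are smooth in time, all time derivatives being tempered. -/
structure IsSmoothTempered {n : ℕ} (T s γ : ℝ) (G : ℝ → ℝ → Space n → ℂ) : Prop where
  contDiff : ∀ ε ∈ Ioc (0 : ℝ) 1, ∀ ξ, ContDiff ℝ ∞ fun t => G ε t ξ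
  tempered : ∀ k, IsTemperedNet T s γ (fun ε t ξ => iteratedDeriv k (fun t => G ε t ξ) t)

section SmoothTempered

variable {n : ℕ} {T s γ : ℝ}

theorem IsSmoothTempered.add {G H : ℝ → ℝ → Space n → ℂ} (hG : IsSmoothTempered T s γ G)
    (hH : IsSmoothTempered T s γ H) : IsSmoothTempered T s γ (fun ε t ξ => G ε t ξ + H ε t ξ) := by
  refine ⟨fun ε hε ξ => (hG.contDiff ε hε ξ).add (hH.contDiff ε hε ξ), fun k =>
    ((hG.tempered k).add (hH.tempered k)).mono fun ε hε t _ ξ => le_of_eq ?_⟩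
  have hk : (k : ℕ∞ω) ≤ ∞ := by exact_mod_cast le_top
  exact congrArg _ (iteratedDeriv_add ((hG.contDiff ε hε ξ).of_le hk).contDiffAt
    ((hH.contDiff ε hε ξ).of_le hk).contDiffAt)

theorem IsSmoothTempered.sum {ι : Type*} (S : Finset ι) {G : ι → ℝ → ℝ → Space n → ℂ}
    (hG : ∀ i ∈ S, IsSmoothTempered T s γ (G i)) :
    IsSmoothTempered T s γ (fun ε t ξ => ∑ i ∈ S, G i ε t ξ) := by
  refine ⟨fun ε hε ξ => ContDiff.sum fun i hi => (hG i hi).contDiff ε hε ξ, fun k =>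
    (IsTemperedNet.sum S fun i hi => (hG i hi).tempered k).mono fun ε hε t _ ξ => le_of_eq ?_⟩
  have hk : (k : ℕ∞ω) ≤ ∞ := by exact_mod_cast le_top
  rw [iteratedDeriv_fun_sum fun i hi => (((hG i hi).contDiff ε hε ξ).of_le hk).contDiffAt]

theorem IsSmoothTempered.mul_right {G : ℝ → ℝ → Space n → ℂ} (hG : IsSmoothTempered T s γ G)
    {m : Space n → ℂ} (hm : IsTemperedNet T s 0 (fun _ _ ξ => m ξ)) :
    IsSmoothTempered T s γ (fun ε t ξ => G ε t ξ * m ξ) := by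
  refine ⟨fun ε hε ξ => (hG.contDiff ε hε ξ).mul contDiff_const, fun k =>
    (hm.coeff_mul (hG.tempered k)).mono fun ε hε t _ ξ => le_of_eq ?_⟩
  rw [iteratedDeriv_mul_const_field, mul_comm]

theorem IsSmoothTempered.iteratedDerivWithin {G : ℝ → ℝ → Space n → ℂ}
    (hG : IsSmoothTempered T s γ G) (hT : 0 < T) (k : ℕ) :
    IsTemperedNet T s γ (fun ε t ξ => iteratedDerivWithin k (fun t => G ε t ξ) (Icc 0 T) t) := by
  refine (hG.tempered k).mono fun ε hε t ht ξ => le_of_eq ?_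
  have hk : (k : ℕ∞ω) ≤ ∞ := by exact_mod_cast le_top
  rw [iteratedDerivWithin_eq_iteratedDeriv (uniqueDiffOn_Icc hT)
    ((hG.contDiff ε hε ξ).of_le hk).contDiffAt ht]

theorem isTemperedNet_of_moderate {E : Type*} [NormedAddCommGroup E] {G : ℝ → ℝ → E} {N : ℕ}
    {C : ℝ} (hC : 0 < C) (h : ∀ ε ∈ Ioc (0 : ℝ) 1, ∀ t ∈ Icc 0 T, ‖G ε t‖ ≤ C * ε⁻¹ ^ N) :
    IsTemperedNet T s 0 (fun ε t (_ : Space n) => G ε t) :=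
  ⟨0, N, C, hC, fun ε hε t ht ξ => by simpa [gevreyDecay] using h ε hε t ht⟩

theorem IsModerate.isSmoothTempered {v : ℝ → ℝ → ℂ} (hv : IsModerate v) :
    IsSmoothTempered T s 0 (fun ε t (_ : Space n) => v ε t) := by
  refine ⟨fun ε hε _ => hv.1 ε hε, fun k => ?_⟩
  obtain ⟨N, C, hC, h⟩ := hv.2 (Icc 0 T) isCompact_Icc k
  exact isTemperedNet_of_moderate hC h

theorem iteratedDeriv_ofReal {v : ℝ → ℝ} (hv : ContDiff ℝ ∞ v) (k : ℕ) :
    iteratedDeriv k (fun t => (v t : ℂ)) = fun t => ((iteratedDeriv k v t : ℝ) : ℂ) := by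
  induction k with
  | zero => simp
  | succ k ih =>
    rw [iteratedDeriv_succ, ih]
    ext t
    have := ((contDiff_iteratedDeriv hv k).differentiable (by simp) t).hasDerivAt.ofReal_comp
    rw [this.deriv, iteratedDeriv_succ]

theorem IsModerate.ofReal {v : ℝ → ℝ → ℝ} (hv : IsModerate v) :
    IsModerate (fun ε t => (v ε t : ℂ)) := by
  refine ⟨fun ε hε => Complex.ofRealCLM.contDiff.comp (hv.1 ε hε), fun K hK k => ?_⟩
  obtain ⟨N, C, hC, h⟩ := hv.2 K hK k
  refine ⟨N, C, hC, fun ε hε t ht => ?_⟩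
  rw [iteratedDeriv_ofReal (hv.1 ε hε), Complex.norm_real]
  exact h ε hε t ht

theorem isTemperedNet_freq (i : Fin n) : IsTemperedNet T s 0 (fun _ _ ξ => freq i ξ) := by
  refine ⟨1, 0, 2 * Real.pi, by positivity, fun ε _ t _ ξ => ?_⟩
  simpa [gevreyDecay] using norm_freq_le i ξ

end SmoothTempered

/-- The principal symbol `∑ a_i(t) (2π ξ_i)²`. -/
def principalSymbol {n : ℕ} (a : Fin n → ℝ → ℝ) (t : ℝ) (ξ : Space n) : ℝ :=
  ∑ i, a i t * (2 * Real.pi * ξ i) ^ 2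

/-- The first order symbol `∑ c_i(t) 2πi ξ_i`. -/
def firstOrderSymbol {n : ℕ} (c : Fin n → ℝ → ℂ) (t : ℝ) (ξ : Space n) : ℂ :=
  ∑ i, c i t * freq i ξ

/-- The symbol of `-∑ a_i(t) ∂_i² + ∑ c_i(t) ∂_i + e(t)`. -/
def spatialSymbol {n : ℕ} (a : Fin n → ℝ → ℝ) (c : Fin n → ℝ → ℂ) (e : ℝ → ℂ) (t : ℝ)
    (ξ : Space n) : ℂ :=
  principalSymbol a t ξ + (firstOrderSymbol c t ξ + e t)

section Symbols

variable {n : ℕ} {T s : ℝ}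

theorem freq_mul_freq (i : Fin n) (ξ : Space n) :
    freq i ξ * freq i ξ = -((2 * Real.pi * ξ i : ℝ) ^ 2 : ℝ) := by
  rw [freq, mul_mul_mul_comm, Complex.I_mul_I]
  push_cast
  ring

theorem coe_principalSymbol (a : Fin n → ℝ → ℝ) (t : ℝ) (ξ : Space n) :
    (principalSymbol a t ξ : ℂ) = ∑ i, (a i t : ℂ) * -(freq i ξ * freq i ξ) := by
  simp only [principalSymbol, freq_mul_freq, neg_neg]
  push_cast
  rfl

theorem contDiff_principalSymbol {a : Fin n → ℝ → ℝ} (ha : ∀ i, ContDiff ℝ ∞ (a i)) (ξ : Space n) :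
    ContDiff ℝ ∞ fun t => principalSymbol a t ξ :=
  ContDiff.sum fun i _ => (ha i).mul contDiff_const

theorem iteratedDeriv_principalSymbol {a : Fin n → ℝ → ℝ} (ha : ∀ i, ContDiff ℝ ∞ (a i))
    (ξ : Space n) (k : ℕ) (t : ℝ) : iteratedDeriv k (fun t => principalSymbol a t ξ) t =
      principalSymbol (fun i => iteratedDeriv k (a i)) t ξ := by
  have hk : (k : ℕ∞ω) ≤ ∞ := by exact_mod_cast le_top
  simp only [principalSymbol]
  rw [iteratedDeriv_fun_sum fun i _ => (((ha i).mul contDiff_const).of_le hk).contDiffAt]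
  simp only [iteratedDeriv_mul_const_field]

theorem abs_principalSymbol_le {a : Fin n → ℝ → ℝ} {t D : ℝ} (ha : ∀ i, |a i t| ≤ D)
    (ξ : Space n) : |principalSymbol a t ξ| ≤ n * (2 * Real.pi) ^ 2 * D * (1 + ‖ξ‖) ^ 2 := by
  have h : ∀ i : Fin n, |a i t * (2 * Real.pi * ξ i) ^ 2| ≤ D * ((2 * Real.pi) ^ 2 * (1 + ‖ξ‖) ^ 2) := by
    intro i
    have hD : 0 ≤ D := (abs_nonneg _).trans (ha i)
    rw [abs_mul, abs_pow, abs_mul, abs_of_pos Real.two_pi_pos, mul_pow]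
    have h1 : |ξ i| ≤ 1 + ‖ξ‖ := by
      have := PiLp.norm_apply_le ξ i
      rw [Real.norm_eq_abs] at this
      linarith
    gcongr
    exact ha i
  refine (Finset.abs_sum_le_sum_abs _ _).trans ((Finset.sum_le_sum fun i _ => h i).trans_eq ?_)
  rw [Finset.sum_const, Finset.card_univ, Fintype.card_fin, nsmul_eq_mul]
  ring

theorem principalSymbol_nonneg {a : Fin n → ℝ → ℝ} {t : ℝ} (ha : ∀ i, 0 ≤ a i t) (ξ : Space n) :
    0 ≤ principalSymbol a t ξ :=
  Finset.sum_nonneg fun i _ => mul_nonneg (ha i) (sq_nonneg _)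

theorem continuous_spatialSymbol {a : Fin n → ℝ → ℝ} {c : Fin n → ℝ → ℂ} {e : ℝ → ℂ}
    (ha : ∀ i, Continuous (a i)) (hc : ∀ i, Continuous (c i)) (he : Continuous e) :
    Continuous (Function.uncurry (spatialSymbol a c e)) := by
  have h1 : Continuous fun p : ℝ × Space n => ∑ i, (a i p.1 : ℂ) * -(freq i p.2 * freq i p.2) :=
    continuous_finsetSum _ fun i _ =>
      (Complex.continuous_ofReal.comp ((ha i).comp continuous_fst)).mul
        ((((continuous_freq i).comp continuous_snd).mul
          ((continuous_freq i).comp continuous_snd)).neg)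
  have h2 : Continuous fun p : ℝ × Space n => ∑ i, c i p.1 * freq i p.2 :=
    continuous_finsetSum _ fun i _ => ((hc i).comp continuous_fst).mul
      ((continuous_freq i).comp continuous_snd)
  refine (h1.add (h2.add (he.comp continuous_fst))).congr fun p => ?_
  rw [Function.uncurry, spatialSymbol, coe_principalSymbol, firstOrderSymbol]
  rfl

theorem isSmoothTempered_spatialSymbol {a : ℝ → Fin n → ℝ → ℝ} {c : ℝ → Fin n → ℝ → ℂ}
    {e : ℝ → ℝ → ℂ} (ha : ∀ i, IsModerate fun ε => a ε i) (hc : ∀ i, IsModerate fun ε => c ε i)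
    (he : IsModerate e) :
    IsSmoothTempered T s 0 (fun ε t ξ => spatialSymbol (a ε) (c ε) (e ε) t ξ) := by
  simp only [spatialSymbol, coe_principalSymbol, firstOrderSymbol]
  refine .add (.sum _ fun i _ => ?_) (.add (.sum _ fun i _ => ?_) he.isSmoothTempered)
  · refine (ha i).ofReal.isSmoothTempered.mul_right ?_
    exact ((isTemperedNet_freq i).coeff_mul (isTemperedNet_freq i)).mono
      fun ε _ t _ ξ => (norm_neg _).le
  · exact (hc i).isSmoothTempered.mul_right (isTemperedNet_freq i)

/-- The Levi condition for the first order terms, in homogeneous form. -/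
theorem norm_firstOrderSymbol_sq_le {a : Fin n → ℝ → ℝ} {c : Fin n → ℝ → ℂ} {e : ℝ → ℂ}
    {t R K : ℝ} (hR : 0 < R) (h : ∀ ξ : Space n, R ≤ ‖ξ‖ →
      ‖Complex.I * ∑ i, c i t * (ξ i : ℂ) + e t‖ ^ 2 ≤ K * (2 * ∑ i, a i t * ξ i ^ 2))
    (ξ : Space n) : ‖firstOrderSymbol c t ξ‖ ^ 2 ≤ 2 * K * principalSymbol a t ξ := by
  rcases eq_or_ne ξ 0 with rfl | hξ
  · simp [firstOrderSymbol, principalSymbol, freq]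
  have hξ0 : 0 < ‖ξ‖ := norm_pos_iff.2 hξ
  set σ : ℝ := R / ‖ξ‖ with hσ
  have hσ0 : 0 < σ := by positivity
  set X := Complex.I * ∑ i, c i t * (ξ i : ℂ) with hX
  set A := ∑ i, a i t * ξ i ^ 2 with hA
  have hX' : firstOrderSymbol c t ξ = (2 * Real.pi : ℝ) * X := by
    rw [hX, firstOrderSymbol, Finset.mul_sum, Finset.mul_sum]
    refine Finset.sum_congr rfl fun i _ => ?_
    rw [freq]
    push_cast
    ring
  have hA' : principalSymbol a t ξ = (2 * Real.pi) ^ 2 * A := by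
    rw [hA, principalSymbol, Finset.mul_sum]
    exact Finset.sum_congr rfl fun i _ => by ring
  -- The condition is used only at the two multiples ±σξ of norm R. Adding the two inequalities
  -- bounds σ²|X|² by the parallelogram law, and homogeneity removes σ.
  have key : ∀ κ : ℝ, |κ| = σ → ‖(κ : ℂ) * X + e t‖ ^ 2 ≤ K * (2 * (σ ^ 2 * A)) := by
    intro κ hκ
    have h1 := h (κ • ξ) (by rw [norm_smul, Real.norm_eq_abs, hκ, hσ, div_mul_cancel₀ _ hξ0.ne'])
    have e1 : Complex.I * ∑ i, c i t * (((κ • ξ) i : ℝ) : ℂ) = κ * X := by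
      rw [hX, mul_left_comm, Finset.mul_sum _ _ (κ : ℂ)]
      congr 1
      refine Finset.sum_congr rfl fun i _ => ?_
      rw [PiLp.smul_apply, smul_eq_mul]
      push_cast
      ring
    have e2 : ∑ i, a i t * (κ • ξ) i ^ 2 = σ ^ 2 * A := by
      rw [hA, Finset.mul_sum, ← hκ, sq_abs]
      refine Finset.sum_congr rfl fun i _ => ?_
      rw [PiLp.smul_apply, smul_eq_mul]
      ring
    rwa [e1, e2] at h1
  have h1 := key σ (abs_of_pos hσ0)
  have h2 := key (-σ) (by rw [abs_neg, abs_of_pos hσ0])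
  have h3 := parallelogram_law_with_norm ℝ (e t) ((σ : ℂ) * X)
  have e3 : ‖e t - (σ : ℂ) * X‖ = ‖((-σ : ℝ) : ℂ) * X + e t‖ := by
    congr 1; push_cast; ring
  rw [e3, add_comm (e t)] at h3
  have h4 : ‖(σ : ℂ) * X‖ ^ 2 = σ ^ 2 * ‖X‖ ^ 2 := by
    rw [norm_mul, Complex.norm_real, mul_pow, Real.norm_eq_abs, sq_abs]
  have h5 : σ ^ 2 * ‖X‖ ^ 2 ≤ σ ^ 2 * (2 * K * A) := by
    nlinarith [mul_self_nonneg ‖e t‖]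
  have h6 := le_of_mul_le_mul_left h5 (by positivity)
  rw [hX', hA', norm_mul, Complex.norm_real, mul_pow, Real.norm_eq_abs, sq_abs]
  nlinarith [mul_le_mul_of_nonneg_left h6 (sq_nonneg (2 * Real.pi))]

/-- The Levi condition for the terms of order zero. -/
theorem norm_zeroOrder_sq_le {a : Fin n → ℝ → ℝ} {c : Fin n → ℝ → ℂ} {e : ℝ → ℂ}
    {t R K : ℝ} (hR : 0 < R) (h : ∀ ξ : Space n, R ≤ ‖ξ‖ →
      ‖Complex.I * ∑ i, c i t * (ξ i : ℂ) + e t‖ ^ 2 ≤ K * (2 * ∑ i, a i t * ξ i ^ 2))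
    (i : Fin n) : ‖e t‖ ^ 2 ≤ 2 * K * R ^ 2 * a i t := by
  -- The same argument at ±R along the i-th axis, this time keeping the term ‖e‖².
  have key : ∀ κ : ℝ, |κ| = R →
      ‖Complex.I * (c i t * κ) + e t‖ ^ 2 ≤ K * (2 * (a i t * R ^ 2)) := by
    intro κ hκ
    have h1 := h (EuclideanSpace.single i κ) (by simp [hκ])
    have e1 : ∑ j, c j t * ((EuclideanSpace.single i κ j : ℝ) : ℂ) = c i t * κ := by
      rw [Finset.sum_eq_single i]
      · simp
      · intro j _ hj
        simp [hj]
      · simp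
    have e2 : ∑ j, a j t * (EuclideanSpace.single i κ j) ^ 2 = a i t * R ^ 2 := by
      rw [Finset.sum_eq_single i]
      · simp [← hκ]
      · intro j _ hj
        simp [hj]
      · simp
    rwa [e1, e2] at h1
  have h1 := key R (abs_of_pos hR)
  have h2 := key (-R) (by rw [abs_neg, abs_of_pos hR])
  have h3 := parallelogram_law_with_norm ℝ (e t) (Complex.I * (c i t * R))
  have e3 : ‖e t - Complex.I * (c i t * R)‖ = ‖Complex.I * (c i t * (-R : ℝ)) + e t‖ := by
    congr 1; push_cast; ring
  rw [e3, add_comm (e t)] at h3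
  nlinarith [mul_self_nonneg ‖Complex.I * (c i t * R)‖]

end Symbols

/-! ### Weakly hyperbolic systems of logarithmic type -/

/-- Nets of coefficients for which the Fourier transformed Cauchy problem is well posed with a loss
which is polynomial in `ε⁻¹`; here `Λ` is of size `log ε⁻¹`. -/
structure IsTameSystem {n : ℕ} (T r : ℝ) (Λ : ℝ → ℝ) (a : ℝ → Fin n → ℝ → ℝ)
    (c : ℝ → Fin n → ℝ → ℂ) (d e : ℝ → ℝ → ℂ) : Prop where
  moderate_a : ∀ i, IsModerate fun ε => a ε i
  moderate_c : ∀ i, IsModerate fun ε => c ε i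
  moderate_d : IsModerate d
  moderate_e : IsModerate e
  one_le : ∀ ε ∈ Ioc (0 : ℝ) 1, 1 ≤ Λ ε
  exp_le : ∃ C > (0 : ℝ), ∀ ε ∈ Ioc (0 : ℝ) 1, Real.exp (Λ ε) ≤ C * ε⁻¹
  nonneg : ∀ ε ∈ Ioc (0 : ℝ) 1, ∀ t i, 0 ≤ a ε i t
  -- N is independent of k, as needed to choose k in terms of N in the variation estimate.
  deriv_le : ∃ N : ℕ, ∀ k : ℕ, ∃ C > (0 : ℝ), ∀ ε ∈ Ioc (0 : ℝ) 1, ∀ t ∈ Icc 0 T, ∀ i,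
    |iteratedDeriv k (a ε i) t| ≤ C * Λ ε ^ (r * (N + k))
  levi : ∃ C > (0 : ℝ), ∀ ε ∈ Ioc (0 : ℝ) 1, ∀ t ∈ Icc 0 T,
    (∀ ξ, ‖firstOrderSymbol (c ε) t ξ‖ ≤ C * Λ ε * √(principalSymbol (a ε) t ξ)) ∧
      ‖e ε t‖ ≤ C * Λ ε * Λ ε ∧ ‖d ε t‖ ≤ C * Λ ε

section Energy

variable {n : ℕ} {T r s γ : ℝ} {Λ : ℝ → ℝ} {a : ℝ → Fin n → ℝ → ℝ} {c : ℝ → Fin n → ℝ → ℂ}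
  {d e : ℝ → ℝ → ℂ}

theorem IsTemperedNet.at_zero {E : Type*} [NormedAddCommGroup E] {G : ℝ → ℝ → Space n → E}
    (hG : IsTemperedNet T s γ G) (hT : 0 ≤ T) : IsTemperedNet T s γ (fun ε _ ξ => G ε 0 ξ) := by
  obtain ⟨p, N, C, hC, hb⟩ := hG
  exact ⟨p, N, C, hC, fun ε hε t _ ξ => hb ε hε 0 ⟨le_rfl, hT⟩ ξ⟩

theorem IsTemperedNet.norm_sq {E : Type*} [NormedAddCommGroup E] {G : ℝ → ℝ → Space n → E}
    (hG : IsTemperedNet T s γ G) : IsTemperedNet T s (γ + γ) (fun ε t ξ => ‖G ε t ξ‖ ^ 2) := by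
  have h1 : IsTemperedNet T s γ (fun ε t ξ => ‖G ε t ξ‖) := hG.mono fun ε _ t _ ξ => by simp
  simpa only [sq] using h1.mul h1

theorem IsTameSystem.isTemperedNet_size (H : IsTameSystem T r Λ a c d e) :
    IsTemperedNet T s 0 (fun ε _ (_ : Space n) => Λ ε) := by
  obtain ⟨C, hC, h⟩ := H.exp_le
  refine isTemperedNet_of_moderate (G := fun ε _ => Λ ε) (N := 1) hC fun ε hε t _ => ?_
  rw [pow_one, Real.norm_of_nonneg (zero_le_one.trans (H.one_le ε hε))]
  linarith [h ε hε, Real.add_one_le_exp (Λ ε)]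

theorem isTemperedNet_principalSymbol (ha : ∀ i, IsModerate fun ε => a ε i) :
    IsTemperedNet T s 0 (fun ε t ξ => principalSymbol (a ε) t ξ) := by
  refine .sum _ fun i _ => .coeff_mul ?_ ?_
  · obtain ⟨N, C, hC, h⟩ := (ha i).2 (Icc 0 T) isCompact_Icc 0
    exact isTemperedNet_of_moderate hC fun ε hε t ht => by simpa using h ε hε t ht
  · refine ((isTemperedNet_freq i).coeff_mul (isTemperedNet_freq i)).mono fun ε _ t _ ξ => ?_
    rw [freq_mul_freq, norm_neg, Complex.norm_real]

theorem rpow_one_div_le {s Y : ℝ} (hs : 1 ≤ s) (hY : 1 ≤ Y) : Y ^ (1 / s) ≤ Y := by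
  have : 1 / s ≤ 1 := by rw [div_le_one (by linarith)]; exact hs
  simpa using Real.rpow_le_rpow_of_exponent_le hY this

theorem isTemperedNet_gevreyWeight (hs : 1 ≤ s) (τ : ℝ) :
    IsTemperedNet T s 0 (fun _ _ (ξ : Space n) => τ * (1 + ‖ξ‖) ^ (1 / s)) := by
  refine ⟨1, 0, |τ| + 1, by positivity, fun ε _ t _ ξ => ?_⟩
  have hY : 1 ≤ 1 + ‖ξ‖ := by linarith [norm_nonneg ξ]
  have h1 := rpow_one_div_le hs hY
  have h2 : 0 ≤ (1 + ‖ξ‖) ^ (1 / s) := by positivity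
  rw [norm_mul, Real.norm_eq_abs, Real.norm_of_nonneg h2]
  simp only [pow_zero, mul_one, pow_one, gevreyDecay, neg_zero, zero_mul, Real.exp_zero]
  nlinarith [abs_nonneg τ]

/-- The loss in the energy estimate. -/
theorem IsTameSystem.isTemperedNet_loss (H : IsTameSystem T r Λ a c d e) (M : ℝ) :
    IsTemperedNet T s (-γ) (fun ε _ (ξ : Space n) =>
      Real.exp (T + M * Λ ε + γ * (1 + ‖ξ‖) ^ (1 / s))) := by
  obtain ⟨C, hC, h⟩ := H.exp_le
  refine ⟨0, ⌈M⌉₊, Real.exp T * C ^ ⌈M⌉₊, by positivity, fun ε hε t _ ξ => ?_⟩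
  rw [Real.norm_of_nonneg (Real.exp_pos _).le, Real.exp_add, Real.exp_add, gevreyDecay, neg_neg,
    pow_zero, mul_one, mul_assoc (Real.exp T) (C ^ _), ← mul_pow]
  gcongr
  have h1 : Real.exp (M * Λ ε) ≤ Real.exp (Λ ε) ^ ⌈M⌉₊ := by
    rw [← Real.exp_nat_mul]
    gcongr
    · exact zero_le_one.trans (H.one_le ε hε)
    · exact Nat.le_ceil M
  exact h1.trans (pow_le_pow_left₀ (Real.exp_pos _).le (h ε hε) _)

/-- The logarithmic derivative of the principal symbol has small mass. -/
theorem IsTameSystem.exists_integral_le (H : IsTameSystem T r Λ a c d e) (hr : 0 < r) (hr1 : r < 1)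
    (hs : 1 ≤ s) (hT : 0 < T) {τ : ℝ} (hτ : 0 < τ) :
    ∃ K > (0 : ℝ), ∀ ε ∈ Ioc (0 : ℝ) 1, ∀ ξ, ∀ δ ≥ (1 : ℝ),
      ∫ t in 0..T, |deriv (fun t => principalSymbol (a ε) t ξ) t| / (principalSymbol (a ε) t ξ + δ)
        ≤ K * Λ ε + τ * (1 + ‖ξ‖) ^ (1 / s) := by
  obtain ⟨N, hN⟩ := H.deriv_le
  -- k depends on N only; the constants for the derivatives of orders 0 and k + 1 are fetched
  -- afterwards.
  obtain ⟨k, hk⟩ := exists_integral_logDeriv_le N hr hr1 hs hT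
  obtain ⟨C₀, hC₀, h₀⟩ := hN 0
  obtain ⟨C₁, hC₁, h₁⟩ := hN (k + 1)
  set C : ℝ := 1 + n * (2 * Real.pi) ^ 2 * (C₀ + C₁) with hC
  have hpi : 0 ≤ n * (2 * Real.pi) ^ 2 := by positivity
  obtain ⟨K, hK, hb⟩ := hk C (by rw [hC]; nlinarith) τ hτ
  refine ⟨K, hK, fun ε hε ξ δ hδ => ?_⟩
  have ha : ∀ i, ContDiff ℝ ∞ (a ε i) := fun i => (H.moderate_a i).1 ε hε
  have hΛ : 0 ≤ Λ ε := zero_le_one.trans (H.one_le ε hε)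
  refine hb (Λ ε) (H.one_le ε hε) (1 + ‖ξ‖) (by linarith [norm_nonneg ξ])
    (fun t => principalSymbol (a ε) t ξ) (contDiff_principalSymbol ha ξ)
    (fun t ht => principalSymbol_nonneg (H.nonneg ε hε t) ξ) (fun t ht => ?_) (fun t ht => ?_) δ hδ
  · have h2 := abs_principalSymbol_le (t := t) (fun i => by simpa using h₀ ε hε t ht i) ξ
    refine (le_abs_self _).trans (h2.trans ?_)
    rw [← mul_assoc]
    gcongr
    rw [hC]
    nlinarith
  · have h2 := abs_principalSymbol_le (a := fun i => iteratedDeriv (k + 1) (a ε i)) (t := t)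
      (fun i => h₁ ε hε t ht i) ξ
    rw [iteratedDeriv_principalSymbol ha]
    refine h2.trans ?_
    push_cast
    rw [← mul_assoc]
    gcongr
    rw [hC]
    nlinarith

/-- The energy estimate: solutions of the Fourier transformed problem are tempered. -/
theorem IsTameSystem.isTemperedNet_solution (H : IsTameSystem T r Λ a c d e) (hr : 0 < r)
    (hr1 : r < 1) (hs : 1 ≤ s) (hT : 0 < T) (hγ : 0 < γ) {v w F : ℝ → ℝ → Space n → ℂ}
    (hv : ∀ ε ∈ Ioc (0 : ℝ) 1, ∀ ξ, ∀ t ∈ Icc 0 T,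
      HasDerivWithinAt (fun t => v ε t ξ) (w ε t ξ) (Icc 0 T) t)
    (hw : ∀ ε ∈ Ioc (0 : ℝ) 1, ∀ ξ, ∀ t ∈ Icc 0 T, HasDerivWithinAt (fun t => w ε t ξ)
      (F ε t ξ - spatialSymbol (a ε) (c ε) (e ε) t ξ * v ε t ξ - d ε t * w ε t ξ) (Icc 0 T) t)
    (hv₀ : IsTemperedNet T s γ (fun ε _ ξ => v ε 0 ξ))
    (hw₀ : IsTemperedNet T s γ (fun ε _ ξ => w ε 0 ξ)) (hF : IsTemperedNet T s γ F) :
    IsTemperedNet T s (γ / 2) v ∧ IsTemperedNet T s (γ / 2) w := by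
  -- In the exponent the term mT contributes τT Y^{1/s} and the variation τY^{1/s}; together exactly
  -- γY^{1/s}.
  set τ : ℝ := γ / (T + 1) with hτ
  have hτ0 : 0 < τ := by positivity
  obtain ⟨K, hK, hL⟩ := H.exists_integral_le hr hr1 hs hT hτ0
  obtain ⟨C, hC, hlevi⟩ := H.levi
  obtain ⟨p, N, B, hB, hFb⟩ := hF
  -- Since m ≥ Λ, the bound CΛ² on e is also CΛm; since m ≥ 1, the variation estimate applies with δ
  -- = m².
  let m : ℝ → Space n → ℝ := fun ε ξ => τ * (1 + ‖ξ‖) ^ (1 / s) + Λ ε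
  let Φ : ℝ → Space n → ℝ := fun ε ξ => B * ε⁻¹ ^ N * (1 + ‖ξ‖) ^ p * gevreyDecay s γ ξ
  have hΦ : IsTemperedNet T s γ (fun ε _ ξ => Φ ε ξ) := by
    refine ⟨p, N, B, hB, fun ε hε t ht ξ => (Real.norm_of_nonneg ?_).le⟩
    have := hε.1
    have := gevreyDecay_pos s γ ξ
    positivity
  have hm : IsTemperedNet T s 0 (fun ε _ ξ => m ε ξ) :=
    (isTemperedNet_gevreyWeight hs τ).add H.isTemperedNet_size
  have hAm : IsTemperedNet T s 0 (fun ε _ ξ => principalSymbol (a ε) 0 ξ + m ε ξ ^ 2) := by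
    refine ((isTemperedNet_principalSymbol H.moderate_a).at_zero hT.le).add ?_
    simpa only [sq] using hm.coeff_mul hm
  have hTΦ : IsTemperedNet T s (γ + γ) (fun ε _ ξ => T * Φ ε ξ ^ 2) := by
    refine (isTemperedNet_const T).coeff_mul ?_
    simpa only [Real.norm_eq_abs, sq_abs] using hΦ.norm_sq
  -- The loss has rate -γ and the squared data have rate 2γ. The rate γ remains for the squares,
  -- hence γ/2 for v and w.
  have htot := (H.isTemperedNet_loss (s := s) (γ := γ) (4 * C * T + T + K)).mul
    ((hw₀.norm_sq.add (hAm.coeff_mul hv₀.norm_sq)).add hTΦ)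
  rw [neg_add_cancel_left] at htot
  have hbound : ∀ ε ∈ Ioc (0 : ℝ) 1, ∀ t ∈ Icc 0 T, ∀ ξ, ‖v ε t ξ‖ ^ 2 + ‖w ε t ξ‖ ^ 2 ≤
      Real.exp (T + (4 * C * T + T + K) * Λ ε + γ * (1 + ‖ξ‖) ^ (1 / s)) *
        (‖w ε 0 ξ‖ ^ 2 + (principalSymbol (a ε) 0 ξ + m ε ξ ^ 2) * ‖v ε 0 ξ‖ ^ 2
          + T * Φ ε ξ ^ 2) := by
    intro ε hε t ht ξ
    have hΛ := H.one_le ε hε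
    have hΛ0 : 0 < Λ ε := by linarith
    have hY : 0 ≤ τ * (1 + ‖ξ‖) ^ (1 / s) := by positivity
    have hm1 : Λ ε ≤ m ε ξ := le_add_of_nonneg_left hY
    have hm2 : 1 ≤ m ε ξ ^ 2 := one_le_pow₀ (hΛ.trans hm1)
    have key := energy_estimate (T := T) (m := m ε ξ) (β := C * Λ ε) (Φ := Φ ε ξ)
      (L := K * Λ ε + τ * (1 + ‖ξ‖) ^ (1 / s))
      (contDiff_principalSymbol (fun i => (H.moderate_a i).1 ε hε) ξ)
      (fun t _ => principalSymbol_nonneg (H.nonneg ε hε t) ξ) (hv ε hε ξ)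
      (b := fun t => firstOrderSymbol (c ε) t ξ) (e := e ε) (d := d ε) (F := fun t => F ε t ξ)
      (fun t ht => (hw ε hε ξ t ht).congr_deriv (by rw [spatialSymbol]; ring))
      (hΛ.trans hm1) (by positivity) (fun t ht => (hlevi ε hε t ht).1 ξ)
      (fun t ht => (hlevi ε hε t ht).2.1.trans (by gcongr)) (fun t ht => (hlevi ε hε t ht).2.2)
      (fun t ht => hFb ε hε t ht ξ) (hL ε hε ξ _ hm2) t ht
    refine key.trans_eq ?_
    congr 2
    have e1 : γ = τ * (T + 1) := by rw [hτ, div_mul_cancel₀ _ (by positivity)]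
    rw [e1]
    simp only [m]
    ring
  exact ⟨htot.of_sq fun ε hε t ht ξ =>
      (le_add_of_nonneg_right (sq_nonneg _)).trans (hbound ε hε t ht ξ),
    htot.of_sq fun ε hε t ht ξ =>
      (le_add_of_nonneg_left (sq_nonneg _)).trans (hbound ε hε t ht ξ)⟩

/-- The Fourier transformed Cauchy problem has a moderate solution. -/
theorem IsTameSystem.exists_solution (H : IsTameSystem T r Λ a c d e) (hr : 0 < r)
    (hr1 : r < 1) (hs : 1 ≤ s) (hT : 0 < T) (hγ : 0 < γ) {F : ℝ → ℝ → Space n → ℂ}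
    {v₀ w₀ : ℝ → Space n → ℂ} (hv₀c : ∀ ε ∈ Ioc (0 : ℝ) 1, Continuous (v₀ ε))
    (hw₀c : ∀ ε ∈ Ioc (0 : ℝ) 1, Continuous (w₀ ε))
    (hFc : ∀ ε ∈ Ioc (0 : ℝ) 1, Continuous (Function.uncurry (F ε)))
    (hFs : ∀ ε ∈ Ioc (0 : ℝ) 1, ∀ ξ, ContDiffOn ℝ ∞ (fun t => F ε t ξ) (Icc 0 T))
    (hv₀ : IsTemperedNet T s γ (fun ε _ ξ => v₀ ε ξ))
    (hw₀ : IsTemperedNet T s γ (fun ε _ ξ => w₀ ε ξ))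
    (hF : ∀ k, IsTemperedNet T s γ
      (fun ε t ξ => iteratedDerivWithin k (fun t => F ε t ξ) (Icc 0 T) t)) :
    ∃ v w : ℝ → ℝ → Space n → ℂ, ∃ B : ℝ → ℕ → ℝ,
      (∀ ε ∈ Ioc (0 : ℝ) 1, IsGevreySymbol T s (γ / 2 / 2) (B ε) (v ε)) ∧
      (∀ k, ∃ N : ℕ, ∃ C > (0 : ℝ), ∀ ε ∈ Ioc (0 : ℝ) 1, B ε k ≤ C * ε⁻¹ ^ N) ∧
      ∀ ε ∈ Ioc (0 : ℝ) 1, (∀ ξ, v ε 0 ξ = v₀ ε ξ) ∧ (∀ ξ, w ε 0 ξ = w₀ ε ξ) ∧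
      (∀ ξ, ∀ t ∈ Icc 0 T, HasDerivWithinAt (fun t => v ε t ξ) (w ε t ξ) (Icc 0 T) t) ∧
      ∀ ξ, ∀ t ∈ Icc 0 T, HasDerivWithinAt (fun t => w ε t ξ)
        (F ε t ξ - spatialSymbol (a ε) (c ε) (e ε) t ξ * v ε t ξ - d ε t * w ε t ξ) (Icc 0 T) t := by
  have hex : ∀ ε, ∃ v w : ℝ → Space n → ℂ, ε ∈ Ioc (0 : ℝ) 1 →
      (∀ ξ, v 0 ξ = v₀ ε ξ) ∧ (∀ ξ, w 0 ξ = w₀ ε ξ) ∧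
      (∀ ξ, ∀ t ∈ Icc 0 T, HasDerivWithinAt (fun t => v t ξ) (w t ξ) (Icc 0 T) t) ∧
      (∀ ξ, ∀ t ∈ Icc 0 T, HasDerivWithinAt (fun t => w t ξ)
        (F ε t ξ - spatialSymbol (a ε) (c ε) (e ε) t ξ * v t ξ - d ε t * w t ξ) (Icc 0 T) t) ∧
      ∀ t ∈ Icc 0 T, StronglyMeasurable (v t) := by
    intro ε
    by_cases hε : ε ∈ Ioc (0 : ℝ) 1
    · obtain ⟨v, w, h⟩ := exists_second_order_solution hT.le
        (continuous_spatialSymbol (fun i => ((H.moderate_a i).1 ε hε).continuous)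
          (fun i => ((H.moderate_c i).1 ε hε).continuous) (H.moderate_e.1 ε hε).continuous)
        (hFc ε hε) (H.moderate_d.1 ε hε).continuous (hv₀c ε hε) (hw₀c ε hε)
      exact ⟨v, w, fun _ => h⟩
    · exact ⟨0, 0, fun h => absurd h hε⟩
  choose v w hvw using hex
  have hv0 : IsTemperedNet T s γ (fun ε _ ξ => v ε 0 ξ) :=
    hv₀.mono fun ε hε t _ ξ => by rw [(hvw ε hε).1]
  have hw0 : IsTemperedNet T s γ (fun ε _ ξ => w ε 0 ξ) :=
    hw₀.mono fun ε hε t _ ξ => by rw [(hvw ε hε).2.1]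
  have hF0 : IsTemperedNet T s γ F := by simpa using hF 0
  obtain ⟨htv, htw⟩ := H.isTemperedNet_solution hr hr1 hs hT hγ
    (fun ε hε => (hvw ε hε).2.2.1) (fun ε hε => (hvw ε hε).2.2.2.1) hv0 hw0 hF0
  have hq := isSmoothTempered_spatialSymbol (T := T) (s := s) H.moderate_a H.moderate_c H.moderate_e
  have hd := H.moderate_d.isSmoothTempered (n := n) (T := T) (s := s)
  have hder := isTemperedNet_iteratedDerivWithin_of_second_order hT
    (fun ε hε ξ => hq.contDiff ε hε ξ) (fun ε hε ξ => hd.contDiff ε hε ξ) hFs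
    (fun ε hε => (hvw ε hε).2.2.1) (fun ε hε => (hvw ε hε).2.2.2.1)
    (fun k => hq.iteratedDerivWithin hT k) (fun k => hd.iteratedDerivWithin hT k)
    (fun k => (hF k).weaken (by linarith)) htv htw
  -- Absorbing the powers of 1 + |ξ| halves the rate once more, whatever k is, so all time
  -- derivatives share the rate γ/4.
  choose N C hC hb using fun k => (hder k).exists_bound hs (half_pos hγ)
  refine ⟨v, w, fun ε k => C k * ε⁻¹ ^ N k, fun ε hε => ⟨fun ξ => ?_, fun t ht => ?_, fun k t ht ξ =>
    hb k ε hε t ht ξ⟩, fun k => ⟨N k, C k, hC k, fun ε _ => le_rfl⟩, fun ε hε =>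
    ⟨(hvw ε hε).1, (hvw ε hε).2.1, (hvw ε hε).2.2.1, (hvw ε hε).2.2.2.1⟩⟩
  · exact (contDiffOn_of_second_order hT (hq.contDiff ε hε ξ) (hd.contDiff ε hε ξ) (hFs ε hε ξ)
      ((hvw ε hε).2.2.1 ξ) ((hvw ε hε).2.2.2.1 ξ)).1
  · exact ((hvw ε hε).2.2.2.2 t ht).aestronglyMeasurable

end Energy

/-! ### From symbols to solutions of the Cauchy problem -/

section Linearity

variable {n : ℕ}

theorem synth_add {u v : Space n → ℂ} (hu : Integrable u) (hv : Integrable v) (x : Space n) :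
    synth (fun ξ => u ξ + v ξ) x = synth u x + synth v x := by
  simp only [synth, mul_add]
  exact integral_add (integrable_wave_mul hu x) (integrable_wave_mul hv x)

theorem synth_const_mul (c : ℂ) (u : Space n → ℂ) (x : Space n) :
    synth (fun ξ => c * u ξ) x = c * synth u x := by
  simp only [synth, mul_left_comm _ c]
  exact integral_const_mul c _

theorem synth_sum {ι : Type*} (S : Finset ι) {u : ι → Space n → ℂ} (hu : ∀ i ∈ S, Integrable (u i))
    (x : Space n) : synth (fun ξ => ∑ i ∈ S, u i ξ) x = ∑ i ∈ S, synth (u i) x := by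
  simp only [synth, Finset.mul_sum]
  exact integral_finsetSum _ fun i hi => integrable_wave_mul (hu i hi) x

end Linearity

/-- Synthesis intertwines ∂_t with the time derivative of the symbol and ∂_{x_i} with multiplication
by `freq i`. The equation for u is the synthesis of the equation for v, split by linearity, for
which each term must be integrable separately. -/
theorem solvesCauchyProblem_synth {n : ℕ} {T s γ : ℝ} (hT : 0 < T) (hs : 1 ≤ s) (hγ : 0 < γ)
    {a : Fin n → ℝ → ℝ} {c : Fin n → ℝ → ℂ} {d e : ℝ → ℂ} {F v w : ℝ → Space n → ℂ} {B : ℕ → ℝ}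
    (hsym : IsGevreySymbol T s γ B v)
    (hv : ∀ ξ, ∀ t ∈ Icc 0 T, HasDerivWithinAt (fun t => v t ξ) (w t ξ) (Icc 0 T) t)
    (hw : ∀ ξ, ∀ t ∈ Icc 0 T, HasDerivWithinAt (fun t => w t ξ)
      (F t ξ - spatialSymbol a c e t ξ * v t ξ - d t * w t ξ) (Icc 0 T) t) :
    SolvesCauchyProblem T a c d e (fun t => synth (F t)) (synth (v 0)) (synth (w 0))
      (fun t => synth (v t)) := by
  have hU := uniqueDiffOn_Icc hT
  have e1 : ∀ t ∈ Icc 0 T, ∀ ξ, derivWithin (fun t => v t ξ) (Icc 0 T) t = w t ξ :=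
    fun t ht ξ => (hv ξ t ht).derivWithin (hU t ht)
  have e2 : ∀ t ∈ Icc 0 T, ∀ ξ, iteratedDerivWithin 2 (fun t => v t ξ) (Icc 0 T) t =
      F t ξ - spatialSymbol a c e t ξ * v t ξ - d t * w t ξ := by
    intro t ht ξ
    rw [iteratedDerivWithin_succ', iteratedDerivWithin_congr (fun t ht => e1 t ht ξ) ht,
      iteratedDerivWithin_one, (hw ξ t ht).derivWithin (hU t ht)]
  have d1 : ∀ t ∈ Icc 0 T, ∀ x, derivWithin (fun τ => synth (v τ) x) (Icc 0 T) t
      = synth (w t) x := by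
    intro t ht x
    rw [(hasDerivWithinAt_synth hsym hT hs hγ ht x).derivWithin (hU t ht)]
    simp only [e1 t ht]
  refine ⟨fun t ht x => ?_, fun x => rfl, fun x => d1 0 ⟨le_rfl, hT.le⟩ x⟩
  have hdec := hsym.hasGevreyDecay ht
  choose B₁ hB₁ using fun i => hdec.freq_mul hs hγ i
  choose B₂ hB₂ using fun i => (hB₁ i).freq_mul hs (half_pos hγ) i
  have i0 : Integrable (v t) := hdec.integrable hs hγ
  have i1 : ∀ i, Integrable fun ξ => freq i ξ * v t ξ := fun i =>
    (hB₁ i).integrable hs (half_pos hγ)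
  have i2 : ∀ i, Integrable fun ξ => freq i ξ * (freq i ξ * v t ξ) := fun i =>
    (hB₂ i).integrable hs (half_pos (half_pos hγ))
  have iw : Integrable (w t) := by
    have h := (hsym.derivWithin hT).integrable hs hγ ht
    simpa only [e1 t ht] using h
  have i3 : Integrable fun ξ => iteratedDerivWithin 2 (fun t => v t ξ) (Icc 0 T) t :=
    (hsym.iteratedDerivWithin hT 2).integrable hs hγ ht
  have p1 : ∀ i, pderiv i (synth (v t)) = synth fun ξ => freq i ξ * v t ξ := fun i =>
    hdec.pderiv_synth hs hγ i
  have p2 : ∀ i, pderiv i (pderiv i (synth (v t))) = synth fun ξ => freq i ξ * (freq i ξ * v t ξ) :=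
    fun i => by rw [p1, (hB₁ i).pderiv_synth hs (half_pos hγ) i]
  -- The bracketing matches the nested integrability statements used to split the synthesis.
  have hF : F t = fun ξ => iteratedDerivWithin 2 (fun t => v t ξ) (Icc 0 T) t
      + (∑ i, -(a i t : ℂ) * (freq i ξ * (freq i ξ * v t ξ))
        + (∑ i, c i t * (freq i ξ * v t ξ) + (d t * w t ξ + e t * v t ξ))) := by
    ext ξ
    have h1 : ∑ i, -(a i t : ℂ) * (freq i ξ * (freq i ξ * v t ξ))
        = principalSymbol a t ξ * v t ξ := by
      rw [coe_principalSymbol, Finset.sum_mul]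
      exact Finset.sum_congr rfl fun i _ => by ring
    have h2 : ∑ i, c i t * (freq i ξ * v t ξ) = firstOrderSymbol c t ξ * v t ξ := by
      rw [firstOrderSymbol, Finset.sum_mul]
      exact Finset.sum_congr rfl fun i _ => by ring
    rw [e2 t ht, h1, h2, spatialSymbol]
    ring
  have j1 : Integrable fun ξ => ∑ i, -(a i t : ℂ) * (freq i ξ * (freq i ξ * v t ξ)) :=
    integrable_finsetSum _ fun i _ => (i2 i).const_mul _
  have j2 : Integrable fun ξ => ∑ i, c i t * (freq i ξ * v t ξ) :=
    integrable_finsetSum _ fun i _ => (i1 i).const_mul _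
  have j3 : Integrable fun ξ => d t * w t ξ + e t * v t ξ :=
    (iw.const_mul _).add (i0.const_mul _)
  have j4 : Integrable fun ξ => ∑ i, c i t * (freq i ξ * v t ξ) + (d t * w t ξ + e t * v t ξ) :=
    j2.add j3
  have j5 : Integrable fun ξ => ∑ i, -(a i t : ℂ) * (freq i ξ * (freq i ξ * v t ξ))
      + (∑ i, c i t * (freq i ξ * v t ξ) + (d t * w t ξ + e t * v t ξ)) := j1.add j4
  have hsF : synth (F t) x = iteratedDerivWithin 2 (fun τ => synth (v τ) x) (Icc 0 T) t
      + (∑ i, -(a i t : ℂ) * pderiv i (pderiv i (synth (v t))) x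
        + (∑ i, c i t * pderiv i (synth (v t)) x
          + (d t * derivWithin (fun τ => synth (v τ) x) (Icc 0 T) t + e t * synth (v t) x))) := by
    rw [hF, synth_add i3 j5, synth_add j1 j4, synth_add j2 j3,
      synth_add (iw.const_mul _) (i0.const_mul _), synth_sum _ fun i _ => (i2 i).const_mul _,
      synth_sum _ fun i _ => (i1 i).const_mul _, iteratedDerivWithin_synth hsym hT hs hγ 2 ht,
      d1 t ht]
    simp only [synth_const_mul, p2]
    simp only [p1]
  refine Eq.trans ?_ hsF.symm
  simp only [neg_mul, Finset.sum_neg_distrib]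
  ring

/-! ### Coefficients regularised at logarithmic scales -/

theorem HasGevreyDecay.weaken {n : ℕ} {s γ γ' B : ℝ} {w : Space n → ℂ}
    (hw : HasGevreyDecay s γ B w) (h : γ' ≤ γ) : HasGevreyDecay s γ' B w := by
  refine ⟨hw.measurable, fun ξ => (hw.bound ξ).trans ?_⟩
  have := hw.nonneg
  rw [gevreyDecay, gevreyDecay]
  gcongr

theorem isTemperedNet_of_hasGevreyDecay {n : ℕ} {T s γ B : ℝ} {v : ℝ → Space n → ℂ}
    (hv : ∀ ε ∈ Ioc (0 : ℝ) 1, HasGevreyDecay s γ B (v ε)) :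
    IsTemperedNet T s γ (fun ε _ ξ => v ε ξ) := by
  refine ⟨0, 0, |B| + 1, by positivity, fun ε hε t _ ξ => ((hv ε hε).bound ξ).trans ?_⟩
  have := (gevreyDecay_pos s γ ξ).le
  simp only [pow_zero, mul_one]
  gcongr
  linarith [le_abs_self B]

/-- The inverse of a logarithmic scale is eventually a power of the logarithm. -/
theorem IsLogScale.eventually_inv_eq {r : ℝ} {μ : ℝ → ℝ} (hμ : IsLogScale r μ) :
    ∃ κ > (0 : ℝ), ∀ᶠ ε in 𝓝[>] (0 : ℝ), (μ ε)⁻¹ = κ * Real.log ε⁻¹ ^ r := by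
  obtain ⟨-, κ, hκ, h⟩ := hμ
  exact ⟨κ, hκ, h.mono fun ε hε => by rw [hε, inv_inv]⟩

/-- Bounds for a regularised distribution in terms of the logarithmic size. -/
theorem exists_iteratedDeriv_mollify_le {F : Type*} [NormedAddCommGroup F] [NormedSpace ℝ F]
    {ι : Type*} [Fintype ι] (v : ι → 𝓓'((⊤ : TopologicalSpace.Opens ℝ), F))
    (ψ : 𝓓((⊤ : TopologicalSpace.Opens ℝ), ℝ)) {T r κ M : ℝ} (hr : 0 ≤ r) (hκ : 0 < κ)
    {μ Λ : ℝ → ℝ} (hΛ : ∀ ε ∈ Ioc (0 : ℝ) 1, 1 ≤ Λ ε)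
    (hμ : ∀ ε ∈ Ioc (0 : ℝ) 1, 0 < μ ε ∧ μ ε ≤ M ∧ (μ ε)⁻¹ = κ * Λ ε ^ r) :
    ∃ N : ℕ, ∀ k : ℕ, ∃ C > (0 : ℝ), ∀ ε ∈ Ioc (0 : ℝ) 1, ∀ t ∈ Icc 0 T, ∀ i,
      ‖iteratedDeriv k (mollify ψ (μ ε) (v i)) t‖ ≤ C * Λ ε ^ (r * (N + k)) := by
  choose N hN using fun i => exists_norm_mollify_le (v i) ψ M (isCompact_Icc (a := 0) (b := T))
  refine ⟨∑ i, N i, fun k => ?_⟩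
  choose C hC hb using fun i => hN i k
  refine ⟨∑ i, C i * κ ^ (N i + k) + 1, ?_, fun ε hε t ht i => ?_⟩
  · have : 0 ≤ ∑ i, C i * κ ^ (N i + k) :=
      Finset.sum_nonneg fun i _ => (mul_pos (hC i) (pow_pos hκ _)).le
    linarith
  obtain ⟨h0, hM, hinv⟩ := hμ ε hε
  have hΛ1 := hΛ ε hε
  have hΛ0 : 0 ≤ Λ ε := by linarith
  have h1 : (Λ ε ^ r) ^ (N i + k) ≤ Λ ε ^ (r * ((∑ i, N i : ℕ) + k)) := by
    rw [← Real.rpow_natCast, ← Real.rpow_mul hΛ0]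
    refine Real.rpow_le_rpow_of_exponent_le hΛ1 (mul_le_mul_of_nonneg_left ?_ hr)
    have : N i ≤ ∑ i, N i := Finset.single_le_sum (fun _ _ => Nat.zero_le _) (Finset.mem_univ i)
    exact_mod_cast Nat.add_le_add_right this k
  refine (hb i _ h0 hM t ht).trans ?_
  have h2 : C i * κ ^ (N i + k) ≤ ∑ i, C i * κ ^ (N i + k) + 1 :=
    (Finset.single_le_sum (f := fun i => C i * κ ^ (N i + k))
      (fun i _ => (mul_pos (hC i) (pow_pos hκ _)).le) (Finset.mem_univ i)).trans (by linarith)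
  rw [hinv, mul_pow, ← mul_assoc]
  exact mul_le_mul h2 h1 (by positivity) ((mul_pos (hC i) (pow_pos hκ _)).le.trans h2)

theorem le_sqrt_mul_of_sq_le {x y S : ℝ} (hy : 0 ≤ y) (h : x ^ 2 ≤ S * y ^ 2) :
    x ≤ √S * y := by
  have h1 := Real.le_sqrt_of_sq_le h
  rwa [Real.sqrt_mul' _ (sq_nonneg y), Real.sqrt_sq hy] at h1

/-- Along a suitable reparametrisation, coefficients regularised at logarithmic scales form a
system with polynomial loss. -/
theorem exists_isTameSystem {n : ℕ} (hn : 0 < n) {T r θ : ℝ} (hr : 0 < r) (hθ : 0 < θ)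
    (hθ1 : θ ≤ 1) (hθr : θ * r < 1)
    {a : Fin n → 𝓓'((⊤ : TopologicalSpace.Opens ℝ), ℝ)}
    (ha : ∀ i, ∀ η : 𝓓((⊤ : TopologicalSpace.Opens ℝ), ℝ), (∀ t, 0 ≤ η t) → 0 ≤ a i η)
    (c : Fin n → 𝓓'((⊤ : TopologicalSpace.Opens ℝ), ℂ))
    (d e : 𝓓'((⊤ : TopologicalSpace.Opens ℝ), ℂ))
    {ψ : 𝓓((⊤ : TopologicalSpace.Opens ℝ), ℝ)} (hψ : ∀ t, 0 ≤ ψ t)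
    {rc rd re : ℝ} {μ νc νd νe : ℝ → ℝ} (hμ : IsLogScale r μ)
    (hνc : IsLogScale rc νc) (hνd : IsLogScale rd νd) (hνe : IsLogScale re νe)
    (hLevi : LeviConditions T (fun ε i => mollify ψ (μ ε) (a i))
      (fun ε i => mollify ψ (νc ε) (c i)) (fun ε => mollify ψ (νd ε) d)
      (fun ε => mollify ψ (νe ε) e)) :
    ∃ ε₀ : ℝ, 0 < ε₀ ∧ ε₀ ≤ Real.exp (-1) ∧ IsTameSystem T (θ * r) (logSize ε₀)
      (fun ε i => mollify ψ (μ (reparam ε₀ θ ε)) (a i))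
      (fun ε i => mollify ψ (νc (reparam ε₀ θ ε)) (c i))
      (fun ε => mollify ψ (νd (reparam ε₀ θ ε)) d)
      (fun ε => mollify ψ (νe (reparam ε₀ θ ε)) e) := by
  obtain ⟨κ, hκ, hκev⟩ := hμ.eventually_inv_eq
  obtain ⟨c₁, hc₁, c₂, hc₂, R, hR, hev⟩ := hLevi
  obtain ⟨ε₀, h₀, h₁, hall⟩ := exists_forall_reparam (hκev.and hev) hθ
  refine ⟨ε₀, h₀, h₁, ?_⟩
  have hmem : ∀ ε ∈ Ioc (0 : ℝ) 1, reparam ε₀ θ ε ∈ Ioc (0 : ℝ) 1 :=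
    fun ε hε => reparam_mem h₀ h₁ hε.1
  have hone : ∀ ε ∈ Ioc (0 : ℝ) 1, 1 ≤ logSize ε₀ ε := fun ε hε => one_le_logSize h₀ h₁ hε.1
  obtain ⟨p, -, M, -, c', -, hM⟩ := hμ.1.1
  have hμb : ∀ ε ∈ Ioc (0 : ℝ) 1, 0 < μ (reparam ε₀ θ ε) ∧ μ (reparam ε₀ θ ε) ≤ M ∧
      (μ (reparam ε₀ θ ε))⁻¹ = κ * logSize ε₀ ε ^ (θ * r) := fun ε hε => by
    refine ⟨hμ.1.pos (hmem ε hε), (hM _ (hmem ε hε)).2, ?_⟩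
    rw [(hall ε hε.1).1, log_inv_reparam, Real.rpow_mul (zero_le_one.trans (hone ε hε))]
  -- One coefficient suffices to bound e, and n > 0 provides it.
  obtain ⟨C₀, hC₀, hb₀⟩ := exists_mollify_le_of_nonneg (ha ⟨0, hn⟩) ψ M
    (isCompact_Icc (a := 0) (b := T))
  refine ⟨fun i => isModerate_mollify (a i) ψ (hμ.comp_reparam h₀ h₁ hθ hθ1).1,
    fun i => isModerate_mollify (c i) ψ (hνc.comp_reparam h₀ h₁ hθ hθ1).1,
    isModerate_mollify d ψ (hνd.comp_reparam h₀ h₁ hθ hθ1).1,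
    isModerate_mollify e ψ (hνe.comp_reparam h₀ h₁ hθ hθ1).1, hone,
    ⟨ε₀⁻¹, inv_pos.2 h₀, fun ε hε => exp_logSize_le h₀
      (h₁.trans (Real.exp_le_one_iff.2 (by norm_num))) hε⟩,
    fun ε hε t i => mollify_nonneg (ha i) hψ (hμb ε hε).1 t,
    exists_iteratedDeriv_mollify_le a ψ (by positivity) hκ hone hμb,
    √(2 * c₁) + √(2 * c₁ * R ^ 2 * (C₀ * κ)) + √c₂, by positivity, fun ε hε t ht => ?_⟩
  obtain ⟨hL1, hL2⟩ := (hall ε hε.1).2 t ht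
  rw [log_inv_reparam] at hL1 hL2
  set Λ := logSize ε₀ ε with hΛ
  have hΛ1 : 1 ≤ Λ := hone ε hε
  have hΛ0 : 0 ≤ Λ := by linarith
  -- After the change of parameter the Levi conditions hold with Λ^θ, which Λ ≥ 1 dominates.
  have hΛθ : (Λ ^ θ) ^ 2 ≤ Λ ^ 2 :=
    pow_le_pow_left₀ (Real.rpow_nonneg hΛ0 _) (logSize_rpow_le h₀ h₁ hθ1 hε.1) 2
  have hanon : ∀ i, 0 ≤ mollify ψ (μ (reparam ε₀ θ ε)) (a i) t := fun i =>
    mollify_nonneg (ha i) hψ (hμb ε hε).1 t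
  have s1 := Real.sqrt_nonneg (2 * c₁)
  have s2 := Real.sqrt_nonneg (2 * c₁ * R ^ 2 * (C₀ * κ))
  have s3 := Real.sqrt_nonneg c₂
  refine ⟨fun ξ => ?_, ?_, ?_⟩
  · have h1 := norm_firstOrderSymbol_sq_le (a := fun i => mollify ψ (μ (reparam ε₀ θ ε)) (a i))
      (c := fun i => mollify ψ (νc (reparam ε₀ θ ε)) (c i)) hR hL1 ξ
    have hA := principalSymbol_nonneg hanon ξ
    refine (le_sqrt_mul_of_sq_le (S := 2 * c₁)
      (y := Λ * √(principalSymbol (fun i => mollify ψ (μ (reparam ε₀ θ ε)) (a i)) t ξ))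
      (by positivity) (h1.trans ?_)).trans ?_
    · rw [mul_pow, Real.sq_sqrt hA, ← mul_assoc, ← mul_assoc]
      gcongr
    · rw [← mul_assoc]
      gcongr
      linarith
  · have h1 := norm_zeroOrder_sq_le (a := fun i => mollify ψ (μ (reparam ε₀ θ ε)) (a i))
      (c := fun i => mollify ψ (νc (reparam ε₀ θ ε)) (c i)) hR hL1 ⟨0, hn⟩
    have h2 := hb₀ _ (hμb ε hε).1 (hμb ε hε).2.1 t ht
    rw [(hμb ε hε).2.2] at h2
    -- Together with the Levi factor Λ² this gives ‖e‖² = O(Λ⁴), that is ‖e‖ = O(Λ·Λ).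
    have h3 : Λ ^ (θ * r) ≤ Λ ^ 2 := by
      rw [← Real.rpow_natCast]
      exact Real.rpow_le_rpow_of_exponent_le hΛ1 (by push_cast; linarith)
    refine (le_sqrt_mul_of_sq_le (S := 2 * c₁ * R ^ 2 * (C₀ * κ)) (y := Λ * Λ)
      (by positivity) (h1.trans ?_)).trans ?_
    · calc 2 * (c₁ * (Λ ^ θ) ^ 2) * R ^ 2 * mollify ψ (μ (reparam ε₀ θ ε)) (a ⟨0, hn⟩) t
          ≤ 2 * (c₁ * Λ ^ 2) * R ^ 2 * (C₀ * (κ * Λ ^ 2)) := by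
            have := hanon ⟨0, hn⟩
            gcongr
            exact h2.trans (by gcongr)
        _ = _ := by ring
    · rw [← mul_assoc]
      gcongr
      linarith
  · refine (le_sqrt_mul_of_sq_le (S := c₂) hΛ0 (hL2.trans (by gcongr))).trans ?_
    gcongr
    linarith

/-! ### Symbols of the regularised source and data -/

/-- Regularised right-hand sides have moderate symbols. -/
theorem exists_sourceSymbol_le {n : ℕ} {T s γ B : ℝ} (hn : 0 < n) (hs : 1 ≤ s) (hT : 0 < T)
    {f : ℝ → Space n → ℂ} (hf : IsContinuousGevreyCompact s T f)
    (ψ : 𝓓((⊤ : TopologicalSpace.Opens ℝ), ℝ)) (φ : 𝓢(Space n, ℂ)) {ρ : ℝ → ℝ}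
    (hρ : IsPositiveNet ρ) (hB : 0 ≤ B) (hd : ∀ t ∈ Icc 0 T, HasGevreyDecay s γ B (𝓕 (f t))) :
    ∃ D : ℝ → ℕ → ℝ,
      (∀ ε ∈ Ioc (0 : ℝ) 1, IsGevreySymbol T s γ (D ε) (sourceSymbol T ψ φ (ρ ε) f)) ∧
      ∀ k, ∃ N : ℕ, ∃ C > (0 : ℝ), ∀ ε ∈ Ioc (0 : ℝ) 1, D ε k ≤ C * ε⁻¹ ^ N := by
  refine ⟨_, fun ε hε => isGevreySymbol_sourceSymbol hn hs hT hf ψ.contDiff ψ.hasCompactSupport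
    (hρ.pos hε) hd, fun k => ?_⟩
  obtain ⟨N, C, hC, hinv⟩ := hρ.exists_inv_le
  have h1 : 0 ≤ ∫ x, ‖φ x‖ := integral_nonneg fun _ => norm_nonneg _
  have h2 : 0 ≤ ∫ τ, |iteratedDeriv k ψ τ| := integral_nonneg fun _ => abs_nonneg _
  refine ⟨N * k, (∫ x, ‖φ x‖) * B * (C ^ k * ∫ τ, |iteratedDeriv k ψ τ|) + 1, by positivity,
    fun ε hε => ?_⟩
  have hε0 := hε.1
  have h3 : (ρ ε)⁻¹ ^ k ≤ C ^ k * ε⁻¹ ^ (N * k) := by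
    rw [pow_mul, ← mul_pow]
    exact pow_le_pow_left₀ (inv_nonneg.2 (hρ.pos hε).le) (hinv ε hε) k
  calc (∫ x, ‖φ x‖) * B * ((ρ ε)⁻¹ ^ k * ∫ τ, |iteratedDeriv k ψ τ|)
      ≤ (∫ x, ‖φ x‖) * B * (C ^ k * ε⁻¹ ^ (N * k) * ∫ τ, |iteratedDeriv k ψ τ|) := by gcongr
    _ = (∫ x, ‖φ x‖) * B * (C ^ k * ∫ τ, |iteratedDeriv k ψ τ|) * ε⁻¹ ^ (N * k) := by ring
    _ ≤ _ := by gcongr; linarith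

theorem IsGevreySymbol.isTemperedNet {n : ℕ} {T s γ : ℝ} {D : ℝ → ℕ → ℝ}
    {F : ℝ → ℝ → Space n → ℂ} (hF : ∀ ε ∈ Ioc (0 : ℝ) 1, IsGevreySymbol T s γ (D ε) (F ε))
    (hD : ∀ k, ∃ N : ℕ, ∃ C > (0 : ℝ), ∀ ε ∈ Ioc (0 : ℝ) 1, D ε k ≤ C * ε⁻¹ ^ N) (k : ℕ) :
    IsTemperedNet T s γ
      (fun ε t ξ => _root_.iteratedDerivWithin k (fun t => F ε t ξ) (Icc 0 T) t) := by
  obtain ⟨N, C, hC, h⟩ := hD k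
  refine ⟨0, N, C, hC, fun ε hε t ht ξ => ((hF ε hε).bound k t ht ξ).trans ?_⟩
  rw [pow_zero, mul_one]
  exact mul_le_mul_of_nonneg_right (h ε hε) (gevreyDecay_pos s γ ξ).le

/-- Regularised compactly supported Gevrey functions, in terms of their symbols. -/
theorem IsGevreyCompact.exists_mollifyData_eq {n : ℕ} (hn : 0 < n) {s : ℝ} (hs : 1 ≤ s)
    {g : Space n → ℂ} (hg : IsGevreyCompact s g) (φ : 𝓢(Space n, ℂ)) {ρ : ℝ → ℝ}
    (hρ : IsPositiveNet ρ) : ∃ γ > 0, ∃ B, ∃ v : ℝ → Space n → ℂ,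
      ∀ ε ∈ Ioc (0 : ℝ) 1, Continuous (v ε) ∧ HasGevreyDecay s γ B (v ε) ∧
        mollifyData φ (ρ ε) g = synth (v ε) := by
  obtain ⟨γ, hγ, B, hB⟩ := hg.exists_decay hn hs
  have hgc : Continuous g := hg.1.1.continuous
  have hgi : Integrable g := hgc.integrable_of_hasCompactSupport hg.2
  refine ⟨γ, hγ, B * ∫ x, ‖φ x‖, fun ε ξ => 𝓕 g ξ * 𝓕 (scaled φ (ρ ε)) ξ, fun ε hε => ⟨?_, ?_,
    mollifyData_eq_synth hs hγ φ (hρ.pos hε) hgc hgi hB⟩⟩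
  · exact (continuous_fourier hgi).mul (continuous_fourier (integrable_scaled φ (hρ.pos hε)))
  · exact hB.mul (continuous_fourier (integrable_scaled φ (hρ.pos hε)))
      (norm_fourier_scaled_le φ (hρ.pos hε))

theorem IsSmoothGevreyModerate.congr {n : ℕ} {s T : ℝ} {u v : ℝ → ℝ → Space n → ℂ}
    (hu : IsSmoothGevreyModerate s T u) (h : ∀ ε ∈ Ioc (0 : ℝ) 1, v ε = u ε) :
    IsSmoothGevreyModerate s T v := by
  refine ⟨fun ε hε => by simpa only [h ε hε] using hu.1 ε hε, fun K hK => ?_⟩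
  obtain ⟨N, C, hC, hb⟩ := hu.2 K hK
  refine ⟨N, C, hC, fun k => ?_⟩
  obtain ⟨Nk, Ck, hCk, hk⟩ := hb k
  exact ⟨Nk, Ck, hCk, fun α t ht x hx ε hε => by simpa only [h ε hε] using hk α t ht x hx ε hε⟩

theorem IsGevreyModerate.congr {n : ℕ} {s : ℝ} {u v : ℝ → Space n → ℂ}
    (hu : IsGevreyModerate s u) (h : ∀ ε ∈ Ioc (0 : ℝ) 1, v ε = u ε) :
    IsGevreyModerate s v := by
  refine ⟨fun ε hε => by simpa only [h ε hε] using hu.1 ε hε, fun K hK => ?_⟩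
  obtain ⟨C, hC, N, hb⟩ := hu.2 K hK
  exact ⟨C, hC, N, fun α x hx ε hε => by simpa only [h ε hε] using hb α x hx ε hε⟩

end VeryWeakWave

end

/-! ### Existence of the very weak solution -/

open VeryWeakWave in
theorem mainTheorem1 {n : ℕ} (hn : 0 < n) {s T : ℝ} (hs : 1 ≤ s) (hT : 0 < T)
    -- the coefficients: distributions on the line with support in `[0,T]`, with `a_i ≥ 0`
    (a : Fin n → 𝓓'((⊤ : TopologicalSpace.Opens ℝ), ℝ))
    (c : Fin n → 𝓓'((⊤ : TopologicalSpace.Opens ℝ), ℂ))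
    (d e : 𝓓'((⊤ : TopologicalSpace.Opens ℝ), ℂ))
    (ha_supp : ∀ i, Distribution.dsupport (a i) ⊆ Icc 0 T)
    (hc_supp : ∀ i, Distribution.dsupport (c i) ⊆ Icc 0 T)
    (hd_supp : Distribution.dsupport d ⊆ Icc 0 T)
    (he_supp : Distribution.dsupport e ⊆ Icc 0 T)
    (ha : ∀ i, ∀ η : 𝓓((⊤ : TopologicalSpace.Opens ℝ), ℝ), (∀ t, 0 ≤ η t) → 0 ≤ a i η)
    -- the right-hand side and the initial data
    (f : ℝ → VeryWeakWave.Space n → ℂ) (hf : VeryWeakWave.IsContinuousGevreyCompact s T f)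
    (g₀ g₁ : VeryWeakWave.Space n → ℂ) (hg₀ : VeryWeakWave.IsGevreyCompact s g₀)
    (hg₁ : VeryWeakWave.IsGevreyCompact s g₁)
    -- the mollifiers, and the scale at which the right-hand side and the data are regularised
    (ψ : 𝓓((⊤ : TopologicalSpace.Opens ℝ), ℝ)) (hψ : VeryWeakWave.IsFriedrichsMollifier ψ)
    (φ : 𝓢(VeryWeakWave.Space n, ℂ)) (hφ : VeryWeakWave.IsMomentMollifier φ)
    (ρ : ℝ → ℝ) (hρ : VeryWeakWave.IsPositiveNet ρ)
    -- logarithmic scales for the coefficients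
    {r rc rd re : ℝ} (hr : 0 < r) (hrc : 0 < rc) (hrd : 0 < rd) (hre : 0 < re)
    (μ νc νd νe : ℝ → ℝ) (hμ : VeryWeakWave.IsLogScale r μ)
    (hνc : VeryWeakWave.IsLogScale rc νc) (hνd : VeryWeakWave.IsLogScale rd νd)
    (hνe : VeryWeakWave.IsLogScale re νe)
    (hLevi : VeryWeakWave.LeviConditions T
      (fun ε i => VeryWeakWave.mollify ψ (μ ε) (a i))
      (fun ε i => VeryWeakWave.mollify ψ (νc ε) (c i))
      (fun ε => VeryWeakWave.mollify ψ (νd ε) d)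
      (fun ε => VeryWeakWave.mollify ψ (νe ε) e)) :
    -- the same regularisations of the coefficients, up to the change of parameter `ε ↦ h ε`,
    -- which for small `ε` is the identity if `r < 1`
    ∃ θ : ℝ, 0 < θ ∧ θ ≤ 1 ∧ (r < 1 → θ = 1) ∧
    ∃ h : ℝ → ℝ, (∀ ε ∈ Ioc (0 : ℝ) 1, h ε ∈ Ioc (0 : ℝ) 1) ∧
      (∀ᶠ ε in 𝓝[>] (0 : ℝ), h ε = Real.exp (-(Real.log ε⁻¹ ^ θ))) ∧
      VeryWeakWave.IsLogScale (θ * r) (μ ∘ h) ∧ VeryWeakWave.IsLogScale (θ * rc) (νc ∘ h) ∧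
      VeryWeakWave.IsLogScale (θ * rd) (νd ∘ h) ∧ VeryWeakWave.IsLogScale (θ * re) (νe ∘ h) ∧
      ∃ u : ℝ → ℝ → VeryWeakWave.Space n → ℂ,
        VeryWeakWave.IsVeryWeakSolution s T
          (fun ε i => VeryWeakWave.mollify ψ (μ (h ε)) (a i))
          (fun ε i => VeryWeakWave.mollify ψ (νc (h ε)) (c i))
          (fun ε => VeryWeakWave.mollify ψ (νd (h ε)) d)
          (fun ε => VeryWeakWave.mollify ψ (νe (h ε)) e)
          (fun ε => VeryWeakWave.mollifySource T ψ φ (ρ ε) f)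
          (fun ε => VeryWeakWave.mollifyData φ (ρ ε) g₀)
          (fun ε => VeryWeakWave.mollifyData φ (ρ ε) g₁)
          u := by
  obtain ⟨θ, hθ, hθ1, hθr1, hθr⟩ : ∃ θ : ℝ, 0 < θ ∧ θ ≤ 1 ∧ (r < 1 → θ = 1) ∧ θ * r < 1 := by
    rcases lt_or_ge r 1 with h | h
    · exact ⟨1, one_pos, le_rfl, fun _ => rfl, by linarith⟩
    -- Any θ < 1/r would do; this one gives θr = 1/2.
    · refine ⟨1 / (2 * r), by positivity, ?_, fun h' => absurd h' (not_lt.2 h), ?_⟩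
      · rw [div_le_one (by positivity)]
        linarith
      · rw [div_mul_eq_mul_div, one_mul, div_lt_one (by positivity)]
        linarith
  obtain ⟨ε₀, h₀, h₁, H⟩ := exists_isTameSystem hn hr hθ hθ1 hθr ha c d e hψ.1 hμ hνc hνd hνe hLevi
  obtain ⟨γ₀, hγ₀, B₀, v₀, hv₀⟩ := hg₀.exists_mollifyData_eq hn hs φ hρ
  obtain ⟨γ₁, hγ₁, B₁, w₀, hw₀⟩ := hg₁.exists_mollifyData_eq hn hs φ hρ
  obtain ⟨-, γ₂, hγ₂, B₂, hB₂, hfd⟩ := hf.exists_decay hn hs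
  -- A common decay rate, independent of ε, for the source and both initial data.
  set γ := min γ₀ (min γ₁ γ₂)
  have hγ : 0 < γ := lt_min hγ₀ (lt_min hγ₁ hγ₂)
  obtain ⟨D, hD, hDb⟩ := exists_sourceSymbol_le hn hs hT hf ψ φ hρ hB₂ fun t ht =>
    (hfd t ht).weaken (γ' := γ) ((min_le_right _ _).trans (min_le_right _ _))
  have hv₀d : ∀ ε ∈ Ioc (0 : ℝ) 1, HasGevreyDecay s γ B₀ (v₀ ε) := fun ε hε =>
    (hv₀ ε hε).2.1.weaken (min_le_left _ _)
  have hw₀d : ∀ ε ∈ Ioc (0 : ℝ) 1, HasGevreyDecay s γ B₁ (w₀ ε) := fun ε hε =>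
    (hw₀ ε hε).2.1.weaken ((min_le_right _ _).trans (min_le_left _ _))
  obtain ⟨v, w, B, hsym, hBb, hsol⟩ := H.exists_solution (mul_pos hθ hr) hθr hs hT hγ
    (fun ε hε => (hv₀ ε hε).1) (fun ε hε => (hw₀ ε hε).1)
    (fun ε hε => continuous_sourceSymbol hn hs hT.le hf ψ.contDiff ψ.hasCompactSupport (hρ.pos hε))
    (fun ε hε => (hD ε hε).contDiffOn) (isTemperedNet_of_hasGevreyDecay hv₀d)
    (isTemperedNet_of_hasGevreyDecay hw₀d) (IsGevreySymbol.isTemperedNet hD hDb)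
  have hγ4 : 0 < γ / 2 / 2 := by positivity
  refine ⟨θ, hθ, hθ1, hθr1, reparam ε₀ θ, fun ε hε => reparam_mem h₀ h₁ hε.1,
    eventually_reparam_eq h₀, hμ.comp_reparam h₀ h₁ hθ hθ1, hνc.comp_reparam h₀ h₁ hθ hθ1,
    hνd.comp_reparam h₀ h₁ hθ hθ1, hνe.comp_reparam h₀ h₁ hθ hθ1, fun ε t => synth (v ε t),
    H.moderate_a, H.moderate_c, H.moderate_d, H.moderate_e, ?_, ?_, ?_, fun ε hε => ?_,
    isSmoothGevreyModerate_synth hT hs hγ4 hsym hBb⟩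
  · refine (isSmoothGevreyModerate_synth hT hs hγ hD hDb).congr fun ε hε => ?_
    rw [mollifySource_eq_synth hn hs hT hf ψ (hρ.pos hε)]
  · exact (isGevreyModerate_synth hs hγ hv₀d).congr fun ε hε => (hv₀ ε hε).2.2
  · exact (isGevreyModerate_synth hs hγ hw₀d).congr fun ε hε => (hw₀ ε hε).2.2
  · obtain ⟨hi, hi', hd1, hd2⟩ := hsol ε hε
    have key := solvesCauchyProblem_synth hT hs hγ4 (hsym ε hε) hd1 hd2
    rw [funext hi, funext hi'] at key
    rw [mollifySource_eq_synth hn hs hT hf ψ (hρ.pos hε), (hv₀ ε hε).2.2, (hw₀ ε hε).2.2]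
    exact key
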